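/- **Setting.** Let $d\ge 0$, $\delta>0$, let $\mathbb{R}^{d\times d}_{+,\mathrm{dia}}$ be the set of positive definite diagonal matrices and $\overline{\mathbb{R}^{d\times d}_{+,\mathrm{dia}}}$ its closure (positive semidefinite diagonal matrices). For a diagonal matrix $\sigma$ let $\mathcal N(0,\sigma^2)$ be the centered (possibly degenerate) Gaussian on $\mathbb{R}^d$ with covariance $\sigma^2$. Fix times $0\le \bar t_1<\dots<\bar t_I\le 1$, $I\ge 1$, and data $\bar\mu_i=\mathcal N(0,\bar\sigma_i^2)$ with $\bar\sigma_i\in\overline{\mathbb{R}^{d\times d}_{+,\mathrm{dia}}}$. No boundary conditions are imposed besides the interpolation constraints (natural boundary conditions). All limits $K\to\infty$ are along an arbitrary sequence of integers $K\ge 1$ tending to infinity with $K\bar t_i\in\mathbb{N}_0$ for all $i$. *Discrete energy.* $\mathcal W$ is the $L^2$-Wasserstein distance, and $\mathrm{Bar}(\mu,\nu)$ is a minimizer over probability measures $\rho$ of $\tfrac12\mathcal W^2(\rho,\mu)+\tfrac12\mathcal W^2(\rho,\nu)$ (if it is not unique, which can happen only if $\mu$ and $\nu$ are both degenerate, the infimum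 over all choices is taken in the next formula). For measures $\mu_0,\dots,\mu_K$ put $$\mathbf F^{\delta,K}(\mu_0,\dots,\mu_K)=4K^3\sum_{k=1}^{K-1}\mathcal W^2(\mu_k,\mathrm{Bar}(\mu_{k-1},\mu_{k+1}))+\delta K\sum_{k=0}^{K-1}\mathcal W^2(\mu_k,\mu_{k+1}).$$ *Continuous energy.* For a curve $(\mu_t)_{t\in(0,1)}$ of probability measures put $$\mathcal F^\delta=\inf_v\int_0^1\!\int\big|\partial_t v_t+\tfrac12\nabla|v_t|^2\big|^2 d\mu_t\,dt+\delta\inf_v\int_0^1\!\int|v_t|^2d\mu_t\,dt,$$ where the infima are over velocity fields $v$ with $\int_0^1\!\int|v_t|^2d\mu_t\,dt<\infty$, $\partial_t\mu_t+\nabla\cdot(v_t\mu_t)=0$ in the sense of distributions on $(0,1)\times\mathbb{R}^d$, and $v_t\in T_{\mu_t}=\overline{\{\nabla\varphi:\varphi\in C_c^\infty\}}^{L^2(\mu_t)}$ for a.e. $t$. The acceleration $a_t=\partial_t v_t+(v_t\cdot\nabla)v_t=\partial_tv_t+\tfrac12\nabla|v_t|^2$ is understood weakly, as a field $a$ with $\int_0^1\int|a_t|^2d\mu_t\,dt<\infty$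 and $\partial_t(\mu_t v_t)+\nabla\cdot(\mu_t v_t\otimes v_t)=\mu_t a_t$ in the sense of distributions (if there is none, $v$ is not admitted in the first infimum). *Extension.* For a tuple of diagonal matrices $(\sigma_0,\dots,\sigma_K)$ and $t_s=s/K$ let $\eta_{(\sigma_0,\dots,\sigma_K)}(t)$ be $\sigma_0+(\sigma_1-\sigma_0)Kt$ on $[0,t_{1/2}]$, $\sigma_{K-1}+(\sigma_K-\sigma_{K-1})K(t-t_{K-1})$ on $[t_{K-1/2},1]$, and $$\tfrac{\sigma_{k-1}+\sigma_k}{2}+(\sigma_k-\sigma_{k-1})K(t-t_{k-1/2})+(\sigma_{k+1}-2\sigma_k+\sigma_{k-1})K^2\tfrac{(t-t_{k-1/2})^2}{2}\quad\text{on }[t_{k-1/2},t_{k+1/2}],\ 1\le k\le K-1.$$ *Functionals.* Let $\mathcal C$ be $\overline{\mathbb{R}^{d\times d}_{+,\mathrm{dia}}}$ or $\mathbb{R}^{d\times d}_{+,\mathrm{dia}}$, and let $H^2((0,1);\mathcal C)$ be the set of diagonal-matrix-valued $H^2$ curves whose continuous representative on $[0,1]$ has values in $\mathcal C$. For $\sigma\in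 H^2((0,1);\mathcal C)$ let $\hat{\mathcal F}^{\delta}[\sigma]=\mathcal F^\delta((\mathcal N(0,\sigma_t^2))_t)$, and let $\mathcal I[\sigma]=0$ if $\mathcal N(0,\sigma_{\bar t_i}^2)=\bar\mu_i$ for all $i$, $\mathcal I[\sigma]=\infty$ otherwise. If $\sigma=\eta_{(\sigma_0,\dots,\sigma_K)}$ with $\sigma_k\in\mathcal C$, let $\hat{\mathcal F}^{\delta,K}[\sigma]=\mathbf F^{\delta,K}(\mathcal N(0,\sigma_0^2),\dots,\mathcal N(0,\sigma_K^2))$, and $\mathcal I^K[\sigma]=0$ if moreover $\mathcal N(0,\sigma_{K\bar t_i}^2)=\bar\mu_i$ for all $i$; in all other cases $\mathcal I^K[\sigma]=\infty$. **Theorem (Mosco convergence and convergence of discrete minimizers).** 1. For both choices of $\mathcal C$, $\hat{\mathcal F}^{\delta,K}+\mathcal I^K$ converges to $\hat{\mathcal F}^{\delta}+\mathcal I$ on $H^2((0,1);\mathcal C)$ in the sense of Mosco: whenever $\sigma^K\rightharpoonup\sigma$ weakly in $H^2$ (with $\sigma^K,\sigma\in H^2((0,1);\mathcal C)$), $\hat{\mathcal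 F}^{\delta}[\sigma]+\mathcal I[\sigma]\le\liminf_K(\hat{\mathcal F}^{\delta,K}[\sigma^K]+\mathcal I^K[\sigma^K])$; and every $\sigma\in H^2((0,1);\mathcal C)$ is the strong $H^2$ limit of some $\sigma^K\in H^2((0,1);\mathcal C)$ with $\limsup_K(\hat{\mathcal F}^{\delta,K}[\sigma^K]+\mathcal I^K[\sigma^K])\le\hat{\mathcal F}^{\delta}[\sigma]+\mathcal I[\sigma]$. 2. For $\mathcal C=\overline{\mathbb{R}^{d\times d}_{+,\mathrm{dia}}}$, every sequence $(\sigma^K)_K$ in $H^2((0,1);\mathcal C)$ with $\hat{\mathcal F}^{\delta,K}[\sigma^K]+\mathcal I^K[\sigma^K]$ uniformly bounded has a subsequence that converges weakly in $H^2$ to an element of $H^2((0,1);\mathcal C)$. 3. For $\mathcal C=\overline{\mathbb{R}^{d\times d}_{+,\mathrm{dia}}}$, every sequence $(\sigma^K)_K$ of minimizers of $\hat{\mathcal F}^{\delta,K}+\mathcal I^K$ over $H^2((0,1);\mathcal C)$ has a subsequence that converges weakly in $H^2$ to a minimizer of $\hat{\mathcal F}^{\delta}+\mathcal I$ over $H^2((0,1);\mathcal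 C)$. -/

import Mathlib

open MeasureTheory ProbabilityTheory Filter Topology Set
open scoped ENNReal ContDiff

namespace WassersteinSpline

noncomputable section

/-! ### Optimal transport on Euclidean space -/

/-- `ℝᵈ` with its Euclidean norm. -/
abbrev E (d : ℕ) : Type := EuclideanSpace ℝ (Fin d)

/-- The couplings of two measures. -/
def couplings {d : ℕ} (μ ν : Measure (E d)) : Set (Measure (E d × E d)) :=
  {P | P.map Prod.fst = μ ∧ P.map Prod.snd = ν}

/-- The squared `L²`-Wasserstein distance. -/
def wassersteinSq {d : ℕ} (μ ν : Measure (E d)) : ℝ≥0∞ :=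
  ⨅ P ∈ couplings μ ν, ∫⁻ z, edist z.1 z.2 ^ 2 ∂P

/-- The set of (midpoint) Wasserstein barycenters of `μ` and `ν`, i.e. of minimizers of
`ρ ↦ W²(ρ, μ) / 2 + W²(ρ, ν) / 2` over all probability measures. -/
def barycenters {d : ℕ} (μ ν : Measure (E d)) : Set (Measure (E d)) :=
  {ρ | IsProbabilityMeasure ρ ∧ ∀ ρ' : Measure (E d), IsProbabilityMeasure ρ' →
    wassersteinSq ρ μ / 2 + wassersteinSq ρ ν / 2 ≤
      wassersteinSq ρ' μ / 2 + wassersteinSq ρ' ν / 2}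

/-! ### Time-discrete energies; only the entries `μ 0, …, μ K` enter -/

/-- Discrete path energy `K ∑_{k=0}^{K-1} W²(μ_k, μ_{k+1})`. -/
def discretePathEnergy {d : ℕ} (K : ℕ) (μ : ℕ → Measure (E d)) : ℝ≥0∞ :=
  K * ∑ k ∈ Finset.range K, wassersteinSq (μ k) (μ (k + 1))

/-- Discrete spline energy `4 K³ ∑_{k=1}^{K-1} W²(μ_k, Bar(μ_{k-1}, μ_{k+1}))`. If the barycenter
is not unique (which can only happen for two degenerate measures), the one closest to `μ_k` is
taken. -/
def discreteSplineEnergy {d : ℕ} (K : ℕ) (μ : ℕ → Measure (E d)) : ℝ≥0∞ :=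
  4 * (K : ℝ≥0∞) ^ 3 * ∑ k ∈ Finset.Ico 1 K,
    ⨅ ρ ∈ barycenters (μ (k - 1)) (μ (k + 1)), wassersteinSq (μ k) ρ

/-- Regularized discrete spline energy. -/
def discreteRegEnergy {d : ℕ} (δ : ℝ) (K : ℕ) (μ : ℕ → Measure (E d)) : ℝ≥0∞ :=
  discreteSplineEnergy K μ + ENNReal.ofReal δ * discretePathEnergy K μ

/-! ### Time-continuous energies of curves `t ↦ μ t`, `t ∈ (0,1)`, of measures -/

/-- `∫₀¹ ∫ |w_t|² dμ_t dt`. -/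
def spaceTimeSq {d : ℕ} (μ : ℝ → Measure (E d)) (w : ℝ → E d → E d) : ℝ≥0∞ :=
  ∫⁻ t in Ioo (0 : ℝ) 1, ∫⁻ x, ‖w t x‖ₑ ^ 2 ∂(μ t)

/-- `w` belongs to the tangent space `T_μ`, the closure of `{∇φ : φ ∈ C_c^∞}` in `L²(μ; ℝᵈ)`. -/
def IsTangent {d : ℕ} (μ : Measure (E d)) (w : E d → E d) : Prop :=
  MemLp w 2 μ ∧ ∀ ε : ℝ≥0∞, 0 < ε → ∃ φ : E d → ℝ, ContDiff ℝ ∞ φ ∧ HasCompactSupport φ ∧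
    eLpNorm (fun x => w x - gradient φ x) 2 μ ≤ ε

/-- Test functions on `(0,1) × ℝᵈ`. -/
def IsSpaceTimeTest {d : ℕ} {F : Type*} [NormedAddCommGroup F] [NormedSpace ℝ F]
    (φ : ℝ × E d → F) : Prop :=
  ContDiff ℝ ∞ φ ∧ HasCompactSupport φ ∧ tsupport φ ⊆ Ioo (0 : ℝ) 1 ×ˢ univ

/-- `v` is a velocity field of finite energy of the curve `μ`: the continuity equation
`∂ₜ μ + ∇ · (v μ) = 0` holds in the sense of distributions on `(0,1) × ℝᵈ`. The integrand is
`∂ₜ φ + ⟨∇ φ, v⟩`. -/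
def IsVelocity {d : ℕ} (μ : ℝ → Measure (E d)) (v : ℝ → E d → E d) : Prop :=
  Measurable (Function.uncurry v) ∧ spaceTimeSq μ v < ⊤ ∧
    ∀ φ : ℝ × E d → ℝ, IsSpaceTimeTest φ →
      ∫ t in Ioo (0 : ℝ) 1, ∫ x, fderiv ℝ φ (t, x) ((1 : ℝ), v t x) ∂(μ t) = 0

/-- `v` is a velocity field with `v_t ∈ T_{μ_t}` for almost every `t`. -/
def IsTangentVelocity {d : ℕ} (μ : ℝ → Measure (E d)) (v : ℝ → E d → E d) : Prop :=
  IsVelocity μ v ∧ ∀ᵐ t ∂(volume.restrict (Ioo (0 : ℝ) 1)), IsTangent (μ t) (v t)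

/-- `a` is the acceleration `∂ₜ v + (v · ∇) v` (which is `∂ₜ v + ½ ∇ |v|²` for gradient fields) of
the velocity field `v` along `μ`. In view of the continuity equation this reads
`∂ₜ (μ v) + ∇ · (μ v ⊗ v) = μ a`, which is imposed in the sense of distributions
on `(0,1) × ℝᵈ` and makes sense without any regularity of `v` and `μ`. -/
def IsAcceleration {d : ℕ} (μ : ℝ → Measure (E d)) (v a : ℝ → E d → E d) : Prop :=
  Measurable (Function.uncurry a) ∧ spaceTimeSq μ a < ⊤ ∧
    ∀ ψ : ℝ × E d → E d, IsSpaceTimeTest ψ →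
      ∫ t in Ioo (0 : ℝ) 1, ∫ x,
        (inner ℝ (fderiv ℝ ψ (t, x) ((1 : ℝ), v t x)) (v t x) + inner ℝ (ψ (t, x)) (a t x))
          ∂(μ t) = 0

/-- Path energy: infimum of `∫₀¹ ∫ |v|² dμ_t dt` over all tangent velocity fields. -/
def pathEnergy {d : ℕ} (μ : ℝ → Measure (E d)) : ℝ≥0∞ :=
  ⨅ (v : ℝ → E d → E d) (_ : IsTangentVelocity μ v), spaceTimeSq μ v

/-- Spline energy: infimum of `∫₀¹ ∫ |∂ₜ v + ½ ∇ |v|²|² dμ_t dt` over all tangent velocity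
fields. -/
def splineEnergy {d : ℕ} (μ : ℝ → Measure (E d)) : ℝ≥0∞ :=
  ⨅ (v : ℝ → E d → E d) (a : ℝ → E d → E d) (_ : IsTangentVelocity μ v)
    (_ : IsAcceleration μ v a), spaceTimeSq μ a

/-- Regularized spline energy. -/
def regEnergy {d : ℕ} (δ : ℝ) (μ : ℝ → Measure (E d)) : ℝ≥0∞ :=
  splineEnergy μ + ENNReal.ofReal δ * pathEnergy μ

/-! ### Centered Gaussians with diagonal covariance

A diagonal matrix is identified with the vector of its diagonal entries; the Frobenius norm becomes
the Euclidean norm. -/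

/-- The Gaussian `N(0, σ²)` with diagonal standard deviation matrix `σ = diag(s)`. -/
def diagGaussian {d : ℕ} (s : E d) : Measure (E d) :=
  multivariateGaussian 0 (Matrix.diagonal (fun j => s j) ^ 2)

/-- Positive definite diagonal matrices. -/
def posDiag (d : ℕ) : Set (E d) := {s | ∀ j, 0 < s j}

/-- The closure of `posDiag d`: positive semidefinite diagonal matrices. -/
def nonnegDiag (d : ℕ) : Set (E d) := {s | ∀ j, 0 ≤ s j}

/-! ### The Hilbert space `H²((0,1))` of curves of diagonal matrices -/

/-- `L²((0,1); ℝᵈ)`. -/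
abbrev L2 (d : ℕ) : Type := Lp (E d) 2 (volume.restrict (Ioo (0 : ℝ) 1))

/-- `g` is the weak derivative of `u` on `(0,1)`. -/
def HasWeakDeriv {d : ℕ} (u g : L2 d) : Prop :=
  ∀ φ : ℝ → ℝ, ContDiff ℝ ∞ φ → HasCompactSupport φ → tsupport φ ⊆ Ioo (0 : ℝ) 1 →
    ∫ t in Ioo (0 : ℝ) 1, deriv φ t • u t = -∫ t in Ioo (0 : ℝ) 1, φ t • g t

theorem integrable_smul_L2 {d : ℕ} {f : ℝ → ℝ} (hf : Continuous f) (hc : HasCompactSupport f)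
    (u : L2 d) : Integrable (fun t => f t • u t) (volume.restrict (Ioo (0 : ℝ) 1)) := by
  obtain ⟨C, hC⟩ := hc.exists_bound_of_continuous hf
  exact ((Lp.memLp u).integrable (by norm_num)).bdd_smul C hf.aestronglyMeasurable
    (Eventually.of_forall hC)

theorem hasWeakDeriv_zero (d : ℕ) : HasWeakDeriv (0 : L2 d) 0 := by
  intro φ _ _ _
  have h0 : ∀ f : ℝ → ℝ, ∫ t in Ioo (0 : ℝ) 1, f t • (0 : L2 d) t = 0 := by
    intro f
    refine integral_eq_zero_of_ae ?_
    filter_upwards [Lp.coeFn_zero (E d) 2 (volume.restrict (Ioo (0 : ℝ) 1))] with t ht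
    rw [ht]; simp
  rw [h0, h0, neg_zero]

theorem HasWeakDeriv.add {d : ℕ} {u g u' g' : L2 d} (h : HasWeakDeriv u g)
    (h' : HasWeakDeriv u' g') : HasWeakDeriv (u + u') (g + g') := by
  intro φ hφ hc hs
  have hadd : ∀ (f : ℝ → ℝ), Continuous f → HasCompactSupport f → ∀ w w' : L2 d,
      ∫ t in Ioo (0 : ℝ) 1, f t • (w + w') t =
        (∫ t in Ioo (0 : ℝ) 1, f t • w t) + ∫ t in Ioo (0 : ℝ) 1, f t • w' t := by
    intro f hf hfc w w'
    rw [← integral_add (integrable_smul_L2 hf hfc w) (integrable_smul_L2 hf hfc w')]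
    refine integral_congr_ae ?_
    filter_upwards [Lp.coeFn_add w w'] with t ht
    rw [ht]; simp [smul_add]
  rw [hadd _ (hφ.continuous_deriv (by simp)) hc.deriv, hadd _ hφ.continuous hc,
    h φ hφ hc hs, h' φ hφ hc hs, neg_add]

theorem HasWeakDeriv.smul {d : ℕ} {u g : L2 d} (r : ℝ) (h : HasWeakDeriv u g) :
    HasWeakDeriv (r • u) (r • g) := by
  intro φ hφ hc hs
  have hsm : ∀ (f : ℝ → ℝ) (w : L2 d),
      ∫ t in Ioo (0 : ℝ) 1, f t • (r • w) t = r • ∫ t in Ioo (0 : ℝ) 1, f t • w t := by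
    intro f w
    rw [← integral_smul]
    refine integral_congr_ae ?_
    filter_upwards [Lp.coeFn_smul r w] with t ht
    rw [ht]; simp [smul_comm r]
  rw [hsm, hsm, h φ hφ hc hs, smul_neg]

/-- `H²((0,1); ℝᵈ)`, as the space of triples `(u, u', u'')` in `L²` with `u'` and `u''` the first
and second weak derivative of `u`, with the norm `(‖u‖² + ‖u'‖² + ‖u''‖²)^{1/2}`. -/
def H2 (d : ℕ) : Submodule ℝ (PiLp 2 (fun _ : Fin 3 => L2 d)) where
  carrier := {w | HasWeakDeriv (w 0) (w 1) ∧ HasWeakDeriv (w 1) (w 2)}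
  zero_mem' := ⟨hasWeakDeriv_zero d, hasWeakDeriv_zero d⟩
  add_mem' := fun ha hb => ⟨ha.1.add hb.1, ha.2.add hb.2⟩
  smul_mem' := fun r _ ha => ⟨ha.1.smul r, ha.2.smul r⟩

/-- The underlying function of an element of `H²`, determined up to a null set. -/
def H2.fn {d : ℕ} (u : H2 d) : ℝ → E d := (u.1 0 : L2 d)

/-- `c` is, on `[0,1]`, the continuous representative of `u`. -/
def IsContRep {d : ℕ} (u : H2 d) (c : ℝ → E d) : Prop :=
  ContinuousOn c (Icc 0 1) ∧ ∀ᵐ t ∂(volume.restrict (Ioo (0 : ℝ) 1)), H2.fn u t = c t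

/-- `H²((0,1); C)`: the curves in `H²` with values in `C`. -/
def H2Curves {d : ℕ} (C : Set (E d)) : Set (H2 d) :=
  {u | ∃ c, IsContRep u c ∧ ∀ t ∈ Icc (0 : ℝ) 1, c t ∈ C}

/-- Weak convergence of sequences in `H²`. -/
def WeakTendsto {d : ℕ} (w : ℕ → H2 d) (u : H2 d) : Prop :=
  Tendsto (fun n => toWeakSpace ℝ (H2 d) (w n)) atTop (𝓝 (toWeakSpace ℝ (H2 d) u))

/-- Mosco convergence (weak `liminf` and strong `limsup` inequality) of functionals defined on a
subset of `H²`. -/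
def MoscoTendsto {d : ℕ} {X : Set (H2 d)} (G : ℕ → X → ℝ≥0∞) (G₀ : X → ℝ≥0∞) : Prop :=
  (∀ (u : X) (w : ℕ → X), WeakTendsto (fun n => (w n : H2 d)) u →
    G₀ u ≤ liminf (fun n => G n (w n)) atTop) ∧
  ∀ u : X, ∃ w : ℕ → X, Tendsto (fun n => (w n : H2 d)) atTop (𝓝 (u : H2 d)) ∧
    limsup (fun n => G n (w n)) atTop ≤ G₀ u

/-! ### Temporal extension and the functionals on `H²` -/

/-- The piecewise cubic Hermite temporal extension `η` of `(x 0, …, x K)`, with `t_s = s / K`: affine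
on `[0, t_{1/2}]` and on `[t_{K-1/2}, 1]`; on `[t_{k-1/2}, t_{k+1/2}]`, `k = 1, …, K-1`, the
quadratic polynomial given in the last lines. -/
def hermite {d : ℕ} (K : ℕ) (x : ℕ → E d) (t : ℝ) : E d :=
  if t ≤ 1 / (2 * (K : ℝ)) then x 0 + (K * t) • (x 1 - x 0)
  else if 1 - 1 / (2 * (K : ℝ)) ≤ t then
    x (K - 1) + (K * (t - ((K : ℝ) - 1) / K)) • (x K - x (K - 1))
  else
    let k : ℕ := ⌊K * t + 1 / 2⌋₊
    let τ : ℝ := t - ((k : ℝ) - 1 / 2) / K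
    (1 / 2 : ℝ) • (x (k - 1) + x k) + (K * τ) • (x k - x (k - 1))
      + ((K : ℝ) ^ 2 * (τ ^ 2 / 2)) • (x (k + 1) - (2 : ℝ) • x k + x (k - 1))

/-- `u = η_{(x 0, …, x K)}` with `x 0, …, x K ∈ C`. -/
def IsExtension {d : ℕ} (C : Set (E d)) (K : ℕ) (x : ℕ → E d) (u : H2 d) : Prop :=
  (∀ k ≤ K, x k ∈ C) ∧ ∀ᵐ t ∂(volume.restrict (Ioo (0 : ℝ) 1)), H2.fn u t = hermite K x t

/-- The regularized discrete spline energy as a functional on curves: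
`𝐅^{δ,K}(N(0, x_0²), …, N(0, x_K²))` if `u = η_{(x_0, …, x_K)}` (and `⊤ = ∞` if `u` is no such
extension). -/
def discreteEnergyHat {d : ℕ} (C : Set (E d)) (δ : ℝ) (K : ℕ) (u : H2 d) : ℝ≥0∞ :=
  ⨅ (x : ℕ → E d) (_ : IsExtension C K x u), discreteRegEnergy δ K (fun k => diagGaussian (x k))

/-- The regularized spline energy of the curve `t ↦ N(0, u(t)²)`. -/
def energyHat {d : ℕ} (δ : ℝ) (u : H2 d) : ℝ≥0∞ :=
  regEnergy δ (fun t => diagGaussian (H2.fn u t))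

open Classical in
/-- Indicator of the discrete constraints: `u = η_{(x_0, …, x_K)}` for a tuple with
`N(0, x_{K t_i}²) = μ_i` for all `i`. -/
def discreteIndicator {d I : ℕ} (C : Set (E d)) (t : Fin I → ℝ) (μ : Fin I → Measure (E d)) (K : ℕ)
    (u : H2 d) : ℝ≥0∞ :=
  if ∃ x : ℕ → E d, IsExtension C K x u ∧
      ∀ (i : Fin I) (k : ℕ), (k : ℝ) = K * t i → diagGaussian (x k) = μ i
  then 0 else ⊤

open Classical in
/-- Indicator of the constraints `N(0, u(t_i)²) = μ_i` for all `i`. -/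
def constraintIndicator {d I : ℕ} (t : Fin I → ℝ) (μ : Fin I → Measure (E d)) (u : H2 d) : ℝ≥0∞ :=
  if ∃ c, IsContRep u c ∧ ∀ i, diagGaussian (c (t i)) = μ i then 0 else ⊤

/-- Discrete energy plus discrete constraint indicator on `H²((0,1); C)`. -/
def discreteFunctional {d I : ℕ} (C : Set (E d)) (δ : ℝ) (t : Fin I → ℝ)
    (μ : Fin I → Measure (E d)) (K : ℕ) (u : H2Curves C) : ℝ≥0∞ :=
  discreteEnergyHat C δ K (u : H2 d) + discreteIndicator C t μ K u

/-- Continuous energy plus constraint indicator on `H²((0,1); C)`. -/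
def continuousFunctional {d I : ℕ} (C : Set (E d)) (δ : ℝ) (t : Fin I → ℝ)
    (μ : Fin I → Measure (E d)) (u : H2Curves C) : ℝ≥0∞ :=
  energyHat δ (u : H2 d) + constraintIndicator t μ u

end

end WassersteinSpline

open WassersteinSpline

namespace WassersteinSpline

/-! ### One-dimensional Sobolev functions -/

/-! On centered diagonal Gaussians the problem becomes a quadratic one in the standard deviations.
Pushing one standard Gaussian forward by `scale s` and by `scale t` gives a coupling of cost `‖s -
t‖ ^ 2`. The reverse triangle inequality in `L²` of any coupling, applied to each coordinate, shows
that it is optimal. That lower bound sees only the `L²` norms of the coordinates, so it holds for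
arbitrary competitors. By the parallelogram law the midpoint Gaussian is a barycenter, and every
other barycenter has the same coordinate norms, which settles the degenerate case. The discrete
energy is therefore `K³ ∑ |second difference|² + δ K ∑ |first difference|²`
(`discreteRegEnergy_diagGaussian`).

The continuous energy equals `‖σ''‖² + δ ‖σ'‖²` in `L²` (`energyHat_eq`). In Lagrangian coordinates
the curve is the image of the standard Gaussian under `z ↦ σ_t z`, and `diag(σ'/σ) x` is its tangent
velocity, unique because a tangent field orthogonal to all gradients vanishes. The field
`diag(σ''/σ) x` is an acceleration. Any other acceleration differs from it by a field orthogonal to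
linear diagonal fields, so it has at least the same energy. Degenerate times are harmless: a
nonnegative entry has zero derivative at an interior zero, and zero second derivative at almost
every zero.

The extension `η` is chosen so that `‖η''‖²` is exactly the discrete spline energy, while convexity
gives `‖η'‖²` at most the discrete path energy (`ofReal_energy_le_discreteFunctional`). With weak
lower semicontinuity this yields the liminf inequality. The constraints survive in the limit because
`η` misses a node by an eighth of a second difference, which bounded energy forces to zero.
Conversely, sampling `σ` at `k / K` keeps the constraints and does not increase the energy, by
Cauchy–Schwarz (`exists_sampling`). The extensions of the samples converge uniformly to `σ`, and
their norms are asymptotically at most that of `σ`, so they converge strongly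
(`tendsto_of_sampling`).

For compactness the energy bounds the derivatives, and a single interpolation constraint bounds the
curve itself. Minimizers converge by the usual argument; squared Lagrange polynomials supply a
competitor with energy bounded uniformly in `K`. -/

theorem integral_Ioo_eq_intervalIntegral {F : Type*} [NormedAddCommGroup F] [NormedSpace ℝ F]
    (f : ℝ → F) : ∫ t in Ioo (0 : ℝ) 1, f t = ∫ t in (0 : ℝ)..1, f t := by
  rw [intervalIntegral.integral_of_le zero_le_one, integral_Ioc_eq_integral_Ioo]

theorem intervalIntegrable_of_integrable_Ioo {F : Type*} [NormedAddCommGroup F]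
    {f : ℝ → F} (hf : Integrable f (volume.restrict (Ioo (0 : ℝ) 1))) {a b : ℝ}
    (ha : a ∈ Icc (0 : ℝ) 1) (hb : b ∈ Icc (0 : ℝ) 1) : IntervalIntegrable f volume a b := by
  have h : IntervalIntegrable f volume 0 1 :=
    (intervalIntegrable_iff_integrableOn_Ioo_of_le zero_le_one).2 hf
  refine h.mono_set ?_
  rw [uIcc_of_le (zero_le_one' ℝ)]
  exact uIcc_subset_Icc ha hb

theorem integrable_Ioo_of_continuous {F : Type*} [NormedAddCommGroup F] [NormedSpace ℝ F]
    {f : ℝ → F} (hf : Continuous f) : Integrable f (volume.restrict (Ioo (0 : ℝ) 1)) :=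
  (hf.integrableOn_Icc (a := 0) (b := 1)).mono_set Ioo_subset_Icc_self

/-- The primitive of a merely integrable `g` is only absolutely continuous, so the product rule is
used in that class. The constant `a` contributes nothing because `f` vanishes at both ends. -/
theorem integral_deriv_mul_primitive {f f' g : ℝ → ℝ} (hf : ∀ t, HasDerivAt f (f' t) t)
    (hf' : Continuous f') (h0 : f 0 = 0) (h1 : f 1 = 0)
    (hg : Integrable g (volume.restrict (Ioo (0 : ℝ) 1))) (a : ℝ) :
    ∫ t in Ioo (0 : ℝ) 1, (f' t * (a + ∫ s in (0 : ℝ)..t, g s) + f t * g t) = 0 := by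
  have hgi : IntervalIntegrable g volume 0 1 :=
    intervalIntegrable_of_integrable_Ioo hg (by simp) (by simp)
  have hf'i : IntervalIntegrable f' volume 0 1 := hf'.intervalIntegrable _ _
  set G : ℝ → ℝ := fun t => ∫ s in (0 : ℝ)..t, g s with hG
  have hGc : ContinuousOn G (uIcc 0 1) :=
    intervalIntegral.continuousOn_primitive_interval' hgi (by simp)
  have hfc : ContDiff ℝ 1 f := by
    rw [contDiff_one_iff_deriv]
    refine ⟨fun t => (hf t).differentiableAt, ?_⟩
    rwa [show deriv f = f' from funext fun t => (hf t).deriv]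
  have hfac : AbsolutelyContinuousOnInterval f 0 1 :=
    ContDiffOn.absolutelyContinuousOnInterval (E := ℝ) hfc.contDiffOn
  have hGac : AbsolutelyContinuousOnInterval G 0 1 :=
    hgi.absolutelyContinuousOnInterval_intervalIntegral (by simp)
  have key := AbsolutelyContinuousOnInterval.integral_deriv_mul_eq_sub hfac hGac
  rw [h0, h1, zero_mul, zero_mul, sub_zero] at key
  have hcong : ∫ t in (0 : ℝ)..1, (f' t * G t + f t * g t) = 0 := by
    refine Eq.trans ?_ key
    refine intervalIntegral.integral_congr_ae ?_
    filter_upwards [hgi.ae_hasDerivAt_integral] with t ht hmem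
    rw [(hf t).deriv, (ht (uIoc_subset_uIcc hmem) 0 (by simp)).deriv]
  have hca : ∫ t in (0 : ℝ)..1, f' t * a = 0 := by
    rw [intervalIntegral.integral_mul_const,
      intervalIntegral.integral_eq_sub_of_hasDerivAt (fun t _ => hf t) hf'i, h0, h1]
    simp
  rw [integral_Ioo_eq_intervalIntegral]
  have h3 : IntervalIntegrable (fun t => f' t * G t + f t * g t) volume 0 1 :=
    (hf'i.mul_continuousOn hGc).add (hgi.continuousOn_mul hfc.continuous.continuousOn)
  have h4 : IntervalIntegrable (fun t => f' t * a) volume 0 1 := hf'i.mul_const a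
  calc _ = ∫ t in (0 : ℝ)..1, ((f' t * a) + (f' t * G t + f t * g t)) := by
        congr 1; ext t; ring
    _ = 0 := by rw [intervalIntegral.integral_add h4 h3, hca, hcong, add_zero]

theorem integral_coord {d : ℕ} {α : Type*} [MeasurableSpace α] {μ : Measure α} {f : α → E d}
    (hf : Integrable f μ) (j : Fin d) : (∫ t, f t ∂μ) j = ∫ t, f t j ∂μ :=
  ((EuclideanSpace.proj (𝕜 := ℝ) j).integral_comp_comm hf).symm

theorem intervalIntegral_coord {d : ℕ} {f : ℝ → E d} {a b : ℝ}
    (hf : IntervalIntegrable f volume a b) (j : Fin d) :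
    (∫ t in a..b, f t) j = ∫ t in a..b, f t j :=
  ((EuclideanSpace.proj (𝕜 := ℝ) j).intervalIntegral_comp_comm hf).symm

theorem integrable_coord {d : ℕ} {α : Type*} [MeasurableSpace α] {μ : Measure α} {f : α → E d}
    (hf : Integrable f μ) (j : Fin d) : Integrable (fun t => f t j) μ :=
  (EuclideanSpace.proj (𝕜 := ℝ) j).integrable_comp hf

/-- Integration by parts against the primitive of an integrable vector-valued function. -/
theorem integral_deriv_smul_primitive {d : ℕ} {f : ℝ → ℝ} (hf : ContDiff ℝ 1 f)
    (h0 : f 0 = 0) (h1 : f 1 = 0) {g : ℝ → E d}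
    (hg : Integrable g (volume.restrict (Ioo (0 : ℝ) 1))) (a : E d) :
    ∫ t in Ioo (0 : ℝ) 1, deriv f t • (a + ∫ s in (0 : ℝ)..t, g s) =
      -∫ t in Ioo (0 : ℝ) 1, f t • g t := by
  have hgi : IntervalIntegrable g volume 0 1 :=
    intervalIntegrable_of_integrable_Ioo hg (by simp) (by simp)
  have hGc : ContinuousOn (fun t => ∫ s in (0 : ℝ)..t, g s) (uIcc 0 1) :=
    intervalIntegral.continuousOn_primitive_interval' hgi (by simp)
  have hd : Continuous (deriv f) := hf.continuous_deriv (by simp)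
  have i1 : Integrable (fun t => deriv f t • (a + ∫ s in (0 : ℝ)..t, g s))
      (volume.restrict (Ioo (0 : ℝ) 1)) := by
    have hc : ContinuousOn (fun t => deriv f t • (a + ∫ s in (0 : ℝ)..t, g s)) (Icc 0 1) := by
      rw [uIcc_of_le (zero_le_one' ℝ)] at hGc
      exact hd.continuousOn.smul (continuousOn_const.add hGc)
    exact (hc.integrableOn_Icc).mono_set Ioo_subset_Icc_self
  have i2 : Integrable (fun t => f t • g t) (volume.restrict (Ioo (0 : ℝ) 1)) := by
    have := (hgi.continuousOn_smul (f := f) hf.continuous.continuousOn)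
    exact (intervalIntegrable_iff_integrableOn_Ioo_of_le zero_le_one).1 this
  rw [eq_neg_iff_add_eq_zero, ← integral_add i1 i2]
  ext j
  have i3 : Integrable (fun t => deriv f t • (a + ∫ s in (0 : ℝ)..t, g s) + f t • g t)
      (volume.restrict (Ioo (0 : ℝ) 1)) := i1.add i2
  rw [integral_coord i3]
  have := integral_deriv_mul_primitive (f := f) (f' := deriv f) (g := fun t => g t j)
    (fun t => (hf.differentiable (by simp) t).hasDerivAt) hd h0 h1 (integrable_coord hg j) (a j)
  simp only [PiLp.zero_apply]
  refine Eq.trans ?_ this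
  refine setIntegral_congr_fun measurableSet_Ioo fun t ht => ?_
  simp only [PiLp.add_apply, PiLp.smul_apply, smul_eq_mul]
  rw [intervalIntegral_coord (intervalIntegrable_of_integrable_Ioo hg (by simp)
    (Ioo_subset_Icc_self ht))]

theorem exists_Icc_of_isCompact_subset_Ioo {s : Set ℝ} (hs : IsCompact s)
    (h : s ⊆ Ioo (0 : ℝ) 1) : ∃ a b : ℝ, 0 < a ∧ a < b ∧ b < 1 ∧ s ⊆ Icc a b := by
  rcases s.eq_empty_or_nonempty with rfl | hne
  · exact ⟨1 / 3, 1 / 2, by norm_num, by norm_num, by norm_num, by simp⟩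
  obtain ⟨a, ha, ha'⟩ := hs.exists_isLeast hne
  obtain ⟨b, hb, hb'⟩ := hs.exists_isGreatest hne
  -- Halving the left end keeps the interval nondegenerate even when the set is a single point.
  refine ⟨a / 2, b, by linarith [(h ha).1], ?_, (h hb).2, fun x hx => ⟨?_, hb' hx⟩⟩
  · linarith [ha' hb, (h ha).1]
  · linarith [ha' hx, (h ha).1]

theorem eq_zero_of_tsupport_subset_Ioo {F : Type*} [Zero F] {φ : ℝ → F}
    (hs : tsupport φ ⊆ Ioo (0 : ℝ) 1) {t : ℝ} (ht : t ∉ Ioo (0 : ℝ) 1) : φ t = 0 :=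
  image_eq_zero_of_notMem_tsupport fun h => ht (hs h)

/-- A test function of mean zero on `(0,1)` is the derivative of a test function. -/
theorem exists_test_primitive {ψ : ℝ → ℝ} (hψ : ContDiff ℝ ∞ ψ) (hc : HasCompactSupport ψ)
    (hs : tsupport ψ ⊆ Ioo (0 : ℝ) 1) (h0 : ∫ t in Ioo (0 : ℝ) 1, ψ t = 0) :
    ∃ φ : ℝ → ℝ, ContDiff ℝ ∞ φ ∧ HasCompactSupport φ ∧ tsupport φ ⊆ Ioo (0 : ℝ) 1 ∧
      deriv φ = ψ := by
  obtain ⟨a, b, ha, hab, hb, hsub⟩ := exists_Icc_of_isCompact_subset_Ioo hc hs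
  have hder : ∀ t, HasDerivAt (fun t => ∫ s in (0 : ℝ)..t, ψ s) (ψ t) t := fun t =>
    intervalIntegral.integral_hasDerivAt_right (hψ.continuous.intervalIntegrable _ _)
      hψ.continuous.stronglyMeasurable.stronglyMeasurableAtFilter hψ.continuous.continuousAt
  have hzero : ∀ t, t ∉ Icc a b → ψ t = 0 := fun t ht =>
    image_eq_zero_of_notMem_tsupport fun h => ht (hsub h)
  have hts : tsupport (fun t => ∫ s in (0 : ℝ)..t, ψ s) ⊆ Icc a b := by
    refine closure_minimal ?_ isClosed_Icc
    intro t ht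
    by_contra hmem
    apply ht
    rw [mem_Icc, not_and_or, not_le, not_le] at hmem
    rcases hmem with h | h
    · refine intervalIntegral.integral_zero_ae (Eventually.of_forall fun s hs' => ?_)
      refine hzero s fun hs2 => ?_
      replace hs' := uIoc_subset_uIcc hs'
      rcases le_max_iff.1 hs'.2 with h' | h' <;> linarith [hs2.1]
    -- To the right of the support the primitive has already collected the whole mean of `ψ`, which
    -- is zero.
    · have e1 : ∫ s in t..1, ψ s = 0 := by
        refine intervalIntegral.integral_zero_ae (Eventually.of_forall fun s hs' => ?_)
        refine hzero s fun hs2 => ?_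
        rcases min_le_iff.1 (uIoc_subset_uIcc hs').1 with h' | h' <;> linarith [hs2.2]
      have e2 := intervalIntegral.integral_add_adjacent_intervals
        (hψ.continuous.intervalIntegrable (μ := volume) 0 t)
        (hψ.continuous.intervalIntegrable (μ := volume) t 1)
      rw [e1, add_zero, ← integral_Ioo_eq_intervalIntegral, h0] at e2
      exact e2
  refine ⟨_, ?_, HasCompactSupport.of_support_subset_isCompact isCompact_Icc
    (subset_closure.trans hts), hts.trans (fun t ht => ⟨by linarith [ht.1], by linarith [ht.2]⟩),
    funext fun t => (hder t).deriv⟩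
  rw [contDiff_infty_iff_deriv]
  refine ⟨fun t => (hder t).differentiableAt, ?_⟩
  rwa [show deriv (fun t => ∫ s in (0 : ℝ)..t, ψ s) = ψ from funext fun t => (hder t).deriv]

theorem exists_test_integral_one : ∃ ρ : ℝ → ℝ, ContDiff ℝ ∞ ρ ∧ HasCompactSupport ρ ∧
    tsupport ρ ⊆ Ioo (0 : ℝ) 1 ∧ ∫ t in Ioo (0 : ℝ) 1, ρ t = 1 := by
  let b : ContDiffBump (1 / 2 : ℝ) := ⟨1 / 8, 1 / 4, by norm_num, by norm_num⟩
  have hts : tsupport (b.normed volume) ⊆ Ioo (0 : ℝ) 1 := by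
    rw [b.tsupport_normed_eq, Real.closedBall_eq_Icc]
    intro t ht
    constructor <;> [linarith [ht.1, show b.rOut = 1 / 4 from rfl];
      linarith [ht.2, show b.rOut = 1 / 4 from rfl]]
  refine ⟨b.normed volume, b.contDiff_normed, b.hasCompactSupport_normed, hts, ?_⟩
  rw [setIntegral_eq_integral_of_forall_compl_eq_zero, b.integral_normed]
  exact fun t ht => eq_zero_of_tsupport_subset_Ioo hts ht

/-- The lemma of du Bois-Reymond. -/
theorem ae_eq_const_of_integral_deriv_smul_eq_zero {d : ℕ} {w : ℝ → E d}
    (hw : Integrable w (volume.restrict (Ioo (0 : ℝ) 1)))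
    (h : ∀ φ : ℝ → ℝ, ContDiff ℝ ∞ φ → HasCompactSupport φ → tsupport φ ⊆ Ioo (0 : ℝ) 1 →
      ∫ t in Ioo (0 : ℝ) 1, deriv φ t • w t = 0) :
    ∃ C : E d, ∀ᵐ t ∂(volume.restrict (Ioo (0 : ℝ) 1)), w t = C := by
  obtain ⟨ρ, hρ, hρc, hρs, hρ1⟩ := exists_test_integral_one
  have hint : ∀ f : ℝ → ℝ, Continuous f → HasCompactSupport f →
      Integrable (fun t => f t • w t) (volume.restrict (Ioo (0 : ℝ) 1)) := by
    intro f hf hc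
    obtain ⟨C, hC⟩ := hc.exists_bound_of_continuous hf
    exact hw.bdd_smul C hf.aestronglyMeasurable (Eventually.of_forall hC)
  -- The constant is forced by testing against the unit-mass bump `ρ`. Subtracting `m * ρ` from a
  -- test function gives it mean zero and hence makes it a derivative.
  set C := ∫ t in Ioo (0 : ℝ) 1, ρ t • w t with hCdef
  have key := isOpen_Ioo.ae_eq_zero_of_integral_contDiff_smul_eq_zero (μ := (volume : Measure ℝ))
    (U := Ioo (0 : ℝ) 1) (f := fun t => w t - C) ?_ ?_
  · refine ⟨C, ?_⟩
    rw [ae_restrict_iff' measurableSet_Ioo]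
    filter_upwards [key] with t ht hmem
    exact sub_eq_zero.1 (ht hmem)
  · have : IntegrableOn (fun t => w t - C) (Ioo (0 : ℝ) 1) volume :=
      hw.sub (integrable_const C)
    exact this.locallyIntegrableOn
  · intro ψ hψ hc hs
    have hψi : Integrable ψ (volume.restrict (Ioo (0 : ℝ) 1)) :=
      integrable_Ioo_of_continuous hψ.continuous
    have hρi : Integrable ρ (volume.restrict (Ioo (0 : ℝ) 1)) :=
      integrable_Ioo_of_continuous hρ.continuous
    set m := ∫ t in Ioo (0 : ℝ) 1, ψ t with hm
    have hts : tsupport (ψ - fun t => m * ρ t) ⊆ Ioo (0 : ℝ) 1 := by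
      refine (tsupport_sub _ _).trans (union_subset hs ?_)
      exact (tsupport_mul_subset_right (f := fun _ => m) (g := ρ)).trans hρs
    obtain ⟨φ, h1, h2, h3, h4⟩ := exists_test_primitive (ψ := ψ - fun t => m * ρ t)
      (hψ.sub (contDiff_const.mul hρ)) (hc.sub hρc.mul_left) hts (by
        simp only [Pi.sub_apply]
        rw [integral_sub hψi (hρi.const_mul m), integral_const_mul, hρ1]; simp [hm])
    have := h φ h1 h2 h3
    rw [h4] at this
    rw [← setIntegral_eq_integral_of_forall_compl_eq_zero (s := Ioo (0 : ℝ) 1)]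
    · calc ∫ t in Ioo (0 : ℝ) 1, ψ t • (w t - C)
          = (∫ t in Ioo (0 : ℝ) 1, ψ t • w t) - ∫ t in Ioo (0 : ℝ) 1, ψ t • C := by
            rw [← integral_sub (hint ψ hψ.continuous hc) (hψi.smul_const C)]
            simp only [smul_sub]
        _ = (∫ t in Ioo (0 : ℝ) 1, ψ t • w t) - m • ∫ t in Ioo (0 : ℝ) 1, ρ t • w t := by
            rw [integral_smul_const]
        _ = ∫ t in Ioo (0 : ℝ) 1, (ψ - fun t => m * ρ t) t • w t := by
            have i4 : Integrable (fun t => m • ρ t • w t) (volume.restrict (Ioo (0 : ℝ) 1)) :=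
              (hint ρ hρ.continuous hρc).smul m
            rw [← integral_smul, ← integral_sub (hint ψ hψ.continuous hc) i4]
            congr 1; ext1 t; simp [sub_smul, mul_smul]
        _ = 0 := this
    · intro t ht
      rw [eq_zero_of_tsupport_subset_Ioo hs ht, zero_smul]

theorem L2.integrable {d : ℕ} (u : L2 d) : Integrable u (volume.restrict (Ioo (0 : ℝ) 1)) :=
  (Lp.memLp u).integrable (by norm_num)

/-- The difference of `u` and the primitive of `g` has vanishing weak derivative, so it is constant
by du Bois-Reymond. -/
theorem HasWeakDeriv.ae_eq_primitive {d : ℕ} {u g : L2 d} (h : HasWeakDeriv u g) :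
    ∃ C : E d, ∀ᵐ t ∂(volume.restrict (Ioo (0 : ℝ) 1)), u t = C + ∫ s in (0 : ℝ)..t, g s := by
  have hg := L2.integrable g
  have hgi : IntervalIntegrable g volume 0 1 :=
    intervalIntegrable_of_integrable_Ioo hg (by simp) (by simp)
  have hGc : ContinuousOn (fun t => ∫ s in (0 : ℝ)..t, g s) (Icc 0 1) := by
    rw [← uIcc_of_le (zero_le_one' ℝ)]
    exact intervalIntegral.continuousOn_primitive_interval' hgi (by simp)
  have hGi : Integrable (fun t => ∫ s in (0 : ℝ)..t, g s) (volume.restrict (Ioo (0 : ℝ) 1)) :=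
    (hGc.integrableOn_Icc).mono_set Ioo_subset_Icc_self
  obtain ⟨C, hC⟩ := ae_eq_const_of_integral_deriv_smul_eq_zero
    (w := fun t => u t - ∫ s in (0 : ℝ)..t, g s) ((L2.integrable u).sub hGi) (by
      intro φ hφ hc hs
      have hd := hφ.continuous_deriv (by simp)
      have i1 := integrable_smul_L2 hd hc.deriv u
      have i2 : Integrable (fun t => deriv φ t • ∫ s in (0 : ℝ)..t, g s)
          (volume.restrict (Ioo (0 : ℝ) 1)) :=
        ((hd.continuousOn.smul hGc).integrableOn_Icc).mono_set Ioo_subset_Icc_self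
      have := integral_deriv_smul_primitive (hφ.of_le (by exact_mod_cast le_top))
        (eq_zero_of_tsupport_subset_Ioo hs (by simp))
        (eq_zero_of_tsupport_subset_Ioo hs (by simp)) hg 0
      simp only [zero_add] at this
      simp only [smul_sub]
      rw [integral_sub i1 i2, this, h φ hφ hc hs, sub_self])
  refine ⟨C, ?_⟩
  filter_upwards [hC] with t ht
  rw [← ht]; abel

theorem hasWeakDeriv_of_ae_eq_primitive {d : ℕ} {u g : L2 d} {C : E d}
    (h : ∀ᵐ t ∂(volume.restrict (Ioo (0 : ℝ) 1)), u t = C + ∫ s in (0 : ℝ)..t, g s) :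
    HasWeakDeriv u g := by
  intro φ hφ hc hs
  rw [← integral_deriv_smul_primitive (hφ.of_le (by exact_mod_cast le_top))
        (eq_zero_of_tsupport_subset_Ioo hs (by simp))
        (eq_zero_of_tsupport_subset_Ioo hs (by simp)) (L2.integrable g) C]
  refine integral_congr_ae ?_
  filter_upwards [h] with t ht
  rw [ht]

/-! ### Representatives of `H²` curves -/

/-- Cauchy–Schwarz for vector-valued integrals. The mean `m` is paired with itself, and Young's
inequality with weight equal to the total mass leaves half of `‖m‖ ^ 2` to absorb. -/
theorem sq_norm_integral_le {F : Type*} [NormedAddCommGroup F] [InnerProductSpace ℝ F]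
    [CompleteSpace F] {α : Type*} [MeasurableSpace α] {μ : Measure α}
    [IsFiniteMeasure μ] {f : α → F} (hf : MemLp f 2 μ) :
    ‖∫ x, f x ∂μ‖ ^ 2 ≤ μ.real univ * ∫ x, ‖f x‖ ^ 2 ∂μ := by
  rcases eq_or_ne μ 0 with rfl | hμ
  · simp
  have hV : 0 < μ.real univ := by
    rw [measureReal_def]
    exact ENNReal.toReal_pos (by simpa using hμ) (measure_ne_top _ _)
  set V := μ.real univ
  set m := ∫ x, f x ∂μ with hm
  have hfi : Integrable f μ := hf.integrable (by norm_num)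
  have hsq : Integrable (fun x => ‖f x‖ ^ 2) μ := hf.integrable_norm_pow (by norm_num)
  have h1 : ‖m‖ ^ 2 = ∫ x, inner ℝ m (f x) ∂μ := by
    rw [integral_inner hfi, ← hm, real_inner_self_eq_norm_sq]
  have h2 : ∫ x, inner ℝ m (f x) ∂μ ≤ ∫ x, (‖m‖ ^ 2 / (2 * V) + V / 2 * ‖f x‖ ^ 2) ∂μ := by
    refine integral_mono (hfi.const_inner m) ((integrable_const _).add (hsq.const_mul _)) ?_
    intro x
    have h3 := real_inner_le_norm m (f x)
    have h4 : ‖m‖ * ‖f x‖ ≤ ‖m‖ ^ 2 / (2 * V) + V / 2 * ‖f x‖ ^ 2 := by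
      have : 0 ≤ (‖m‖ - V * ‖f x‖) ^ 2 / (2 * V) := by positivity
      have e : (‖m‖ - V * ‖f x‖) ^ 2 / (2 * V)
          = ‖m‖ ^ 2 / (2 * V) + V / 2 * ‖f x‖ ^ 2 - ‖m‖ * ‖f x‖ := by
        field_simp; ring
      linarith
    exact h3.trans h4
  rw [integral_add (integrable_const _) (hsq.const_mul _), integral_const, integral_const_mul,
    ← h1, smul_eq_mul] at h2
  have e : V * (‖m‖ ^ 2 / (2 * V)) = ‖m‖ ^ 2 / 2 := by field_simp
  rw [e] at h2
  linarith

theorem L2.norm_sq {d : ℕ} (f : L2 d) : ‖f‖ ^ 2 = ∫ t in Ioo (0 : ℝ) 1, ‖f t‖ ^ 2 := by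
  rw [← real_inner_self_eq_norm_sq, L2.inner_def]
  simp only [real_inner_self_eq_norm_sq]

namespace H2

variable {d : ℕ}

/-- The second derivative, extended by zero. -/
noncomputable def acc (u : H2 d) : ℝ → E d := (Ioo (0 : ℝ) 1).indicator (u.1 2)

theorem stronglyMeasurable_acc (u : H2 d) : StronglyMeasurable (acc u) :=
  (Lp.stronglyMeasurable _).indicator measurableSet_Ioo

theorem acc_ae (u : H2 d) : ∀ᵐ t ∂(volume.restrict (Ioo (0 : ℝ) 1)), u.1 2 t = acc u t := by
  rw [ae_restrict_iff' measurableSet_Ioo]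
  exact Eventually.of_forall fun t ht => by rw [acc, indicator_of_mem ht]

theorem integrable_acc (u : H2 d) : Integrable (acc u) :=
  (integrable_indicator_iff measurableSet_Ioo).2 (L2.integrable _)

theorem memLp_acc (u : H2 d) : MemLp (acc u) 2 (volume.restrict (Ioo (0 : ℝ) 1)) :=
  (memLp_congr_ae (acc_ae u)).1 (Lp.memLp _)

theorem intervalIntegral_acc (u : H2 d) {t : ℝ} (ht : t ∈ Ioo (0 : ℝ) 1) :
    ∫ s in (0 : ℝ)..t, u.1 2 s = ∫ s in (0 : ℝ)..t, acc u s := by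
  refine intervalIntegral.integral_congr_ae (Eventually.of_forall fun s hs => ?_)
  rw [uIoc_of_le ht.1.le] at hs
  have hs' : s ∈ Ioo (0 : ℝ) 1 := ⟨hs.1, hs.2.trans_lt ht.2⟩
  rw [acc, indicator_of_mem hs']

/-- Extending the second derivative by zero makes `c1` continuous on all of `ℝ`, so `c` is
differentiable everywhere and no one-sided derivatives occur at the end points. -/
theorem exists_rep (u : H2 d) : ∃ c c1 : ℝ → E d,
    (∀ t, c1 t = c1 0 + ∫ s in (0 : ℝ)..t, acc u s) ∧ (∀ t, HasDerivAt c (c1 t) t) ∧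
    (∀ᵐ t ∂(volume.restrict (Ioo (0 : ℝ) 1)), u.1 0 t = c t) ∧
    ∀ᵐ t ∂(volume.restrict (Ioo (0 : ℝ) 1)), u.1 1 t = c1 t := by
  obtain ⟨A, hA⟩ := u.2.1.ae_eq_primitive
  obtain ⟨B, hB⟩ := u.2.2.ae_eq_primitive
  set c1 : ℝ → E d := fun t => B + ∫ s in (0 : ℝ)..t, acc u s with hc1
  have hc1c : Continuous c1 := continuous_const.add
    (intervalIntegral.continuous_primitive (fun a b => (integrable_acc u).intervalIntegrable) 0)
  have hv : ∀ᵐ t ∂(volume.restrict (Ioo (0 : ℝ) 1)), u.1 1 t = c1 t := by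
    filter_upwards [hB, ae_restrict_mem measurableSet_Ioo] with t ht hmem
    rw [ht, intervalIntegral_acc u hmem]
  refine ⟨fun t => A + ∫ s in (0 : ℝ)..t, c1 s, c1, fun t => by simp [hc1], fun t => ?_, ?_, hv⟩
  · exact (intervalIntegral.integral_hasDerivAt_right (hc1c.intervalIntegrable _ _)
      hc1c.stronglyMeasurable.stronglyMeasurableAtFilter hc1c.continuousAt).const_add A
  · filter_upwards [hA, ae_restrict_mem measurableSet_Ioo] with t ht hmem
    rw [ht]
    congr 1
    refine intervalIntegral.integral_congr_ae ?_
    rw [ae_restrict_iff' measurableSet_Ioo] at hv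
    filter_upwards [hv] with s hs hs'
    rw [uIoc_of_le hmem.1.le] at hs'
    exact hs ⟨hs'.1, hs'.2.trans_lt hmem.2⟩

/-- The continuously differentiable representative. -/
noncomputable def rep (u : H2 d) : ℝ → E d := (exists_rep u).choose

/-- The continuous representative of the derivative. -/
noncomputable def vel (u : H2 d) : ℝ → E d := (exists_rep u).choose_spec.choose

theorem vel_eq (u : H2 d) (t : ℝ) : vel u t = vel u 0 + ∫ s in (0 : ℝ)..t, acc u s :=
  (exists_rep u).choose_spec.choose_spec.1 t

theorem hasDerivAt_rep (u : H2 d) (t : ℝ) : HasDerivAt (rep u) (vel u t) t :=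
  (exists_rep u).choose_spec.choose_spec.2.1 t

theorem rep_ae (u : H2 d) : ∀ᵐ t ∂(volume.restrict (Ioo (0 : ℝ) 1)), u.1 0 t = rep u t :=
  (exists_rep u).choose_spec.choose_spec.2.2.1

theorem vel_ae (u : H2 d) : ∀ᵐ t ∂(volume.restrict (Ioo (0 : ℝ) 1)), u.1 1 t = vel u t :=
  (exists_rep u).choose_spec.choose_spec.2.2.2

theorem continuous_rep (u : H2 d) : Continuous (rep u) :=
  continuous_iff_continuousAt.2 fun t => (hasDerivAt_rep u t).continuousAt

theorem continuous_vel (u : H2 d) : Continuous (vel u) := by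
  rw [show vel u = _ from funext (vel_eq u)]
  exact continuous_const.add
    (intervalIntegral.continuous_primitive (fun a b => (integrable_acc u).intervalIntegrable) 0)

theorem isContRep_rep (u : H2 d) : IsContRep u (rep u) :=
  ⟨(continuous_rep u).continuousOn, rep_ae u⟩

theorem norm_sq_zero (u : H2 d) : ‖u.1 0‖ ^ 2 = ∫ t in Ioo (0 : ℝ) 1, ‖rep u t‖ ^ 2 := by
  rw [L2.norm_sq]
  exact integral_congr_ae ((rep_ae u).mono fun t ht => by simp only [ht])

theorem norm_sq_one (u : H2 d) : ‖u.1 1‖ ^ 2 = ∫ t in Ioo (0 : ℝ) 1, ‖vel u t‖ ^ 2 := by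
  rw [L2.norm_sq]
  exact integral_congr_ae ((vel_ae u).mono fun t ht => by simp only [ht])

theorem norm_sq_two (u : H2 d) : ‖u.1 2‖ ^ 2 = ∫ t in Ioo (0 : ℝ) 1, ‖acc u t‖ ^ 2 := by
  rw [L2.norm_sq]
  exact integral_congr_ae ((acc_ae u).mono fun t ht => by simp only [ht])

theorem norm_sq (u : H2 d) : ‖u‖ ^ 2 = ‖u.1 0‖ ^ 2 + ‖u.1 1‖ ^ 2 + ‖u.1 2‖ ^ 2 := by
  rw [show ‖u‖ = ‖u.1‖ from rfl, PiLp.norm_sq_eq_of_L2, Fin.sum_univ_three]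

end H2

theorem eqOn_Icc_of_ae_eq_Ioo {F : Type*} [TopologicalSpace F] [T2Space F] {f g : ℝ → F}
    (hf : ContinuousOn f (Icc 0 1)) (hg : ContinuousOn g (Icc 0 1))
    (h : ∀ᵐ t ∂(volume.restrict (Ioo (0 : ℝ) 1)), f t = g t) : EqOn f g (Icc 0 1) := by
  refine Measure.eqOn_Icc_of_ae_eq volume (zero_ne_one' ℝ) ?_ hf hg
  rw [← restrict_Ioo_eq_restrict_Icc]
  exact h

theorem IsContRep.eqOn {d : ℕ} {u : H2 d} {c : ℝ → E d} (h : IsContRep u c) :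
    EqOn c (H2.rep u) (Icc 0 1) := by
  refine eqOn_Icc_of_ae_eq_Ioo h.1 (H2.continuous_rep u).continuousOn ?_
  filter_upwards [h.2, H2.rep_ae u] with t h1 h2
  rw [← h1, ← h2]; rfl

theorem mem_H2Curves_iff {d : ℕ} {C : Set (E d)} {u : H2 d} :
    u ∈ H2Curves C ↔ ∀ t ∈ Icc (0 : ℝ) 1, H2.rep u t ∈ C := by
  constructor
  · rintro ⟨c, hc, h⟩ t ht
    rw [← hc.eqOn ht]; exact h t ht
  · exact fun h => ⟨_, H2.isContRep_rep u, h⟩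

theorem constraintIndicator_eq {d I : ℕ} {t : Fin I → ℝ} (ht : ∀ i, t i ∈ Icc (0 : ℝ) 1)
    (μ : Fin I → Measure (E d)) (u : H2 d) [Decidable (∀ i, diagGaussian (H2.rep u (t i)) = μ i)] :
    constraintIndicator t μ u =
      if ∀ i, diagGaussian (H2.rep u (t i)) = μ i then 0 else ⊤ := by
  have : (∃ c, IsContRep u c ∧ ∀ i, diagGaussian (c (t i)) = μ i) ↔
      ∀ i, diagGaussian (H2.rep u (t i)) = μ i :=
    ⟨fun ⟨c, hc, h⟩ i => by rw [← hc.eqOn (ht i)]; exact h i,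
      fun h => ⟨_, H2.isContRep_rep u, h⟩⟩
  simp only [constraintIndicator, this]

/-! ### Determination, construction and evaluation of `H²` curves -/

namespace H2

variable {d : ℕ}

/-- The weak derivatives carry no extra information: the first comes from uniqueness of classical
derivatives, the second from testing. This identifies a curve with the explicit spline. -/
theorem ext_rep {u v : H2 d} (h : EqOn (rep u) (rep v) (Icc 0 1)) : u = v := by
  have hv : ∀ t ∈ Ioo (0 : ℝ) 1, vel u t = vel v t := fun t ht => by
    refine (hasDerivAt_rep u t).unique ((hasDerivAt_rep v t).congr_of_eventuallyEq ?_)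
    filter_upwards [Icc_mem_nhds ht.1 ht.2] with s hs using h hs
  have e0 : u.1 0 = v.1 0 := by
    refine Lp.ext ?_
    filter_upwards [rep_ae u, rep_ae v, ae_restrict_mem measurableSet_Ioo] with t h1 h2 h3
    rw [h1, h2, h (Ioo_subset_Icc_self h3)]
  have e1 : u.1 1 = v.1 1 := by
    refine Lp.ext ?_
    filter_upwards [vel_ae u, vel_ae v, ae_restrict_mem measurableSet_Ioo] with t h1 h2 h3
    rw [h1, h2, hv t h3]
  have e2 : u.1 2 = v.1 2 := by
    have hwd : ∀ φ : ℝ → ℝ, ContDiff ℝ ∞ φ → HasCompactSupport φ → tsupport φ ⊆ Ioo (0 : ℝ) 1 →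
        ∫ t in Ioo (0 : ℝ) 1, φ t • (u.1 2) t = ∫ t in Ioo (0 : ℝ) 1, φ t • (v.1 2) t := by
      intro φ h1 h2 h3
      rw [← neg_inj, ← u.2.2 φ h1 h2 h3, ← v.2.2 φ h1 h2 h3, e1]
    have := isOpen_Ioo.ae_eq_zero_of_integral_contDiff_smul_eq_zero (μ := (volume : Measure ℝ))
      (U := Ioo (0 : ℝ) 1) (f := fun t => (u.1 2) t - (v.1 2) t) ?_ ?_
    · refine Lp.ext ?_
      rw [EventuallyEq, ae_restrict_iff' measurableSet_Ioo]
      filter_upwards [this] with t ht h3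
      exact sub_eq_zero.1 (ht h3)
    · have : IntegrableOn (fun t => (u.1 2) t - (v.1 2) t) (Ioo (0 : ℝ) 1) volume :=
        (L2.integrable _).sub (L2.integrable _)
      exact this.locallyIntegrableOn
    · intro φ h1 h2 h3
      rw [← setIntegral_eq_integral_of_forall_compl_eq_zero (s := Ioo (0 : ℝ) 1)
        (fun t ht => by rw [eq_zero_of_tsupport_subset_Ioo h3 ht, zero_smul])]
      simp only [smul_sub]
      rw [integral_sub (integrable_smul_L2 h1.continuous h2 _)
        (integrable_smul_L2 h1.continuous h2 _), hwd φ h1 h2 h3, sub_self]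
  refine Subtype.ext (PiLp.ext fun i => ?_)
  fin_cases i <;> assumption

/-- A twice differentiable curve with square integrable second derivative is in `H²`. -/
theorem exists_of_rep {c c1 g : ℝ → E d} (hg : MemLp g 2 (volume.restrict (Ioo (0 : ℝ) 1)))
    (hc1 : ∀ t ∈ Icc (0 : ℝ) 1, c1 t = c1 0 + ∫ s in (0 : ℝ)..t, g s)
    (hc : ∀ t, HasDerivAt c (c1 t) t) (hc1c : Continuous c1) :
    ∃ u : H2 d, EqOn (rep u) c (Icc 0 1) ∧ EqOn (vel u) c1 (Icc 0 1) ∧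
      ∀ᵐ t ∂(volume.restrict (Ioo (0 : ℝ) 1)), acc u t = g t := by
  have hcc : Continuous c := continuous_iff_continuousAt.2 fun t => (hc t).continuousAt
  have hmem : ∀ {f : ℝ → E d}, Continuous f → MemLp f 2 (volume.restrict (Ioo (0 : ℝ) 1)) := by
    intro f hf
    obtain ⟨M, hM⟩ := isCompact_Icc.exists_bound_of_continuousOn (s := Icc (0 : ℝ) 1)
      hf.continuousOn
    refine MemLp.of_bound hf.aestronglyMeasurable M ?_
    filter_upwards [ae_restrict_mem measurableSet_Ioo] with t ht using
      hM t (Ioo_subset_Icc_self ht)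
  have hprim : ∀ {f : ℝ → E d} (F : L2 d), (∀ᵐ t ∂(volume.restrict (Ioo (0 : ℝ) 1)), F t = f t) →
      ∀ t ∈ Ioo (0 : ℝ) 1, ∫ s in (0 : ℝ)..t, F s = ∫ s in (0 : ℝ)..t, f s := by
    intro f F h t ht
    refine intervalIntegral.integral_congr_ae ?_
    rw [ae_restrict_iff' measurableSet_Ioo] at h
    filter_upwards [h] with s hs hs'
    rw [uIoc_of_le ht.1.le] at hs'
    exact hs ⟨hs'.1, hs'.2.trans_lt ht.2⟩
  let U : PiLp 2 (fun _ : Fin 3 => L2 d) :=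
    WithLp.toLp 2 ![(hmem hcc).toLp c, (hmem hc1c).toLp c1, hg.toLp g]
  have hU : U ∈ H2 d := by
    constructor
    · refine hasWeakDeriv_of_ae_eq_primitive (C := c 0) ?_
      filter_upwards [(hmem hcc).coeFn_toLp, ae_restrict_mem measurableSet_Ioo] with t ht h1
      rw [hprim (U 1) (hmem hc1c).coeFn_toLp t h1]
      refine ht.trans ?_
      rw [intervalIntegral.integral_eq_sub_of_hasDerivAt (fun s _ => hc s)
        (hc1c.intervalIntegrable _ _)]
      abel
    · refine hasWeakDeriv_of_ae_eq_primitive (C := c1 0) ?_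
      filter_upwards [(hmem hc1c).coeFn_toLp, ae_restrict_mem measurableSet_Ioo] with t ht h1
      rw [hprim (U 2) hg.coeFn_toLp t h1]
      exact ht.trans (hc1 t (Ioo_subset_Icc_self h1))
  refine ⟨⟨U, hU⟩, ?_, ?_, ?_⟩
  · refine eqOn_Icc_of_ae_eq_Ioo (continuous_rep _).continuousOn hcc.continuousOn ?_
    filter_upwards [rep_ae ⟨U, hU⟩, (hmem hcc).coeFn_toLp] with t h1 h2
    rw [← h1]; exact h2
  · refine eqOn_Icc_of_ae_eq_Ioo (continuous_vel _).continuousOn hc1c.continuousOn ?_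
    filter_upwards [vel_ae ⟨U, hU⟩, (hmem hc1c).coeFn_toLp] with t h1 h2
    rw [← h1]; exact h2
  · filter_upwards [acc_ae ⟨U, hU⟩, hg.coeFn_toLp] with t h1 h2
    rw [← h1]; exact h2

theorem rep_sub_eq (u : H2 d) (a b : ℝ) : rep u b - rep u a = ∫ s in a..b, vel u s :=
  (intervalIntegral.integral_eq_sub_of_hasDerivAt (fun s _ => hasDerivAt_rep u s)
    ((continuous_vel u).intervalIntegrable _ _)).symm

theorem vel_sub_eq (u : H2 d) (a b : ℝ) : vel u b - vel u a = ∫ s in a..b, acc u s := by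
  rw [vel_eq u a, vel_eq u b, add_sub_add_left_eq_sub]
  exact intervalIntegral.integral_interval_sub_left (integrable_acc u).intervalIntegrable
    (integrable_acc u).intervalIntegrable

/-- The value at `s` is at most the value at `t` plus the `L¹` norm of the derivative. Averaging
over `t` and using `L¹ ≤ L²` on an interval of length one gives the bound. -/
theorem norm_rep_le (u : H2 d) {s : ℝ} (hs : s ∈ Icc (0 : ℝ) 1) :
    ‖rep u s‖ ≤ ‖u.1 0‖ + ‖u.1 1‖ := by
  have hL1 : ∀ f : ℝ → E d, Continuous f → ∫ t in Ioo (0 : ℝ) 1, ‖f t‖ ≤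
      √(∫ t in Ioo (0 : ℝ) 1, ‖f t‖ ^ 2) := by
    intro f hf
    have hm : MemLp (fun t => ‖f t‖) 2 (volume.restrict (Ioo (0 : ℝ) 1)) := by
      obtain ⟨M, hM⟩ := isCompact_Icc.exists_bound_of_continuousOn (s := Icc (0 : ℝ) 1)
        hf.norm.continuousOn
      refine MemLp.of_bound hf.norm.aestronglyMeasurable M ?_
      filter_upwards [ae_restrict_mem measurableSet_Ioo] with t ht using
        hM t (Ioo_subset_Icc_self ht)
    have h1 := sq_norm_integral_le hm
    refine Real.le_sqrt_of_sq_le ?_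
    simpa using h1
  have hr := hL1 _ (continuous_rep u)
  have hv := hL1 _ (continuous_vel u)
  rw [← norm_sq_zero, Real.sqrt_sq (norm_nonneg _)] at hr
  rw [← norm_sq_one, Real.sqrt_sq (norm_nonneg _)] at hv
  have hvi : Integrable (fun t => ‖vel u t‖) (volume.restrict (Ioo (0 : ℝ) 1)) :=
    integrable_Ioo_of_continuous (continuous_vel u).norm
  have hri : Integrable (fun t => ‖rep u t‖) (volume.restrict (Ioo (0 : ℝ) 1)) :=
    integrable_Ioo_of_continuous (continuous_rep u).norm
  have hpt : ∀ t ∈ Ioo (0 : ℝ) 1, ‖rep u s‖ ≤ ‖rep u t‖ + ‖u.1 1‖ := by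
    intro t ht
    have h1 : rep u s = rep u t + ∫ r in t..s, vel u r := by rw [← rep_sub_eq]; abel
    rw [h1]
    refine (norm_add_le _ _).trans (add_le_add le_rfl (le_trans ?_ hv))
    refine (intervalIntegral.norm_integral_le_integral_norm_uIoc).trans ?_
    rw [← integral_Icc_eq_integral_Ioo]
    refine setIntegral_mono_set ?_ (Eventually.of_forall fun _ => norm_nonneg _) ?_
    · exact (continuous_vel u).norm.integrableOn_Icc
    · exact (uIoc_subset_uIcc.trans (uIcc_subset_Icc (Ioo_subset_Icc_self ht) hs)).eventuallyLE
  have h3 : ∫ t in Ioo (0 : ℝ) 1, ‖rep u s‖ ≤ ∫ t in Ioo (0 : ℝ) 1, (‖rep u t‖ + ‖u.1 1‖) :=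
    setIntegral_mono_on (integrable_const _) (hri.add (integrable_const _)) measurableSet_Ioo hpt
  rw [integral_add hri (integrable_const _)] at h3
  simp at h3
  linarith

/-- Evaluation at a point of `[0,1]`. -/
noncomputable def eval (s : ℝ) (hs : s ∈ Icc (0 : ℝ) 1) : H2 d →L[ℝ] E d :=
  LinearMap.mkContinuous
    { toFun := fun u => rep u s
      map_add' := fun u v => by
        refine (IsContRep.eqOn (u := u + v) (c := fun t => rep u t + rep v t) ⟨?_, ?_⟩ hs).symm
        · exact ((continuous_rep u).add (continuous_rep v)).continuousOn
        · filter_upwards [rep_ae u, rep_ae v, Lp.coeFn_add (u.1 0) (v.1 0)] with t h1 h2 h3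
          rw [← h1, ← h2]; exact h3
      map_smul' := fun r u => by
        refine (IsContRep.eqOn (u := r • u) (c := fun t => r • rep u t) ⟨?_, ?_⟩ hs).symm
        · exact ((continuous_rep u).const_smul r).continuousOn
        · filter_upwards [rep_ae u, Lp.coeFn_smul r (u.1 0)] with t h1 h3
          rw [← h1]; exact h3 }
    2 (fun u => by
      have h0 : ‖u.1 0‖ ≤ ‖u‖ := PiLp.norm_apply_le u.1 0
      have h1 : ‖u.1 1‖ ≤ ‖u‖ := PiLp.norm_apply_le u.1 1
      exact (norm_rep_le u hs).trans (by linarith))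

theorem eval_apply (s : ℝ) (hs : s ∈ Icc (0 : ℝ) 1) (u : H2 d) : eval s hs u = rep u s := rfl

/-- The components `u`, `u'`, `u''` as continuous linear maps. -/
noncomputable def comp (i : Fin 3) : H2 d →L[ℝ] L2 d :=
  (PiLp.proj 2 (fun _ : Fin 3 => L2 d) i : PiLp 2 (fun _ : Fin 3 => L2 d) →L[ℝ] L2 d).comp
    (H2 d).subtypeL

end H2

/-! ### Weak convergence in `H²` -/

variable {d : ℕ}

theorem weakTendsto_iff {w : ℕ → H2 d} {u : H2 d} :
    WeakTendsto w u ↔ ∀ f : H2 d →L[ℝ] ℝ, Tendsto (fun n => f (w n)) atTop (𝓝 (f u)) := by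
  refine WeakBilin.tendsto_iff_forall_eval_tendsto (B := (topDualPairing ℝ (H2 d)).flip) ?_
  intro x y hxy
  by_contra hne
  obtain ⟨f, hf⟩ := SeparatingDual.exists_separating_of_ne (R := ℝ) hne
  exact hf (LinearMap.congr_fun hxy f)

theorem WeakTendsto.comp_tendsto {w : ℕ → H2 d} {u : H2 d} (h : WeakTendsto w u) {φ : ℕ → ℕ}
    (hφ : Tendsto φ atTop atTop) : WeakTendsto (fun n => w (φ n)) u :=
  Tendsto.comp (f := φ) (g := fun n => toWeakSpace ℝ (H2 d) (w n)) h hφ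

theorem WeakTendsto.inner_comp {w : ℕ → H2 d} {u : H2 d} (h : WeakTendsto w u) (i : Fin 3)
    (g : L2 d) : Tendsto (fun n => inner ℝ g ((w n).1 i)) atTop (𝓝 (inner ℝ g (u.1 i))) :=
  weakTendsto_iff.1 h ((innerSL ℝ g).comp (H2.comp i))

/-- Point evaluations are bounded functionals, so weak convergence is pointwise on the closed
interval. Sign and interpolation conditions pass to weak limits this way. -/
theorem WeakTendsto.rep {w : ℕ → H2 d} {u : H2 d} (h : WeakTendsto w u) {s : ℝ}
    (hs : s ∈ Icc (0 : ℝ) 1) : Tendsto (fun n => H2.rep (w n) s) atTop (𝓝 (H2.rep u s)) := by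
  rw [(EuclideanSpace.equiv (Fin d) ℝ).toHomeomorph.isInducing.tendsto_nhds_iff, tendsto_pi_nhds]
  intro j
  exact weakTendsto_iff.1 h ((EuclideanSpace.proj (𝕜 := ℝ) j).comp (H2.eval s hs))

theorem continuous_integral_smul {f : ℝ → ℝ} (hf : Continuous f) (hc : HasCompactSupport f) :
    Continuous fun u : L2 d => ∫ t in Ioo (0 : ℝ) 1, f t • u t := by
  rw [(EuclideanSpace.equiv (Fin d) ℝ).toHomeomorph.isInducing.continuous_iff, continuous_pi_iff]
  intro j
  have hm : MemLp (fun t => f t • EuclideanSpace.single j (1 : ℝ)) 2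
      (volume.restrict (Ioo (0 : ℝ) 1)) := by
    obtain ⟨C, hC⟩ := hc.exists_bound_of_continuous hf
    refine MemLp.of_bound (by fun_prop) C (Eventually.of_forall fun t => ?_)
    simpa [norm_smul] using hC t
  have : (fun u : L2 d => (∫ t in Ioo (0 : ℝ) 1, f t • u t) j) =
      fun u => inner ℝ (hm.toLp _) u := by
    ext u
    rw [L2.inner_def, integral_coord (integrable_smul_L2 hf hc u)]
    refine integral_congr_ae ?_
    filter_upwards [hm.coeFn_toLp] with t ht
    rw [ht, real_inner_smul_left, EuclideanSpace.inner_single_left]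
    simp
  exact this ▸ (innerSL ℝ (hm.toLp _)).continuous

/-- The weak derivative relations are equalities of continuous maps. Closedness gives completeness,
which the Riesz representation needs. -/
theorem isClosed_H2 : IsClosed (H2 d : Set (PiLp 2 (fun _ : Fin 3 => L2 d))) := by
  have hw : ∀ i j : Fin 3,
      IsClosed {w : PiLp 2 (fun _ : Fin 3 => L2 d) | HasWeakDeriv (w i) (w j)} := by
    intro i j
    simp only [HasWeakDeriv, ofPred_forall]
    refine isClosed_iInter fun φ => isClosed_iInter fun h1 => isClosed_iInter fun h2 =>
      isClosed_iInter fun h3 => isClosed_eq ?_ ?_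
    · exact (continuous_integral_smul (h1.continuous_deriv (by simp)) h2.deriv).comp
        (PiLp.continuous_apply 2 _ i)
    · exact ((continuous_integral_smul h1.continuous h2).comp (PiLp.continuous_apply 2 _ j)).neg
  exact (hw 0 1).inter (hw 1 2)

instance : CompleteSpace (H2 d) := isClosed_H2.completeSpace_coe

/-- Separability is what turns Banach–Alaoglu into a statement about subsequences. -/
instance : SecondCountableTopology (L2 d) :=
  haveI : Fact ((2 : ℝ≥0∞) ≠ ⊤) := ⟨by simp⟩
  inferInstance

instance : TopologicalSpace.SeparableSpace (PiLp 2 (fun _ : Fin 3 => L2 d)) :=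
  (PiLp.homeomorph 2 (fun _ : Fin 3 => L2 d)).symm.surjective.denseRange.separableSpace
    (PiLp.homeomorph 2 (fun _ : Fin 3 => L2 d)).symm.continuous

instance : TopologicalSpace.SeparableSpace (H2 d) := by
  have : SecondCountableTopology (PiLp 2 (fun _ : Fin 3 => L2 d)) :=
    UniformSpace.secondCountable_of_separable _
  have : SecondCountableTopology (H2 d) := TopologicalSpace.Subtype.secondCountableTopology _
  infer_instance

/-- Bounded sequences in `H²` have weakly convergent subsequences. -/
theorem exists_weakTendsto_subseq {w : ℕ → H2 d} {M : ℝ} (h : ∀ n, ‖w n‖ ≤ M) :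
    ∃ (u : H2 d) (φ : ℕ → ℕ), StrictMono φ ∧ WeakTendsto (fun n => w (φ n)) u := by
  have hseq := WeakDual.isSeqCompact_closedBall ℝ (H2 d) 0 M
  -- Riesz moves the sequence to the dual, where balls are weak-* sequentially compact, and the
  -- limit functional back.
  let J := InnerProductSpace.toDual ℝ (H2 d)
  obtain ⟨ℓ, -, φ, hφ, hlim⟩ := hseq (x := fun n => StrongDual.toWeakDual (J (w n))) (by
    intro n
    rw [mem_preimage]
    refine (mem_closedBall_zero_iff (a := J (w n))).2 ?_
    exact (J.norm_map (w n)).le.trans (h n))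
  refine ⟨J.symm (WeakDual.toStrongDual ℓ), φ, hφ, weakTendsto_iff.2 fun f => ?_⟩
  obtain ⟨v, rfl⟩ := J.surjective f
  have h1 := (WeakBilin.eval_continuous (topDualPairing ℝ (H2 d)) v).continuousAt.tendsto.comp hlim
  have e1 : ∀ x : H2 d, J v x = J x v := fun x => by
    rw [InnerProductSpace.toDual_apply_apply, InnerProductSpace.toDual_apply_apply,
      real_inner_comm]
  simp only [e1]
  rw [LinearIsometryEquiv.apply_symm_apply]
  exact h1

/-- Weak convergence together with an upper bound on the norms gives strong convergence. -/
theorem WeakTendsto.tendsto_of_norm_sq_le {w : ℕ → H2 d} {u : H2 d} (h : WeakTendsto w u)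
    {r : ℕ → ℝ} (hr : Tendsto r atTop (𝓝 (‖u‖ ^ 2))) (hle : ∀ n, ‖w n‖ ^ 2 ≤ r n) :
    Tendsto w atTop (𝓝 u) := by
  rw [tendsto_iff_norm_sub_tendsto_zero]
  have hin : Tendsto (fun n => inner ℝ u (w n)) atTop (𝓝 (inner ℝ u u)) :=
    weakTendsto_iff.1 h (innerSL ℝ u)
  -- This is the expansion of `‖w n - u‖ ^ 2` with `‖w n‖ ^ 2` replaced by its bound.
  have hb : Tendsto (fun n => r n - 2 * inner ℝ u (w n) + ‖u‖ ^ 2) atTop (𝓝 0) := by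
    have := (hr.sub (hin.const_mul 2)).add_const (‖u‖ ^ 2)
    rw [real_inner_self_eq_norm_sq] at this
    convert this using 2; ring
  have hsq : Tendsto (fun n => ‖w n - u‖ ^ 2) atTop (𝓝 0) := by
    refine squeeze_zero (fun n => sq_nonneg _) (fun n => ?_) hb
    rw [norm_sub_sq_real, real_inner_comm]
    linarith [hle n]
  simpa using hsq.sqrt

/-- Weighted squared seminorm of the first two derivatives. -/
noncomputable def energy (δ : ℝ) (u : H2 d) : ℝ := ‖u.1 2‖ ^ 2 + δ * ‖u.1 1‖ ^ 2

/-- Weak lower semicontinuity of the energy. -/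
theorem WeakTendsto.energy_le {δ : ℝ} (hδ : 0 < δ) {w : ℕ → H2 d} {u : H2 d}
    (h : WeakTendsto w u) {q : ℝ} (hq : ∀ n, energy δ (w n) ≤ q) : energy δ u ≤ q := by
  have hlim : Tendsto (fun n => inner ℝ (u.1 2) ((w n).1 2) + δ * inner ℝ (u.1 1) ((w n).1 1))
      atTop (𝓝 (energy δ u)) := by
    have := (h.inner_comp 2 (u.1 2)).add ((h.inner_comp 1 (u.1 1)).const_mul δ)
    rwa [real_inner_self_eq_norm_sq, real_inner_self_eq_norm_sq] at this
  -- The pairing with `u` is linear in `w n`, so it converges. Young's inequality bounds it by the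
  -- mean of the two energies, and the half belonging to `u` is absorbed afterwards.
  have hle : energy δ u ≤ (energy δ u + q) / 2 := by
    refine le_of_tendsto hlim (Eventually.of_forall fun n => ?_)
    have hY : ∀ x y : L2 d, inner ℝ x y ≤ (‖x‖ ^ 2 + ‖y‖ ^ 2) / 2 := fun x y => by
      have := norm_sub_sq_real x y
      nlinarith [sq_nonneg ‖x - y‖]
    have h1 := hY (u.1 2) ((w n).1 2)
    have h2 := mul_le_mul_of_nonneg_left (hY (u.1 1) ((w n).1 1)) hδ.le
    have h3 := hq n
    unfold energy at h3 ⊢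
    linarith
  linarith

/-! ### The temporal extension as an `H²` curve -/

section Spline

variable {d : ℕ}

/-- Second differences, set to zero at the two end points. -/
noncomputable def secDiff (K : ℕ) (x : ℕ → E d) (k : ℕ) : E d :=
  if 1 ≤ k ∧ k < K then x (k + 1) - (2 : ℝ) • x k + x (k - 1) else 0

/-- The extension in the rescaled time `s = K t`, written with truncated powers. -/
noncomputable def splinePos (K : ℕ) (x : ℕ → E d) (s : ℝ) : E d :=
  x 0 + s • (x 1 - x 0) + ∑ j ∈ Finset.range K,
    ((max (s - j - 1 / 2) 0) ^ 2 / 2) • (secDiff K x (j + 1) - secDiff K x j)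

/-- The derivative of `splinePos`. -/
noncomputable def splineVel (K : ℕ) (x : ℕ → E d) (s : ℝ) : E d :=
  (x 1 - x 0) + ∑ j ∈ Finset.range K,
    (max (s - j - 1 / 2) 0) • (secDiff K x (j + 1) - secDiff K x j)

/-- The derivative of `splineVel`. -/
noncomputable def splineAcc (K : ℕ) (x : ℕ → E d) (s : ℝ) : E d :=
  ∑ j ∈ Finset.range K,
    (if (j : ℝ) + 1 / 2 ≤ s then (1 : ℝ) else 0) • (secDiff K x (j + 1) - secDiff K x j)

theorem hasDerivAt_max_sq (b s : ℝ) :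
    HasDerivAt (fun s : ℝ => (max (s - b) 0) ^ 2 / 2) (max (s - b) 0) s := by
  rcases lt_trichotomy s b with h | rfl | h
  · rw [max_eq_right (by linarith)]
    refine (hasDerivAt_const s (0 : ℝ)).congr_of_eventuallyEq ?_
    filter_upwards [gt_mem_nhds h] with r hr
    rw [max_eq_right (by linarith)]; norm_num
  · rw [sub_self, max_self, hasDerivAt_iff_isLittleO]
    simp only [sub_self, max_self, smul_zero, sub_zero, ne_eq, OfNat.ofNat_ne_zero,
      not_false_eq_true, zero_pow, zero_div]
    -- At the kink the function is dominated by the squared distance, so the derivative there is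
    -- zero.
    refine Asymptotics.IsBigO.trans_isLittleO (g := fun r : ℝ => (r - s) ^ 2) ?_ ?_
    · refine Asymptotics.IsBigO.of_bound 1 (Eventually.of_forall fun r => ?_)
      rw [Real.norm_of_nonneg (by positivity), Real.norm_of_nonneg (by positivity)]
      rcases le_total (r - s) 0 with h | h
      · rw [max_eq_right h]; nlinarith [sq_nonneg (r - s)]
      · rw [max_eq_left h]; nlinarith [sq_nonneg (r - s)]
    · have h1 : (fun r : ℝ => r - s) =o[𝓝 s] fun _ => (1 : ℝ) := by
        rw [Asymptotics.isLittleO_one_iff]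
        have : Tendsto (fun r : ℝ => r - s) (𝓝 s) (𝓝 (s - s)) :=
          (continuous_id.sub continuous_const).tendsto s
        rwa [sub_self] at this
      have h2 := h1.mul_isBigO (Asymptotics.isBigO_refl (fun r : ℝ => r - s) (𝓝 s))
      simpa [sq] using h2
  · rw [max_eq_left (by linarith)]
    have : HasDerivAt (fun s : ℝ => (s - b) ^ 2 / 2) (s - b) s := by
      have := (((hasDerivAt_id s).sub_const b).pow 2).div_const 2
      refine HasDerivAt.congr_deriv this ?_
      simp
    refine this.congr_of_eventuallyEq ?_
    filter_upwards [lt_mem_nhds h] with r hr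
    rw [max_eq_left (by linarith)]

/-- With truncated powers the derivative is taken termwise, and no polynomial pieces have to be
glued at the breakpoints. -/
theorem hasDerivAt_splinePos (K : ℕ) (x : ℕ → E d) (s : ℝ) :
    HasDerivAt (splinePos K x) (splineVel K x s) s := by
  have h1 : HasDerivAt (fun s : ℝ => x 0 + s • (x 1 - x 0)) (x 1 - x 0) s := by
    simpa using ((hasDerivAt_id s).smul_const (x 1 - x 0)).const_add (x 0)
  refine h1.add (HasDerivAt.fun_sum fun j _ => ?_)
  have := (hasDerivAt_max_sq (j + 1 / 2) s).smul_const (secDiff K x (j + 1) - secDiff K x j)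
  simpa only [sub_sub] using this

theorem continuous_splineVel (K : ℕ) (x : ℕ → E d) : Continuous (splineVel K x) := by
  unfold splineVel
  fun_prop

theorem intervalIntegral_ite {b s : ℝ} (hb : 0 ≤ b) :
    ∫ r in (0 : ℝ)..s, (if b ≤ r then (1 : ℝ) else 0) = max (s - b) 0 := by
  rcases le_total s b with h | h
  · rw [max_eq_right (by linarith)]
    refine intervalIntegral.integral_zero_ae ?_
    have : ∀ᵐ r : ℝ, r ≠ b := by simp [ae_iff, measure_singleton]
    filter_upwards [this] with r hr hmem
    rw [if_neg]
    intro hle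
    rcases le_max_iff.1 hmem.2 with h' | h'
    · exact hr (le_antisymm (h'.trans hb) hle)
    · exact hr (le_antisymm (h'.trans h) hle)
  · rw [max_eq_left (by linarith)]
    have h1 : ∫ r in (0 : ℝ)..b, (if b ≤ r then (1 : ℝ) else 0) = 0 := by
      refine intervalIntegral.integral_zero_ae ?_
      have : ∀ᵐ r : ℝ, r ≠ b := by simp [ae_iff, measure_singleton]
      filter_upwards [this] with r hr hmem
      rw [uIoc_of_le hb] at hmem
      rw [if_neg]
      exact fun hle => hr (le_antisymm hmem.2 hle)
    have h2 : ∫ r in b..s, (if b ≤ r then (1 : ℝ) else 0) = s - b := by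
      rw [← mul_one (s - b), ← smul_eq_mul, ← intervalIntegral.integral_const]
      refine intervalIntegral.integral_congr fun r hr => ?_
      rw [uIcc_of_le h] at hr
      exact if_pos hr.1
    have hm : Monotone fun r : ℝ => if b ≤ r then (1 : ℝ) else 0 := by
      intro r r' hrr
      dsimp only
      split_ifs <;> linarith
    rw [← intervalIntegral.integral_add_adjacent_intervals hm.intervalIntegrable
      (b := b) hm.intervalIntegrable, h1, h2, zero_add]

theorem measurable_splineAcc (K : ℕ) (x : ℕ → E d) : Measurable (splineAcc K x) := by
  unfold splineAcc
  refine Finset.measurable_sum _ fun j _ => ?_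
  exact (Measurable.ite measurableSet_Ici measurable_const measurable_const).smul_const _

theorem norm_splineAcc_le (K : ℕ) (x : ℕ → E d) (s : ℝ) : ‖splineAcc K x s‖ ≤
    ∑ j ∈ Finset.range K, ‖secDiff K x (j + 1) - secDiff K x j‖ := by
  refine (norm_sum_le _ _).trans (Finset.sum_le_sum fun j _ => ?_)
  split_ifs <;> simp

theorem splineVel_eq (K : ℕ) (x : ℕ → E d) (s : ℝ) :
    splineVel K x s = splineVel K x 0 + ∫ r in (0 : ℝ)..s, splineAcc K x r := by
  have hm : ∀ j : ℕ, Monotone fun r : ℝ => if (j : ℝ) + 1 / 2 ≤ r then (1 : ℝ) else 0 := by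
    intro j r r' hrr
    dsimp only
    split_ifs <;> linarith
  have hi : ∀ (j : ℕ) (v : E d), IntervalIntegrable
      (fun r : ℝ => (if (j : ℝ) + 1 / 2 ≤ r then (1 : ℝ) else 0) • v) volume 0 s := fun j v =>
    ⟨(hm j).intervalIntegrable.1.smul_const v, (hm j).intervalIntegrable.2.smul_const v⟩
  have h0 : splineVel K x 0 = x 1 - x 0 := by
    unfold splineVel
    rw [add_eq_left]
    refine Finset.sum_eq_zero fun j _ => ?_
    rw [max_eq_right, zero_smul]
    have : (0 : ℝ) ≤ j := j.cast_nonneg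
    linarith
  unfold splineAcc
  rw [h0, intervalIntegral.integral_finsetSum (fun j _ => hi j _)]
  unfold splineVel
  congr 1
  refine Finset.sum_congr rfl fun j _ => ?_
  rw [intervalIntegral.integral_smul_const, intervalIntegral_ite (by positivity), sub_sub]

/-- The breakpoints are the half-integers, and those reached by time `s` are exactly the first `⌊s +
1 / 2⌋₊`. -/
theorem sum_range_truncated {F : Type*} [AddCommMonoid F] {K : ℕ} {s : ℝ} (hs : 0 ≤ s)
    (hsK : s ≤ K) (g : ℕ → F) :
    ∑ j ∈ Finset.range K, (if (j : ℝ) + 1 / 2 ≤ s then g j else 0) =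
      ∑ j ∈ Finset.range ⌊s + 1 / 2⌋₊, g j := by
  rw [← Finset.sum_filter]
  refine Finset.sum_congr ?_ fun _ _ => rfl
  ext j
  rw [Finset.mem_filter, Finset.mem_range, Finset.mem_range, ← Nat.succ_le_iff (n := ⌊s + 1 / 2⌋₊),
    Nat.succ_eq_add_one,
    Nat.le_floor_iff (by positivity)]
  push_cast
  constructor
  · rintro ⟨-, h⟩; linarith
  · intro h
    refine ⟨?_, by linarith⟩
    have : (j : ℝ) < K := by linarith
    exact_mod_cast this

theorem floor_le_of_le {K : ℕ} {s : ℝ} (hsK : s ≤ K) : ⌊s + 1 / 2⌋₊ ≤ K := by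
  have : ⌊s + 1 / 2⌋₊ < K + 1 := by
    rw [Nat.floor_lt' (by omega)]; push_cast; linarith
  omega

theorem secDiff_zero (K : ℕ) (x : ℕ → E d) : secDiff K x 0 = 0 := by simp [secDiff]

/-- The jumps telescope, and the sum starts from zero because `secDiff` vanishes at index `0`. -/
theorem splineAcc_eq {K : ℕ} (x : ℕ → E d) {s : ℝ} (hs : 0 ≤ s) (hsK : s ≤ K) :
    splineAcc K x s = secDiff K x ⌊s + 1 / 2⌋₊ := by
  unfold splineAcc
  simp only [ite_smul, one_smul, zero_smul]
  rw [sum_range_truncated hs hsK, Finset.sum_range_sub, secDiff_zero, sub_zero]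

theorem splineVel_zero {K : ℕ} (x : ℕ → E d) {s : ℝ} (hs : 0 ≤ s) (hsK : s ≤ K) :
    splineVel K x s = (x 1 - x 0) + ∑ j ∈ Finset.range ⌊s + 1 / 2⌋₊,
      (s - j - 1 / 2) • (secDiff K x (j + 1) - secDiff K x j) := by
  unfold splineVel
  rw [← sum_range_truncated hs hsK]
  congr 1
  refine Finset.sum_congr rfl fun j _ => ?_
  split_ifs with h
  · rw [max_eq_left (by linarith)]
  · rw [max_eq_right (by linarith), zero_smul]

theorem splinePos_zero {K : ℕ} (x : ℕ → E d) {s : ℝ} (hs : 0 ≤ s) (hsK : s ≤ K) :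
    splinePos K x s = x 0 + s • (x 1 - x 0) + ∑ j ∈ Finset.range ⌊s + 1 / 2⌋₊,
      ((s - j - 1 / 2) ^ 2 / 2) • (secDiff K x (j + 1) - secDiff K x j) := by
  unfold splinePos
  rw [← sum_range_truncated hs hsK]
  congr 1
  refine Finset.sum_congr rfl fun j _ => ?_
  split_ifs with h
  · rw [max_eq_left (by linarith)]
  · rw [max_eq_right (by linarith)]; simp

theorem secDiff_of_lt {K : ℕ} (x : ℕ → E d) {k : ℕ} (h : k + 1 < K) :
    secDiff K x (k + 1) = x (k + 2) - (2 : ℝ) • x (k + 1) + x k := by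
  rw [secDiff, if_pos ⟨by omega, h⟩, Nat.add_sub_cancel]

/-- A polynomial identity in `s`, valid for all real `s`. This is why induction over the pieces
needs no case distinction. -/
theorem sum_vel_pieces {K : ℕ} (x : ℕ → E d) (s : ℝ) {k : ℕ} (hk : k + 1 ≤ K) :
    (x 1 - x 0) + ∑ j ∈ Finset.range (k + 1),
      (s - j - 1 / 2) • (secDiff K x (j + 1) - secDiff K x j) =
    (x (k + 1) - x k) + (s - k - 1 / 2) • secDiff K x (k + 1) := by
  induction k with
  | zero => simp [secDiff_zero]
  | succ k ih =>
    rw [Finset.sum_range_succ, ← add_assoc, ih (by omega), secDiff_of_lt x (k := k) (by omega)]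
    push_cast
    module

theorem sum_pos_pieces {K : ℕ} (x : ℕ → E d) (s : ℝ) {k : ℕ} (hk : k + 1 ≤ K) :
    x 0 + s • (x 1 - x 0) + ∑ j ∈ Finset.range (k + 1),
      ((s - j - 1 / 2) ^ 2 / 2) • (secDiff K x (j + 1) - secDiff K x j) =
    (1 / 2 : ℝ) • (x k + x (k + 1)) + (s - k - 1 / 2) • (x (k + 1) - x k) +
      ((s - k - 1 / 2) ^ 2 / 2) • secDiff K x (k + 1) := by
  induction k with
  | zero =>
    simp [secDiff_zero]
    module
  | succ k ih =>
    rw [Finset.sum_range_succ, ← add_assoc, ih (by omega), secDiff_of_lt x (k := k) (by omega)]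
    push_cast
    module

theorem floor_cases {K : ℕ} {s : ℝ} (hs : 0 ≤ s) (hsK : s ≤ K) :
    (⌊s + 1 / 2⌋₊ = 0 ∧ s < 1 / 2) ∨
    ∃ k, k + 1 ≤ K ∧ ⌊s + 1 / 2⌋₊ = k + 1 ∧ (k : ℝ) + 1 / 2 ≤ s ∧ s < k + 3 / 2 := by
  have h1 := Nat.floor_le (show 0 ≤ s + 1 / 2 by positivity)
  have h2 := Nat.lt_floor_add_one (s + 1 / 2)
  have h3 := floor_le_of_le hsK
  rcases h : ⌊s + 1 / 2⌋₊ with _ | k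
  · rw [h] at h2; left; refine ⟨rfl, ?_⟩; push_cast at h2; linarith
  · rw [h] at h1 h2 h3; right
    push_cast at h1 h2
    exact ⟨k, h3, rfl, by linarith, by linarith⟩

theorem splinePos_of_lt {K : ℕ} (x : ℕ → E d) {s : ℝ} (hs : 0 ≤ s) (hsK : s ≤ K)
    (h : ⌊s + 1 / 2⌋₊ = 0) : splinePos K x s = x 0 + s • (x 1 - x 0) := by
  rw [splinePos_zero x hs hsK, h]; simp

theorem splineVel_of_lt {K : ℕ} (x : ℕ → E d) {s : ℝ} (hs : 0 ≤ s) (hsK : s ≤ K)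
    (h : ⌊s + 1 / 2⌋₊ = 0) : splineVel K x s = x 1 - x 0 := by
  rw [splineVel_zero x hs hsK, h]; simp

theorem splinePos_of_eq {K : ℕ} (x : ℕ → E d) {s : ℝ} (hs : 0 ≤ s) (hsK : s ≤ K) {k : ℕ}
    (hk : k + 1 ≤ K) (h : ⌊s + 1 / 2⌋₊ = k + 1) : splinePos K x s =
      (1 / 2 : ℝ) • (x k + x (k + 1)) + (s - k - 1 / 2) • (x (k + 1) - x k) +
      ((s - k - 1 / 2) ^ 2 / 2) • secDiff K x (k + 1) := by
  rw [splinePos_zero x hs hsK, h, sum_pos_pieces x s hk]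

theorem splineVel_of_eq {K : ℕ} (x : ℕ → E d) {s : ℝ} (hs : 0 ≤ s) (hsK : s ≤ K) {k : ℕ}
    (hk : k + 1 ≤ K) (h : ⌊s + 1 / 2⌋₊ = k + 1) : splineVel K x s =
      (x (k + 1) - x k) + (s - k - 1 / 2) • secDiff K x (k + 1) := by
  rw [splineVel_zero x hs hsK, h, sum_vel_pieces x s hk]

theorem secDiff_self (K : ℕ) (x : ℕ → E d) : secDiff K x K = 0 := by simp [secDiff]

theorem hermite_eq_splinePos {K : ℕ} (hK : 0 < K) (x : ℕ → E d) {t : ℝ}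
    (ht : t ∈ Icc (0 : ℝ) 1) : hermite K x t = splinePos K x (K * t) := by
  have hK' : (0 : ℝ) < K := by exact_mod_cast hK
  have hs : 0 ≤ K * t := mul_nonneg hK'.le ht.1
  have hsK : K * t ≤ K := by nlinarith [ht.2]
  have c1 : t ≤ 1 / (2 * (K : ℝ)) ↔ K * t ≤ 1 / 2 := by
    rw [le_div_iff₀ (by positivity)]; constructor <;> intro h <;> linarith
  have c2 : 1 - 1 / (2 * (K : ℝ)) ≤ t ↔ K - 1 / 2 ≤ K * t := by
    have : K * (1 / (2 * (K : ℝ))) = 1 / 2 := by field_simp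
    rw [← mul_le_mul_iff_right₀ hK', mul_sub, this, mul_one]
  rw [hermite]
  simp only [c1, c2]
  rcases floor_cases hs hsK with ⟨h, hlt⟩ | ⟨k, hk, h, hle, hlt⟩
  · rw [if_pos hlt.le, splinePos_of_lt x hs hsK h]
  · rw [splinePos_of_eq x hs hsK hk h]
    have hmul : ∀ a : ℝ, K * (t - a / K) = K * t - a := fun a => by field_simp
    split_ifs with h1 h2
    -- The two case splits overlap only at the breakpoint `K * t = 1 / 2`, where the affine and
    -- quadratic formulas agree.
    · have hk0 : k = 0 := by
        have : (k : ℝ) ≤ 0 := by linarith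
        exact_mod_cast le_antisymm this k.cast_nonneg
      subst hk0
      have : K * t = 1 / 2 := le_antisymm h1 (by simpa using hle)
      rw [this]; norm_num
      module
    -- On the last half-interval the convention `secDiff K x K = 0` removes the quadratic term.
    · have hkK : k + 1 = K := by
        have : (K : ℝ) < k + 2 := by linarith
        have : K < k + 2 := by exact_mod_cast this
        omega
      have hk' : (K : ℝ) = k + 1 := by exact_mod_cast hkK.symm
      rw [hmul, hkK, secDiff_self, show K - 1 = k by omega]
      rw [hk']; module
    · have hkK : k + 1 < K := by
        rcases hk.lt_or_eq with hlt' | heq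
        · exact hlt'
        · have hk' : (K : ℝ) = k + 1 := by exact_mod_cast heq.symm
          exact absurd (by linarith) h2
      simp only [h]
      have e2 : (K : ℝ) ^ 2 * ((t - (((k + 1 : ℕ) : ℝ) - 1 / 2) / K) ^ 2 / 2) =
          (K * (t - (((k + 1 : ℕ) : ℝ) - 1 / 2) / K)) ^ 2 / 2 := by ring
      rw [e2, hmul, secDiff_of_lt x hkK, Nat.add_sub_cancel]
      push_cast
      module

/-- The extension is everywhere a convex combination of at most three neighbouring nodes. -/
theorem splinePos_convex {K : ℕ} (hK : 0 < K) (x : ℕ → E d) {s : ℝ} (hs : 0 ≤ s) (hsK : s ≤ K) :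
    ∃ (i : Fin 3 → ℕ) (a : Fin 3 → ℝ), (∀ m, i m ≤ K) ∧ (∀ m, |s - i m| ≤ 3 / 2) ∧
      (∀ m, 0 ≤ a m) ∧ ∑ m, a m = 1 ∧ splinePos K x s = ∑ m, a m • x (i m) := by
  rcases floor_cases hs hsK with ⟨h, hlt⟩ | ⟨k, hk, h, hle, hlt⟩
  · refine ⟨![0, 1, 1], ![1 - s, s, 0], ?_, ?_, ?_, ?_, ?_⟩
    · intro m; fin_cases m <;> simp <;> omega
    · intro m; fin_cases m <;> simp [abs_le] <;> constructor <;> linarith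
    · intro m; fin_cases m <;> simp <;> linarith
    · simp [Fin.sum_univ_three]
    · rw [splinePos_of_lt x hs hsK h]
      simp [Fin.sum_univ_three]
      module
  · rcases hk.lt_or_eq with hkK | hkK
    -- With `τ = s - k - 1 / 2` in `[0, 1]` these are the quadratic B-spline weights `(1 - τ)²/2`,
    -- `1/2 + τ(1 - τ)`, `τ²/2`.
    · refine ⟨![k, k + 1, k + 2], ![(1 - (s - k - 1 / 2)) ^ 2 / 2,
        1 / 2 + (s - k - 1 / 2) * (1 - (s - k - 1 / 2)), (s - k - 1 / 2) ^ 2 / 2],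
        ?_, ?_, ?_, ?_, ?_⟩
      · intro m; fin_cases m <;> simp <;> omega
      · intro m; fin_cases m <;> simp [abs_le] <;> constructor <;> linarith
      · intro m; fin_cases m
        · simp; positivity
        · have : 0 ≤ (s - k - 1 / 2) * (1 - (s - k - 1 / 2)) :=
            mul_nonneg (by linarith) (by linarith)
          change 0 ≤ 1 / 2 + (s - k - 1 / 2) * (1 - (s - k - 1 / 2))
          linarith
        · simp; positivity
      · simp [Fin.sum_univ_three]; ring
      · rw [splinePos_of_eq x hs hsK hk h, secDiff_of_lt x hkK]
        simp only [Fin.sum_univ_three, Matrix.cons_val_zero, Matrix.cons_val_one, Matrix.cons_val]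
        module
    · have hk' : (K : ℝ) = k + 1 := by exact_mod_cast hkK.symm
      refine ⟨![k, k + 1, k + 1], ![1 / 2 - (s - k - 1 / 2), 1 / 2 + (s - k - 1 / 2), 0],
        ?_, ?_, ?_, ?_, ?_⟩
      · intro m; fin_cases m <;> simp <;> omega
      · intro m; fin_cases m <;> simp [abs_le] <;> constructor <;> linarith
      · intro m; fin_cases m
        · change 0 ≤ 1 / 2 - (s - k - 1 / 2); linarith
        · change 0 ≤ 1 / 2 + (s - k - 1 / 2); linarith
        · simp
      · simp [Fin.sum_univ_three]; ring
      · rw [splinePos_of_eq x hs hsK hk h, hkK, secDiff_self]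
        simp only [Fin.sum_univ_three, Matrix.cons_val_zero, Matrix.cons_val_one, Matrix.cons_val]
        module

/-- An interior node is the midpoint of its piece, so the local variable is `1 / 2` and the
quadratic term contributes `(1/2)²/2 = 1/8`. The end nodes are hit exactly. -/
theorem splinePos_node {K : ℕ} (x : ℕ → E d) {k : ℕ} (hk : k ≤ K) :
    splinePos K x k = x k + (1 / 8 : ℝ) • secDiff K x k := by
  have hf : ⌊(k : ℝ) + 1 / 2⌋₊ = k := by
    rw [Nat.floor_eq_iff (by positivity)]
    constructor <;> linarith
  rcases k with _ | k
  · rw [splinePos_of_lt x (by simp) (by simp) hf, secDiff_zero]; simp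
  · rw [splinePos_of_eq x (by positivity) (by exact_mod_cast hk) hk hf]
    push_cast
    module

end Spline

/-! ### Norms of the extension and its distance to the nodes -/

section SplineCurve

variable {d : ℕ}

theorem exists_spline_H2 {K : ℕ} (hK : 0 < K) (x : ℕ → E d) : ∃ w : H2 d,
    EqOn (H2.rep w) (fun t => splinePos K x (K * t)) (Icc 0 1) ∧
    EqOn (H2.vel w) (fun t => (K : ℝ) • splineVel K x (K * t)) (Icc 0 1) ∧
    ∀ᵐ t ∂(volume.restrict (Ioo (0 : ℝ) 1)),
      H2.acc w t = ((K : ℝ) ^ 2) • splineAcc K x (K * t) := by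
  have hK' : (K : ℝ) ≠ 0 := by exact_mod_cast hK.ne'
  have hmeas : Measurable fun t : ℝ => ((K : ℝ) ^ 2) • splineAcc K x (K * t) :=
    ((measurable_splineAcc K x).comp (measurable_const_mul (K : ℝ))).const_smul ((K : ℝ) ^ 2)
  refine H2.exists_of_rep ?_ ?_ ?_ ?_
  · refine MemLp.of_bound hmeas.aestronglyMeasurable (‖((K : ℝ) ^ 2)‖ *
      ∑ j ∈ Finset.range K, ‖secDiff K x (j + 1) - secDiff K x j‖)
      (Eventually.of_forall fun t => ?_)
    rw [norm_smul]
    exact mul_le_mul_of_nonneg_left (norm_splineAcc_le K x _) (norm_nonneg _)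
  · intro t _
    simp only [mul_zero]
    rw [splineVel_eq, intervalIntegral.integral_smul,
      intervalIntegral.integral_comp_mul_left (fun s => splineAcc K x s) hK', smul_add, mul_zero,
      smul_smul]
    congr 2
    field_simp
  · intro t
    have := (hasDerivAt_splinePos K x (K * t)).scomp t ((hasDerivAt_id t).const_mul (K : ℝ))
    exact this.congr_deriv (by simp)
  · exact ((continuous_splineVel K x).comp (continuous_const_mul _)).const_smul (K : ℝ)

theorem IsExtension.rep_eqOn {C : Set (E d)} {K : ℕ} (hK : 0 < K) {x : ℕ → E d} {u : H2 d}
    (h : IsExtension C K x u) :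
    EqOn (H2.rep u) (fun t => splinePos K x (K * t)) (Icc 0 1) := by
  have hc : Continuous (splinePos K x) :=
    continuous_iff_continuousAt.2 fun t => (hasDerivAt_splinePos K x t).continuousAt
  refine eqOn_Icc_of_ae_eq_Ioo (H2.continuous_rep u).continuousOn
    (hc.comp (continuous_const_mul _)).continuousOn ?_
  filter_upwards [H2.rep_ae u, h.2, ae_restrict_mem measurableSet_Ioo] with t h1 h2 h3
  rw [← hermite_eq_splinePos hK x (Ioo_subset_Icc_self h3), ← h2, ← h1]
  rfl

theorem isExtension_of_rep_eqOn {C : Set (E d)} {K : ℕ} (hK : 0 < K) {x : ℕ → E d} {u : H2 d}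
    (hx : ∀ k ≤ K, x k ∈ C)
    (h : EqOn (H2.rep u) (fun t => splinePos K x (K * t)) (Icc 0 1)) : IsExtension C K x u := by
  refine ⟨hx, ?_⟩
  filter_upwards [H2.rep_ae u, ae_restrict_mem measurableSet_Ioo] with t h1 h3
  rw [hermite_eq_splinePos hK x (Ioo_subset_Icc_self h3)]
  exact h1.trans (h (Ioo_subset_Icc_self h3))

theorem intervalIntegral_half_integer_split {K : ℕ} (hK : 0 < K) {f : ℝ → ℝ}
    (hf : ∀ a b, IntervalIntegrable f volume a b) :
    ∫ s in (0 : ℝ)..K, f s = (∫ s in (0 : ℝ)..(1 / 2), f s) +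
      (∑ k ∈ Finset.Ico 1 K, ∫ s in ((k : ℝ) - 1 / 2)..((k : ℝ) + 1 / 2), f s) +
      ∫ s in ((K : ℝ) - 1 / 2)..K, f s := by
  have h := intervalIntegral.sum_integral_adjacent_intervals_Ico (f := f) (μ := volume)
    (a := fun k : ℕ => (k : ℝ) - 1 / 2) (m := 1) (n := K) hK (fun k _ => hf _ _)
  have e : ∀ k : ℕ, ((k + 1 : ℕ) : ℝ) - 1 / 2 = (k : ℝ) + 1 / 2 := fun k => by push_cast; ring
  have e1 : ((1 : ℕ) : ℝ) - 1 / 2 = 1 / 2 := by norm_num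
  rw [e1] at h
  simp only [e] at h
  rw [h, intervalIntegral.integral_add_adjacent_intervals (hf _ _) (hf _ _),
    intervalIntegral.integral_add_adjacent_intervals (hf _ _) (hf _ _)]

theorem floor_add_half_eq {k : ℕ} {s : ℝ} (h1 : (k : ℝ) - 1 / 2 ≤ s) (h2 : s < k + 1 / 2)
    (h0 : 0 ≤ s) : ⌊s + 1 / 2⌋₊ = k := by
  rw [Nat.floor_eq_iff (by positivity)]
  constructor <;> linarith

/-- The acceleration is constant on each unit interval centered at an integer and vanishes on the
two end half-intervals. -/
theorem integral_norm_sq_splineAcc {K : ℕ} (hK : 0 < K) (x : ℕ → E d) :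
    ∫ s in (0 : ℝ)..K, ‖splineAcc K x s‖ ^ 2 = ∑ k ∈ Finset.Ico 1 K, ‖secDiff K x k‖ ^ 2 := by
  have hK1 : (1 : ℝ) ≤ K := by exact_mod_cast hK
  have hint : ∀ a b, IntervalIntegrable (fun s => ‖splineAcc K x s‖ ^ 2) volume a b := by
    intro a b
    refine (intervalIntegrable_const (c := (∑ j ∈ Finset.range K,
      ‖secDiff K x (j + 1) - secDiff K x j‖) ^ 2)).mono_fun
      ((measurable_splineAcc K x).norm.pow_const 2).aestronglyMeasurable
      (Eventually.of_forall fun s => ?_)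
    dsimp only
    rw [Real.norm_of_nonneg (by positivity)]
    refine le_trans ?_ (le_abs_self _)
    exact pow_le_pow_left₀ (norm_nonneg _) (norm_splineAcc_le K x s) 2
  have hpiece : ∀ (k : ℕ) (a b : ℝ), k ≤ K → (k : ℝ) - 1 / 2 ≤ a → 0 ≤ a → a ≤ b → b ≤ K →
      b ≤ k + 1 / 2 →
      ∫ s in a..b, ‖splineAcc K x s‖ ^ 2 = (b - a) * ‖secDiff K x k‖ ^ 2 := by
    intro k a b hk ha ha0 hab hbK hb
    rw [← smul_eq_mul, ← intervalIntegral.integral_const]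
    refine intervalIntegral.integral_congr_Ioo_of_le hab fun s hs => ?_
    rw [splineAcc_eq x (ha0.trans hs.1.le) (hs.2.le.trans hbK),
      floor_add_half_eq (ha.trans hs.1.le) (hs.2.trans_le hb) (ha0.trans hs.1.le)]
  rw [intervalIntegral_half_integer_split hK hint,
    hpiece 0 0 (1 / 2) (by omega) (by norm_num) le_rfl (by norm_num) (by linarith) (by norm_num),
    hpiece K (K - 1 / 2) K le_rfl le_rfl (by linarith) (by linarith) le_rfl (by linarith),
    secDiff_zero, secDiff_self]
  simp only [norm_zero, ne_eq, OfNat.ofNat_ne_zero, not_false_eq_true, zero_pow, mul_zero,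
    zero_add, add_zero]
  refine Finset.sum_congr rfl fun k hk => ?_
  rw [Finset.mem_Ico] at hk
  have h1 : (1 : ℝ) ≤ k := by exact_mod_cast hk.1
  have h2 : (k : ℝ) + 1 ≤ K := by exact_mod_cast hk.2
  rw [hpiece k _ _ hk.2.le le_rfl (by linarith) (by linarith) (by linarith) le_rfl]
  ring

theorem norm_sq_convex_le (v w : E d) {r : ℝ} (h0 : 0 ≤ r) (h1 : r ≤ 1) :
    ‖v + r • (w - v)‖ ^ 2 ≤ ‖v‖ ^ 2 + r * (‖w‖ ^ 2 - ‖v‖ ^ 2) := by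
  have e : v + r • (w - v) = (1 - r) • v + r • w := by module
  have h := norm_add_le ((1 - r) • v) (r • w)
  rw [← e, norm_smul, norm_smul, Real.norm_of_nonneg h0, Real.norm_of_nonneg (by linarith)] at h
  have h2 := pow_le_pow_left₀ (norm_nonneg _) h 2
  nlinarith [mul_nonneg (mul_nonneg h0 (sub_nonneg.2 h1)) (sq_nonneg (‖v‖ - ‖w‖))]

/-- Each increment is shared equally by two neighbouring pieces; the affine end pieces supply the
halves missing at both ends. -/
theorem sum_trapezoid (A : ℕ → ℝ) {K : ℕ} (hK : 0 < K) :
    1 / 2 * A 0 + ∑ k ∈ Finset.Ico 1 K, (A (k - 1) + A k) / 2 + 1 / 2 * A (K - 1) =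
      ∑ k ∈ Finset.range K, A k := by
  induction K, hK using Nat.le_induction with
  | base => simp; ring
  | succ K hK ih =>
    rw [Finset.sum_Ico_succ_top hK, Finset.sum_range_succ, ← ih, Nat.add_sub_cancel]
    ring

/-- On an interior piece the velocity interpolates linearly between two consecutive increments.
Convexity of the squared norm bounds its integral by the trapezoidal mean, so here only an
inequality holds. -/
theorem integral_norm_sq_splineVel_le {K : ℕ} (hK : 0 < K) (x : ℕ → E d) :
    ∫ s in (0 : ℝ)..K, ‖splineVel K x s‖ ^ 2 ≤
      ∑ k ∈ Finset.range K, ‖x (k + 1) - x k‖ ^ 2 := by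
  have hK1 : (1 : ℝ) ≤ K := by exact_mod_cast hK
  have hcont : Continuous fun s => ‖splineVel K x s‖ ^ 2 := (continuous_splineVel K x).norm.pow 2
  have hint : ∀ a b, IntervalIntegrable (fun s => ‖splineVel K x s‖ ^ 2) volume a b :=
    fun a b => hcont.intervalIntegrable a b
  have hends : ∀ (k : ℕ) (a b : ℝ), a ≤ b →
      (∀ s ∈ Ioo a b, splineVel K x s = x (k + 1) - x k) →
      ∫ s in a..b, ‖splineVel K x s‖ ^ 2 = (b - a) * ‖x (k + 1) - x k‖ ^ 2 := by
    intro k a b hab h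
    rw [← smul_eq_mul, ← intervalIntegral.integral_const]
    refine intervalIntegral.integral_congr_Ioo_of_le hab fun s hs => ?_
    rw [h s hs]
  rw [intervalIntegral_half_integer_split hK hint,
    hends 0 0 (1 / 2) (by norm_num) (fun s hs => splineVel_of_lt x hs.1.le (by linarith [hs.2])
      (floor_add_half_eq (by norm_num; linarith [hs.1]) (by norm_num; linarith [hs.2]) hs.1.le)),
    hends (K - 1) (K - 1 / 2) K (by linarith) (fun s hs => by
      have h0 : 0 ≤ s := by linarith [hs.1]
      rw [splineVel_of_eq x (k := K - 1) h0 hs.2.le (by omega) (by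
        rw [floor_add_half_eq (k := K) hs.1.le (by linarith [hs.2]) h0]; omega),
        show K - 1 + 1 = K by omega, secDiff_self, smul_zero, add_zero]),
    ← sum_trapezoid (fun k => ‖x (k + 1) - x k‖ ^ 2) hK]
  refine add_le_add (add_le_add (by simp) (Finset.sum_le_sum fun k hk => ?_)) (by
    rw [sub_sub_cancel])
  rw [Finset.mem_Ico] at hk
  obtain ⟨k, rfl⟩ : ∃ m, k = m + 1 := ⟨k - 1, by omega⟩
  have hkK : ((k + 1 : ℕ) : ℝ) + 1 ≤ K := by exact_mod_cast hk.2
  have hk0 : (0 : ℝ) ≤ k := k.cast_nonneg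
  push_cast at hkK ⊢
  set A := ‖x (k + 1) - x k‖ ^ 2
  set B := ‖x (k + 1 + 1) - x (k + 1)‖ ^ 2
  -- An antiderivative of the affine upper bound given by convexity; over the unit interval it
  -- yields `(A + B) / 2`.
  have hF : ∀ s : ℝ, HasDerivAt (fun s : ℝ => A * s + (s - k - 1 / 2) ^ 2 / 2 * (B - A))
      (A + (s - k - 1 / 2) * (B - A)) s := by
    intro s
    have h1 := (hasDerivAt_id s).const_mul A
    have h2 := (((((hasDerivAt_id s).sub_const (k : ℝ)).sub_const (1 / 2)).pow 2).div_const
      2).mul_const (B - A)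
    refine (h1.add h2).congr_deriv ?_
    simp
  have hle : ∫ s in ((k : ℝ) + 1 - 1 / 2)..((k : ℝ) + 1 + 1 / 2), ‖splineVel K x s‖ ^ 2 ≤
      ∫ s in ((k : ℝ) + 1 - 1 / 2)..((k : ℝ) + 1 + 1 / 2), (A + (s - k - 1 / 2) * (B - A)) := by
    refine intervalIntegral.integral_mono_on_of_le_Ioo (by linarith) (hint _ _)
      (Continuous.intervalIntegrable (by fun_prop) _ _) fun s hs => ?_
    have h0 : 0 ≤ s := by linarith [hs.1]
    rw [splineVel_of_eq x h0 (by linarith [hs.2]) (by omega : k + 1 ≤ K)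
      (floor_add_half_eq (by push_cast; linarith [hs.1]) (by push_cast; linarith [hs.2]) h0),
      secDiff_of_lt x hk.2, show x (k + 2) - (2 : ℝ) • x (k + 1) + x k =
        (x (k + 1 + 1) - x (k + 1)) - (x (k + 1) - x k) by module]
    exact norm_sq_convex_le _ _ (by linarith [hs.1]) (by linarith [hs.2])
  refine hle.trans_eq ?_
  rw [intervalIntegral.integral_eq_sub_of_hasDerivAt (fun s _ => hF s)
    (Continuous.intervalIntegrable (by fun_prop) _ _)]
  ring

variable {C : Set (E d)} {K : ℕ} {x : ℕ → E d} {u : H2 d}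

theorem exists_spline_of_isExtension (hK : 0 < K) (h : IsExtension C K x u) :
    EqOn (H2.vel u) (fun t => (K : ℝ) • splineVel K x (K * t)) (Icc 0 1) ∧
    ∀ᵐ t ∂(volume.restrict (Ioo (0 : ℝ) 1)),
      H2.acc u t = ((K : ℝ) ^ 2) • splineAcc K x (K * t) := by
  obtain ⟨w, h1, h2, h3⟩ := exists_spline_H2 hK x
  have : u = w := H2.ext_rep ((h.rep_eqOn hK).trans h1.symm)
  subst this
  exact ⟨h2, h3⟩

/-- Two time derivatives give `K⁴` after squaring, and the substitution `s = K t` takes one power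
back: precisely the weight of the discrete spline energy. -/
theorem IsExtension.norm_sq_two (hK : 0 < K) (h : IsExtension C K x u) :
    ‖u.1 2‖ ^ 2 = (K : ℝ) ^ 3 * ∑ k ∈ Finset.Ico 1 K, ‖secDiff K x k‖ ^ 2 := by
  have hK' : (K : ℝ) ≠ 0 := by exact_mod_cast hK.ne'
  have e : ∫ t in Ioo (0 : ℝ) 1, ‖H2.acc u t‖ ^ 2 =
      ∫ t in Ioo (0 : ℝ) 1, ‖(K : ℝ) ^ 2‖ ^ 2 * ‖splineAcc K x (K * t)‖ ^ 2 :=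
    integral_congr_ae ((exists_spline_of_isExtension hK h).2.mono
      fun t ht => by simp only [ht, norm_smul, mul_pow])
  rw [H2.norm_sq_two, e, integral_const_mul,
    integral_Ioo_eq_intervalIntegral,
    intervalIntegral.integral_comp_mul_left (fun s => ‖splineAcc K x s‖ ^ 2) hK', mul_zero,
    mul_one, integral_norm_sq_splineAcc hK, Real.norm_of_nonneg (by positivity), smul_eq_mul]
  field_simp

theorem IsExtension.norm_sq_one_le (hK : 0 < K) (h : IsExtension C K x u) :
    ‖u.1 1‖ ^ 2 ≤ (K : ℝ) * ∑ k ∈ Finset.range K, ‖x (k + 1) - x k‖ ^ 2 := by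
  have hK' : (0 : ℝ) < K := by exact_mod_cast hK
  rw [H2.norm_sq_one, setIntegral_congr_fun measurableSet_Ioo (fun t ht => by
    rw [(exists_spline_of_isExtension hK h).1 (Ioo_subset_Icc_self ht)]),
    integral_Ioo_eq_intervalIntegral]
  simp only [norm_smul, mul_pow]
  rw [intervalIntegral.integral_const_mul,
    intervalIntegral.integral_comp_mul_left (fun s => ‖splineVel K x s‖ ^ 2) hK'.ne', mul_zero,
    mul_one, Real.norm_of_nonneg hK'.le, smul_eq_mul]
  have e : (K : ℝ) ^ 2 * ((K : ℝ)⁻¹ * ∫ s in (0 : ℝ)..K, ‖splineVel K x s‖ ^ 2) =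
      K * ∫ s in (0 : ℝ)..K, ‖splineVel K x s‖ ^ 2 := by field_simp
  rw [e]
  exact mul_le_mul_of_nonneg_left (integral_norm_sq_splineVel_le hK x) hK'.le

/-- The extension nearly interpolates the nodes. -/
theorem IsExtension.norm_rep_sub_le (hK : 0 < K) (h : IsExtension C K x u) {k : ℕ} (hk : k ≤ K)
    {t : ℝ} (ht : (k : ℝ) = K * t) : ‖H2.rep u t - x k‖ ^ 2 ≤ ‖u.1 2‖ ^ 2 / (K : ℝ) ^ 3 := by
  have hK' : (0 : ℝ) < K := by exact_mod_cast hK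
  have htm : t ∈ Icc (0 : ℝ) 1 := by
    have h1 : (k : ℝ) ≤ K := by exact_mod_cast hk
    have h2 : (0 : ℝ) ≤ k := k.cast_nonneg
    constructor
    · by_contra hlt; push Not at hlt; nlinarith
    · by_contra hlt; push Not at hlt; nlinarith
  rw [h.rep_eqOn hK htm]
  dsimp only
  rw [← ht, splinePos_node x hk, add_sub_cancel_left, h.norm_sq_two hK, mul_div_assoc,
    mul_div_cancel₀ _ (by positivity), norm_smul, mul_pow]
  -- A single term of the sum, or zero at the two end nodes.
  have hle : ‖secDiff K x k‖ ^ 2 ≤ ∑ k ∈ Finset.Ico 1 K, ‖secDiff K x k‖ ^ 2 := by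
    by_cases hmem : k ∈ Finset.Ico 1 K
    · exact Finset.single_le_sum (f := fun k => ‖secDiff K x k‖ ^ 2)
        (fun i _ => sq_nonneg _) hmem
    · rw [secDiff, if_neg (by simpa using hmem)]
      simp only [norm_zero, ne_eq, OfNat.ofNat_ne_zero, not_false_eq_true, zero_pow]
      exact Finset.sum_nonneg fun i _ => sq_nonneg _
  refine le_trans ?_ hle
  have : ‖(1 / 8 : ℝ)‖ ^ 2 ≤ 1 := by norm_num
  exact mul_le_of_le_one_left (sq_nonneg _) this

theorem rep_mem_of_isExtension (hK : 0 < K) (hC : Convex ℝ C) (h : IsExtension C K x u) :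
    u ∈ H2Curves C := by
  have hK' : (0 : ℝ) < K := by exact_mod_cast hK
  rw [mem_H2Curves_iff]
  intro t ht
  rw [h.rep_eqOn hK ht]
  obtain ⟨i, a, hi, -, ha, ha1, he⟩ := splinePos_convex hK x (mul_nonneg hK'.le ht.1)
    (by nlinarith [ht.2] : K * t ≤ K)
  dsimp only
  rw [he]
  exact hC.sum_mem (fun m _ => ha m) ha1 fun m _ => h.1 _ (hi m)

end SplineCurve

/-! ### Diagonal Gaussians, their Wasserstein distances and barycenters -/

section Gaussian

variable {d : ℕ}

/-- Multiplication by the diagonal matrix `diag(s)`. -/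
noncomputable def scale (s z : E d) : E d := WithLp.toLp 2 fun j => s j * z j

@[simp] theorem scale_apply (s z : E d) (j : Fin d) : scale s z j = s j * z j := rfl

theorem continuous_scale : Continuous fun p : E d × E d => scale p.1 p.2 := by
  unfold scale
  fun_prop

theorem continuous_scale_right (s : E d) : Continuous (scale s) := by
  unfold scale
  fun_prop

open scoped MatrixOrder Matrix.Norms.L2Operator in
-- Nonnegativity matters: only then is `diag(s)` itself the square root of `diag(s)²`.
theorem diagGaussian_eq_map {s : E d} (hs : s ∈ nonnegDiag d) :
    diagGaussian s = (stdGaussian (E d)).map (scale s) := by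
  have h0 : (0 : Matrix (Fin d) (Fin d) ℝ) ≤ Matrix.diagonal (fun j => s j) :=
    (Matrix.PosSemidef.diagonal hs).nonneg
  rw [diagGaussian, multivariateGaussian, CFC.sqrt_sq _ h0]
  congr 1
  ext z j
  simp [Matrix.mulVec_diagonal]

instance (s : E d) : IsProbabilityMeasure (diagGaussian s) := by
  unfold diagGaussian; infer_instance

theorem lintegral_coord_sq_stdGaussian (j : Fin d) :
    ∫⁻ z : E d, ‖z j‖ₑ ^ 2 ∂(stdGaussian (E d)) = 1 := by
  have hmp := measurePreserving_eval_multivariateGaussian (μ := (0 : E d))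
    (S := (1 : Matrix (Fin d) (Fin d) ℝ)) Matrix.PosSemidef.one (i := j)
  rw [multivariateGaussian_zero_one] at hmp
  simp only [PiLp.zero_apply, Matrix.one_apply_eq, Real.toNNReal_one] at hmp
  have h1 : ∫⁻ z : E d, ‖z j‖ₑ ^ 2 ∂(stdGaussian (E d)) = ∫⁻ y : ℝ, ‖y‖ₑ ^ 2 ∂(gaussianReal 0 1) :=
    hmp.lintegral_comp (f := fun y : ℝ => ‖y‖ₑ ^ 2) (by fun_prop)
  rw [h1]
  have hv := variance_id_gaussianReal (μ := 0) (v := 1)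
  have hm : MemLp id 2 (gaussianReal 0 1) := IsGaussian.memLp_two_id
  have hev := ofReal_variance hm
  rw [hv, evariance] at hev
  simp only [integral_id_gaussianReal, id, sub_zero, NNReal.coe_one, ENNReal.ofReal_one] at hev
  exact hev.symm

theorem enorm_sq_eq_sum (x : E d) : ‖x‖ₑ ^ 2 = ∑ j, ‖x j‖ₑ ^ 2 := by
  have h : ∀ {F : Type} [NormedAddCommGroup F] (y : F), ‖y‖ₑ ^ 2 = ENNReal.ofReal (‖y‖ ^ 2) :=
    fun y => by rw [ENNReal.ofReal_pow (norm_nonneg _), ofReal_norm]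
  rw [h, EuclideanSpace.norm_sq_eq, ENNReal.ofReal_sum_of_nonneg fun j _ => sq_nonneg _]
  exact Finset.sum_congr rfl fun j _ => (h _).symm

theorem lintegral_scale_sq (s : E d) :
    ∫⁻ z, ‖scale s z‖ₑ ^ 2 ∂(stdGaussian (E d)) = ENNReal.ofReal (‖s‖ ^ 2) := by
  simp only [enorm_sq_eq_sum, scale_apply, enorm_mul, mul_pow]
  rw [lintegral_finsetSum _ fun j _ => by fun_prop]
  have h : ∀ j, ∫⁻ z : E d, ‖s j‖ₑ ^ 2 * ‖z j‖ₑ ^ 2 ∂(stdGaussian (E d)) = ‖s j‖ₑ ^ 2 := fun j => by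
    rw [lintegral_const_mul _ (by fun_prop), lintegral_coord_sq_stdGaussian, mul_one]
  rw [Finset.sum_congr rfl fun j _ => h j, ← enorm_sq_eq_sum,
    ENNReal.ofReal_pow (norm_nonneg _), ofReal_norm]

/-- Both Gaussians are images of the same standard Gaussian; moving each sample `scale s z` to
`scale t z` has this cost. -/
theorem wassersteinSq_diagGaussian_le {s t : E d} (hs : s ∈ nonnegDiag d)
    (ht : t ∈ nonnegDiag d) :
    wassersteinSq (diagGaussian s) (diagGaussian t) ≤ ENNReal.ofReal (‖s - t‖ ^ 2) := by
  have hms := (continuous_scale_right s).measurable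
  have hmt := (continuous_scale_right t).measurable
  have hm : Measurable fun z => (scale s z, scale t z) := hms.prodMk hmt
  have hP : (stdGaussian (E d)).map (fun z => (scale s z, scale t z)) ∈
      couplings (diagGaussian s) (diagGaussian t) := by
    constructor
    · rw [Measure.map_map measurable_fst hm, diagGaussian_eq_map hs]; rfl
    · rw [Measure.map_map measurable_snd hm, diagGaussian_eq_map ht]; rfl
  refine (iInf₂_le _ hP).trans ?_
  rw [lintegral_map (by fun_prop) hm, ← lintegral_scale_sq]
  refine (lintegral_congr fun z => ?_).le
  rw [edist_eq_enorm_sub]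
  congr 2
  ext j
  simp [sub_mul]

/-- The `L²` norm of the `j`-th coordinate. -/
noncomputable def coordNorm (ρ : Measure (E d)) (j : Fin d) : ℝ≥0∞ :=
  eLpNorm (fun x : E d => x j) 2 ρ

theorem coordNorm_diagGaussian {s : E d} (hs : s ∈ nonnegDiag d) (j : Fin d) :
    coordNorm (diagGaussian s) j = ENNReal.ofReal (s j) := by
  have hm := (continuous_scale_right s).measurable
  rw [coordNorm, diagGaussian_eq_map hs, eLpNorm_map_measure (by fun_prop) hm.aemeasurable,
    eLpNorm_eq_lintegral_rpow_enorm_toReal (by norm_num) (by norm_num)]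
  simp only [Function.comp_apply, scale_apply, enorm_mul, ENNReal.toReal_ofNat,
    ENNReal.rpow_ofNat, mul_pow]
  rw [lintegral_const_mul _ (by fun_prop), lintegral_coord_sq_stdGaussian, mul_one,
    ← ENNReal.rpow_ofNat, ← ENNReal.rpow_mul]
  norm_num
  rw [Real.enorm_of_nonneg (hs j)]

theorem sum_eLpNorm_sq_eq (P : Measure (E d × E d)) :
    ∑ j, (eLpNorm (fun z : E d × E d => z.1 j - z.2 j) 2 P) ^ 2 = ∫⁻ z, edist z.1 z.2 ^ 2 ∂P := by
  simp only [edist_eq_enorm_sub, enorm_sq_eq_sum]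
  rw [lintegral_finsetSum _ fun j _ => by fun_prop]
  refine Finset.sum_congr rfl fun j _ => ?_
  rw [eLpNorm_eq_lintegral_rpow_enorm_toReal (by norm_num) (by norm_num)]
  simp only [ENNReal.toReal_ofNat, ENNReal.rpow_ofNat]
  rw [← ENNReal.rpow_natCast, ← ENNReal.rpow_mul]
  norm_num

/-- Minkowski's inequality in `L²(P)`, with the coordinate norms read off the marginals of `P`. -/
theorem coordNorm_le {ρ μ : Measure (E d)} {P : Measure (E d × E d)} (hP : P ∈ couplings ρ μ)
    (j : Fin d) : coordNorm ρ j ≤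
      eLpNorm (fun z : E d × E d => z.1 j - z.2 j) 2 P + coordNorm μ j ∧
    coordNorm μ j ≤ eLpNorm (fun z : E d × E d => z.1 j - z.2 j) 2 P + coordNorm ρ j := by
  have hr : coordNorm ρ j = eLpNorm (fun z : E d × E d => z.1 j) 2 P := by
    rw [coordNorm, ← hP.1, eLpNorm_map_measure (by fun_prop) (by fun_prop)]; rfl
  have hm : coordNorm μ j = eLpNorm (fun z : E d × E d => z.2 j) 2 P := by
    rw [coordNorm, ← hP.2, eLpNorm_map_measure (by fun_prop) (by fun_prop)]; rfl
  rw [hr, hm]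
  constructor
  · refine le_trans (le_of_eq ?_) (eLpNorm_add_le (by fun_prop) (by fun_prop) (by norm_num))
    congr 1; ext z; simp
  · rw [show eLpNorm (fun z : E d × E d => z.1 j - z.2 j) 2 P =
        eLpNorm (fun z : E d × E d => z.2 j - z.1 j) 2 P from
      eLpNorm_sub_comm (fun z : E d × E d => z.1 j) (fun z : E d × E d => z.2 j) 2 P]
    refine le_trans (le_of_eq ?_) (eLpNorm_add_le (by fun_prop) (by fun_prop) (by norm_num))
    congr 1; ext z; simp

/-- Finite distance to a measure with finite second moments forces finite second moments. An
arbitrary competitor can then be compared through a vector of coordinate norms, as if it were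
Gaussian. -/
theorem exists_coordNorm_eq {ρ μ : Measure (E d)} (h : wassersteinSq ρ μ ≠ ⊤)
    (hμ : ∀ j, coordNorm μ j ≠ ⊤) :
    ∃ a ∈ nonnegDiag d, ∀ j, coordNorm ρ j = ENNReal.ofReal (a j) := by
  have hfin : ∀ j, coordNorm ρ j ≠ ⊤ := by
    obtain ⟨P, hP, hlt⟩ : ∃ P ∈ couplings ρ μ, ∫⁻ z, edist z.1 z.2 ^ 2 ∂P < ⊤ := by
      by_contra hcon
      push Not at hcon
      exact h (by simpa [wassersteinSq, iInf_eq_top, top_le_iff] using hcon)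
    intro j
    rw [← sum_eLpNorm_sq_eq, ENNReal.sum_lt_top] at hlt
    have hj := hlt j (Finset.mem_univ j)
    refine ne_top_of_le_ne_top (ENNReal.add_ne_top.2 ⟨fun htop => ?_, hμ j⟩) (coordNorm_le hP j).1
    rw [htop] at hj
    simp at hj
  refine ⟨WithLp.toLp 2 fun j => (coordNorm ρ j).toReal,
    fun j => ENNReal.toReal_nonneg, fun j => ?_⟩
  exact (ENNReal.ofReal_toReal (hfin j)).symm

/-- The reverse triangle inequality in each coordinate. Nothing Gaussian is used, so the bound
applies to all candidates for the barycenter. -/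
theorem ofReal_norm_sub_sq_le_wassersteinSq {ρ μ : Measure (E d)} {a b : E d}
    (ha : a ∈ nonnegDiag d) (hb : b ∈ nonnegDiag d)
    (hρ : ∀ j, coordNorm ρ j = ENNReal.ofReal (a j))
    (hμ : ∀ j, coordNorm μ j = ENNReal.ofReal (b j)) :
    ENNReal.ofReal (‖a - b‖ ^ 2) ≤ wassersteinSq ρ μ := by
  refine le_iInf₂ fun P hP => ?_
  rw [← sum_eLpNorm_sq_eq, ENNReal.ofReal_pow (norm_nonneg _), ofReal_norm, enorm_sq_eq_sum]
  refine Finset.sum_le_sum fun j _ => ?_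
  gcongr
  obtain ⟨h1, h2⟩ := coordNorm_le hP j
  rw [hρ, hμ] at h1 h2
  set e := eLpNorm (fun z : E d × E d => z.1 j - z.2 j) 2 P
  rcases eq_or_ne e ⊤ with he | he
  · rw [he]; exact le_top
  rw [← ENNReal.ofReal_toReal he] at h1 h2 ⊢
  rw [← ENNReal.ofReal_add ENNReal.toReal_nonneg (hb j),
    ENNReal.ofReal_le_ofReal_iff (add_nonneg ENNReal.toReal_nonneg (hb j))] at h1
  rw [← ENNReal.ofReal_add ENNReal.toReal_nonneg (ha j),
    ENNReal.ofReal_le_ofReal_iff (add_nonneg ENNReal.toReal_nonneg (ha j))] at h2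
  rw [← ofReal_norm, ENNReal.ofReal_le_ofReal_iff ENNReal.toReal_nonneg, Real.norm_eq_abs, abs_le,
    PiLp.sub_apply]
  constructor <;> linarith

theorem wassersteinSq_diagGaussian {s t : E d} (hs : s ∈ nonnegDiag d) (ht : t ∈ nonnegDiag d) :
    wassersteinSq (diagGaussian s) (diagGaussian t) = ENNReal.ofReal (‖s - t‖ ^ 2) :=
  le_antisymm (wassersteinSq_diagGaussian_le hs ht)
    (ofReal_norm_sub_sq_le_wassersteinSq hs ht (coordNorm_diagGaussian hs)
      (coordNorm_diagGaussian ht))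

theorem diagGaussian_injOn : InjOn (diagGaussian (d := d)) (nonnegDiag d) := by
  intro s hs t ht h
  have h1 := wassersteinSq_diagGaussian hs ht
  have h2 := wassersteinSq_diagGaussian ht ht
  rw [h, h2] at h1
  simp only [sub_self, norm_zero, ne_eq, OfNat.ofNat_ne_zero, not_false_eq_true, zero_pow,
    ENNReal.ofReal_zero] at h1
  have h3 := ENNReal.ofReal_eq_zero.1 h1.symm
  have h4 : ‖s - t‖ = 0 := by nlinarith [norm_nonneg (s - t)]
  exact sub_eq_zero.1 (norm_eq_zero.1 h4)

theorem half_add_mem_nonnegDiag {s t : E d} (hs : s ∈ nonnegDiag d) (ht : t ∈ nonnegDiag d) :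
    (1 / 2 : ℝ) • (s + t) ∈ nonnegDiag d := fun j => by
  have := hs j
  have := ht j
  simp only [PiLp.smul_apply, PiLp.add_apply, smul_eq_mul]
  linarith

/-- The parallelogram law isolates the excess over the midpoint, which gives both minimality of the
midpoint and rigidity of the minimizers. -/
theorem half_sum_norm_sq (a s t : E d) : ‖a - s‖ ^ 2 / 2 + ‖a - t‖ ^ 2 / 2 =
    ‖a - (1 / 2 : ℝ) • (s + t)‖ ^ 2 + ‖s - t‖ ^ 2 / 4 := by
  have h := parallelogram_law_with_norm ℝ (a - s) (a - t)
  have e1 : (a - s) + (a - t) = (2 : ℝ) • (a - (1 / 2 : ℝ) • (s + t)) := by module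
  have e2 : (a - s) - (a - t) = -(s - t) := by abel
  rw [e1, e2, norm_neg, norm_smul, Real.norm_ofNat] at h
  nlinarith

theorem ofReal_half_add_half {a b : ℝ} (ha : 0 ≤ a) (hb : 0 ≤ b) :
    ENNReal.ofReal a / 2 + ENNReal.ofReal b / 2 = ENNReal.ofReal (a / 2 + b / 2) := by
  rw [ENNReal.ofReal_add (by positivity) (by positivity), ENNReal.ofReal_div_of_pos two_pos,
    ENNReal.ofReal_div_of_pos two_pos, ENNReal.ofReal_ofNat]

variable {s t : E d}

theorem barycenter_value (hs : s ∈ nonnegDiag d) (ht : t ∈ nonnegDiag d) :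
    wassersteinSq (diagGaussian ((1 / 2 : ℝ) • (s + t))) (diagGaussian s) / 2 +
      wassersteinSq (diagGaussian ((1 / 2 : ℝ) • (s + t))) (diagGaussian t) / 2 =
      ENNReal.ofReal (‖s - t‖ ^ 2 / 4) := by
  have hm := half_add_mem_nonnegDiag hs ht
  rw [wassersteinSq_diagGaussian hm hs, wassersteinSq_diagGaussian hm ht,
    ofReal_half_add_half (sq_nonneg _) (sq_nonneg _), half_sum_norm_sq, sub_self]
  simp

theorem le_barycenter_value (hs : s ∈ nonnegDiag d) (ht : t ∈ nonnegDiag d)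
    (ρ : Measure (E d)) {a : E d} (ha : a ∈ nonnegDiag d)
    (hρ : ∀ j, coordNorm ρ j = ENNReal.ofReal (a j)) :
    ENNReal.ofReal (‖a - (1 / 2 : ℝ) • (s + t)‖ ^ 2 + ‖s - t‖ ^ 2 / 4) ≤
      wassersteinSq ρ (diagGaussian s) / 2 + wassersteinSq ρ (diagGaussian t) / 2 := by
  rw [← half_sum_norm_sq, ← ofReal_half_add_half (sq_nonneg _) (sq_nonneg _)]
  gcongr
  · exact ofReal_norm_sub_sq_le_wassersteinSq ha hs hρ (coordNorm_diagGaussian hs)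
  · exact ofReal_norm_sub_sq_le_wassersteinSq ha ht hρ (coordNorm_diagGaussian ht)

theorem diagGaussian_mem_barycenters (hs : s ∈ nonnegDiag d) (ht : t ∈ nonnegDiag d) :
    diagGaussian ((1 / 2 : ℝ) • (s + t)) ∈ barycenters (diagGaussian s) (diagGaussian t) := by
  refine ⟨inferInstance, fun ρ _ => ?_⟩
  rw [barycenter_value hs ht]
  rcases eq_or_ne (wassersteinSq ρ (diagGaussian s)) ⊤ with h | h
  · rw [h, ENNReal.top_div_of_ne_top (by norm_num), top_add]; exact le_top
  obtain ⟨a, ha, hρ⟩ := exists_coordNorm_eq h fun j => by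
    rw [coordNorm_diagGaussian hs]; exact ENNReal.ofReal_ne_top
  refine le_trans (ENNReal.ofReal_le_ofReal ?_) (le_barycenter_value hs ht ρ ha hρ)
  linarith [sq_nonneg ‖a - (1 / 2 : ℝ) • (s + t)‖]

/-- Barycenters of degenerate Gaussians need not be unique, but the excess term must vanish for each
of them. This fixes the coordinate norms, all that the lower bound for the distance requires. -/
theorem coordNorm_of_mem_barycenters (hs : s ∈ nonnegDiag d) (ht : t ∈ nonnegDiag d)
    {ρ : Measure (E d)} (h : ρ ∈ barycenters (diagGaussian s) (diagGaussian t)) (j : Fin d) :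
    coordNorm ρ j = ENNReal.ofReal (((1 / 2 : ℝ) • (s + t)) j) := by
  have hle := h.2 (diagGaussian ((1 / 2 : ℝ) • (s + t))) inferInstance
  rw [barycenter_value hs ht] at hle
  have hfin : wassersteinSq ρ (diagGaussian s) ≠ ⊤ := fun htop => by
    rw [htop, ENNReal.top_div_of_ne_top (by norm_num), top_add, top_le_iff] at hle
    exact ENNReal.ofReal_ne_top hle
  obtain ⟨a, ha, hρ⟩ := exists_coordNorm_eq hfin fun j => by
    rw [coordNorm_diagGaussian hs]; exact ENNReal.ofReal_ne_top
  have h1 := (le_barycenter_value hs ht ρ ha hρ).trans hle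
  rw [ENNReal.ofReal_le_ofReal_iff (by positivity)] at h1
  have h2 : ‖a - (1 / 2 : ℝ) • (s + t)‖ = 0 := by
    nlinarith [norm_nonneg (a - (1 / 2 : ℝ) • (s + t))]
  rw [hρ, sub_eq_zero.1 (norm_eq_zero.1 h2)]

theorem iInf_wassersteinSq_barycenters (hs : s ∈ nonnegDiag d) (ht : t ∈ nonnegDiag d)
    {r : E d} (hr : r ∈ nonnegDiag d) :
    ⨅ ρ ∈ barycenters (diagGaussian s) (diagGaussian t), wassersteinSq (diagGaussian r) ρ =
      ENNReal.ofReal (‖r - (1 / 2 : ℝ) • (s + t)‖ ^ 2) := by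
  have hm := half_add_mem_nonnegDiag hs ht
  refine le_antisymm ?_ (le_iInf₂ fun ρ hρ => ?_)
  · exact (iInf₂_le _ (diagGaussian_mem_barycenters hs ht)).trans
      (wassersteinSq_diagGaussian hr hm).le
  · exact ofReal_norm_sub_sq_le_wassersteinSq hr hm (coordNorm_diagGaussian hr)
      (coordNorm_of_mem_barycenters hs ht hρ)

/-- The discrete energy of a tuple of diagonal Gaussians. -/
theorem discreteRegEnergy_diagGaussian {δ : ℝ} (hδ : 0 < δ) {K : ℕ} {x : ℕ → E d}
    (hx : ∀ k ≤ K, x k ∈ nonnegDiag d) :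
    discreteRegEnergy δ K (fun k => diagGaussian (x k)) =
      ENNReal.ofReal ((K : ℝ) ^ 3 * ∑ k ∈ Finset.Ico 1 K, ‖secDiff K x k‖ ^ 2 +
        δ * (K * ∑ k ∈ Finset.range K, ‖x (k + 1) - x k‖ ^ 2)) := by
  have hspline : discreteSplineEnergy K (fun k => diagGaussian (x k)) =
      ENNReal.ofReal ((K : ℝ) ^ 3 * ∑ k ∈ Finset.Ico 1 K, ‖secDiff K x k‖ ^ 2) := by
    have hterm : ∀ k ∈ Finset.Ico 1 K,
        ⨅ ρ ∈ barycenters (diagGaussian (x (k - 1))) (diagGaussian (x (k + 1))),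
          wassersteinSq (diagGaussian (x k)) ρ = ENNReal.ofReal (‖secDiff K x k‖ ^ 2 / 4) := by
      intro k hk
      rw [Finset.mem_Ico] at hk
      rw [iInf_wassersteinSq_barycenters (hx _ (by omega)) (hx _ (by omega)) (hx _ (by omega)),
        secDiff, if_pos hk]
      congr 1
      -- The second difference is minus twice the deviation from the midpoint; the resulting `1/4`
      -- cancels the factor 4 in the spline energy.
      have e : x (k + 1) - (2 : ℝ) • x k + x (k - 1) =
          (-2 : ℝ) • (x k - (1 / 2 : ℝ) • (x (k - 1) + x (k + 1))) := by module
      rw [e, norm_smul, mul_pow]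
      norm_num
    rw [discreteSplineEnergy, Finset.sum_congr rfl hterm,
      ← ENNReal.ofReal_sum_of_nonneg (fun k _ => by positivity)]
    rw [show (4 : ℝ≥0∞) * (K : ℝ≥0∞) ^ 3 = ENNReal.ofReal (4 * (K : ℝ) ^ 3) by
      rw [ENNReal.ofReal_mul (by norm_num), ENNReal.ofReal_pow (by positivity),
        ENNReal.ofReal_natCast, ENNReal.ofReal_ofNat], ← ENNReal.ofReal_mul (by positivity),
      ← Finset.sum_div]
    congr 1; ring
  have hpath : discretePathEnergy K (fun k => diagGaussian (x k)) =
      ENNReal.ofReal (K * ∑ k ∈ Finset.range K, ‖x (k + 1) - x k‖ ^ 2) := by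
    have hterm : ∀ k ∈ Finset.range K, wassersteinSq (diagGaussian (x k))
        (diagGaussian (x (k + 1))) = ENNReal.ofReal (‖x (k + 1) - x k‖ ^ 2) := by
      intro k hk
      rw [Finset.mem_range] at hk
      rw [wassersteinSq_diagGaussian (hx _ hk.le) (hx _ hk), norm_sub_rev]
    rw [discretePathEnergy, Finset.sum_congr rfl hterm,
      ← ENNReal.ofReal_sum_of_nonneg (fun k _ => by positivity),
      ENNReal.ofReal_mul (by positivity), ENNReal.ofReal_natCast]
  rw [discreteRegEnergy, hspline, hpath, ← ENNReal.ofReal_mul hδ.le,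
    ← ENNReal.ofReal_add (by positivity) (by positivity)]

end Gaussian

/-! ### Curves of diagonal Gaussians in Lagrangian coordinates -/

section Lagrange

variable {d : ℕ}

theorem norm_scale_le (s z : E d) : ‖scale s z‖ ≤ ‖s‖ * ‖z‖ := by
  rw [← abs_of_nonneg (norm_nonneg (scale s z)), ← abs_of_nonneg (mul_nonneg (norm_nonneg s)
    (norm_nonneg z)), ← sq_le_sq, mul_pow, EuclideanSpace.norm_sq_eq, EuclideanSpace.norm_sq_eq z,
    Finset.mul_sum]
  refine Finset.sum_le_sum fun j _ => ?_
  rw [scale_apply, norm_mul, mul_pow]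
  gcongr
  exact PiLp.norm_apply_le s j

/-- `scale` as a linear map of its first argument. -/
noncomputable def scaleL (z : E d) : E d →L[ℝ] E d :=
  LinearMap.toContinuousLinearMap
    { toFun := fun s => scale s z
      map_add' := fun s t => by ext j; simp [add_mul]
      map_smul' := fun r s => by ext j; simp [mul_assoc] }

theorem scaleL_apply (z s : E d) : scaleL z s = scale s z := rfl

theorem hasDerivAt_scale_rep (u : H2 d) (z : E d) (t : ℝ) :
    HasDerivAt (fun t => scale (H2.rep u t) z) (scale (H2.vel u t) z) t :=
  (scaleL z).hasFDerivAt.comp_hasDerivAt t (H2.hasDerivAt_rep u t)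

variable {u : H2 d}

theorem H2.hasDerivAt_rep_coord (u : H2 d) (j : Fin d) (t : ℝ) :
    HasDerivAt (fun t => H2.rep u t j) (H2.vel u t j) t :=
  ((EuclideanSpace.proj (𝕜 := ℝ) j).hasFDerivAt.comp_hasDerivAt t (H2.hasDerivAt_rep u t))

/-- A nonnegative entry has vanishing derivative at its zeros. -/
theorem vel_eq_zero_of_rep_eq_zero (hu : u ∈ H2Curves (nonnegDiag d)) {t : ℝ}
    (ht : t ∈ Ioo (0 : ℝ) 1) {j : Fin d} (h : H2.rep u t j = 0) : H2.vel u t j = 0 := by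
  rw [mem_H2Curves_iff] at hu
  have hmin : IsLocalMin (fun t => H2.rep u t j) t := by
    filter_upwards [Icc_mem_nhds ht.1 ht.2] with s hs
    rw [h]; exact hu s hs j
  exact hmin.hasDerivAt_eq_zero (H2.hasDerivAt_rep_coord u j t)

theorem ae_hasDerivAt_vel (u : H2 d) : ∀ᵐ t, HasDerivAt (H2.vel u) (H2.acc u t) t := by
  filter_upwards [LocallyIntegrable.ae_hasDerivAt_integral (H2.integrable_acc u).locallyIntegrable]
    with t ht
  rw [show H2.vel u = _ from funext (H2.vel_eq u)]
  exact (ht 0).const_add _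

/-- The second derivative of a nonnegative entry vanishes almost everywhere on its zero set. -/
theorem ae_acc_eq_zero_of_rep_eq_zero (hu : u ∈ H2Curves (nonnegDiag d)) :
    ∀ᵐ t ∂(volume.restrict (Ioo (0 : ℝ) 1)), ∀ j, H2.rep u t j = 0 → H2.acc u t j = 0 := by
  rw [ae_all_iff]
  intro j
  set S : Set ℝ := {t | t ∈ Ioo (0 : ℝ) 1 ∧ H2.rep u t j = 0} with hS
  -- Zeros isolated from the right are countable, hence null. At any other zero the difference
  -- quotients of the velocity may be taken along zeros, where they all vanish.
  have hcount : {t ∈ S | 𝓝[S ∩ Ioi t] t = ⊥}.Countable := countable_setOfPred_isolated_right_within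
  rw [ae_restrict_iff' measurableSet_Ioo]
  filter_upwards [ae_hasDerivAt_vel u, hcount.ae_notMem volume] with t hder hiso ht h0
  have hne : (𝓝[S ∩ Ioi t] t).NeBot := ⟨fun hbot => hiso ⟨⟨ht, h0⟩, hbot⟩⟩
  have hj : HasDerivAt (fun t => H2.vel u t j) (H2.acc u t j) t :=
    (EuclideanSpace.proj (𝕜 := ℝ) j).hasFDerivAt.comp_hasDerivAt t hder
  have hlim : Tendsto (slope (fun t => H2.vel u t j) t) (𝓝[S ∩ Ioi t] t) (𝓝 (H2.acc u t j)) :=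
    (hasDerivAt_iff_tendsto_slope.1 hj).mono_left
      (nhdsWithin_mono _ fun s hs => ne_of_gt hs.2)
  refine tendsto_nhds_unique hlim ((tendsto_const_nhds (x := (0 : ℝ))).congr' ?_)
  filter_upwards [self_mem_nhdsWithin] with s hs
  rw [slope_def_field, vel_eq_zero_of_rep_eq_zero hu hs.1.1 hs.1.2,
    vel_eq_zero_of_rep_eq_zero hu ht h0]
  simp

theorem ae_diagGaussian_eq (hu : u ∈ H2Curves (nonnegDiag d)) :
    ∀ᵐ t ∂(volume.restrict (Ioo (0 : ℝ) 1)),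
      diagGaussian (H2.fn u t) = (stdGaussian (E d)).map (scale (H2.rep u t)) := by
  filter_upwards [H2.rep_ae u, ae_restrict_mem measurableSet_Ioo] with t h1 h2
  rw [show H2.fn u t = H2.rep u t from h1]
  exact diagGaussian_eq_map (mem_H2Curves_iff.1 hu t (Ioo_subset_Icc_self h2))

/-- The Lagrangian flow `(t, z) ↦ (t, σ_t z)`. -/
noncomputable def flow (u : H2 d) (p : ℝ × E d) : ℝ × E d := (p.1, scale (H2.rep u p.1) p.2)

theorem continuous_flow (u : H2 d) : Continuous (flow u) :=
  continuous_fst.prodMk (continuous_scale.comp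
    (((H2.continuous_rep u).comp continuous_fst).prodMk continuous_snd))

/-- Lebesgue measure on `(0,1)` times the standard Gaussian. -/
noncomputable abbrev lagrange (d : ℕ) : Measure (ℝ × E d) :=
  (volume.restrict (Ioo (0 : ℝ) 1)).prod (stdGaussian (E d))

/-- Every space-time integral is moved to the fixed measure `lagrange d`; degenerate time slices
need no separate treatment there. -/
theorem lintegral_curve (hu : u ∈ H2Curves (nonnegDiag d)) {F : ℝ × E d → ℝ≥0∞}
    (hF : Measurable F) :
    ∫⁻ t in Ioo (0 : ℝ) 1, ∫⁻ x, F (t, x) ∂(diagGaussian (H2.fn u t)) =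
      ∫⁻ p, F (flow u p) ∂(lagrange d) := by
  have hm : Measurable fun p => F (flow u p) := hF.comp (continuous_flow u).measurable
  rw [lintegral_prod _ hm.aemeasurable]
  refine lintegral_congr_ae ?_
  filter_upwards [ae_diagGaussian_eq hu] with t ht
  have hm' : Measurable fun x => F (t, x) := hF.comp measurable_prodMk_left
  rw [ht, lintegral_map hm' (continuous_scale_right _).measurable]
  rfl

theorem integral_curve (hu : u ∈ H2Curves (nonnegDiag d)) {F : ℝ × E d → ℝ}
    (hF : Measurable F) (hi : Integrable (fun p => F (flow u p)) (lagrange d)) :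
    ∫ t in Ioo (0 : ℝ) 1, ∫ x, F (t, x) ∂(diagGaussian (H2.fn u t)) =
      ∫ p, F (flow u p) ∂(lagrange d) := by
  rw [integral_prod _ hi]
  refine integral_congr_ae ?_
  filter_upwards [ae_diagGaussian_eq hu] with t ht
  have hm : Measurable fun x => F (t, x) := hF.comp measurable_prodMk_left
  rw [ht, integral_map (continuous_scale_right _).measurable.aemeasurable hm.aestronglyMeasurable]
  rfl

theorem memLp_two_of_lintegral {α F : Type*} [MeasurableSpace α] [NormedAddCommGroup F]
    {μ : Measure α} {f : α → F} (hf : AEStronglyMeasurable f μ) (h : ∫⁻ x, ‖f x‖ₑ ^ 2 ∂μ < ⊤) :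
    MemLp f 2 μ := by
  refine ⟨hf, (eLpNorm_lt_top_iff_lintegral_rpow_enorm_lt_top (by norm_num) (by norm_num)).2 ?_⟩
  simpa using h

theorem lintegral_lt_top_of_memLp_two {α F : Type*} [MeasurableSpace α] [NormedAddCommGroup F]
    {μ : Measure α} {f : α → F} (h : MemLp f 2 μ) : ∫⁻ x, ‖f x‖ₑ ^ 2 ∂μ < ⊤ := by
  have := (eLpNorm_lt_top_iff_lintegral_rpow_enorm_lt_top (by norm_num) (by norm_num)).1 h.2
  simpa using this

theorem integrable_inner_of_memLp {α F : Type*} [MeasurableSpace α] [NormedAddCommGroup F]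
    [InnerProductSpace ℝ F] {μ : Measure α} {f g : α → F} (hf : MemLp f 2 μ) (hg : MemLp g 2 μ) :
    Integrable (fun x => inner ℝ (f x) (g x)) μ := by
  refine (hf.norm.integrable_mul hg.norm).mono' (hf.1.inner hg.1) (Eventually.of_forall fun x => ?_)
  exact norm_inner_le_norm _ _

theorem spaceTimeSq_curve (hu : u ∈ H2Curves (nonnegDiag d)) {w : ℝ → E d → E d}
    (hw : Measurable (Function.uncurry w)) :
    spaceTimeSq (fun t => diagGaussian (H2.fn u t)) w =
      ∫⁻ p, ‖Function.uncurry w (flow u p)‖ₑ ^ 2 ∂(lagrange d) :=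
  lintegral_curve hu (F := fun p => ‖Function.uncurry w p‖ₑ ^ 2) (hw.enorm.pow_const 2)

theorem memLp_curve (hu : u ∈ H2Curves (nonnegDiag d)) {w : ℝ → E d → E d}
    (hw : Measurable (Function.uncurry w))
    (hfin : spaceTimeSq (fun t => diagGaussian (H2.fn u t)) w < ⊤) :
    MemLp (fun p => Function.uncurry w (flow u p)) 2 (lagrange d) := by
  refine memLp_two_of_lintegral (hw.comp (continuous_flow u).measurable).aestronglyMeasurable ?_
  rwa [← spaceTimeSq_curve hu hw]

theorem measurable_scale_comp {f : ℝ → E d} (hf : Measurable f) :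
    Measurable fun p : ℝ × E d => scale (f p.1) p.2 :=
  continuous_scale.measurable.comp ((hf.comp measurable_fst).prodMk measurable_snd)

theorem ofReal_integral_norm_sq {f : ℝ → E d}
    (hf : MemLp f 2 (volume.restrict (Ioo (0 : ℝ) 1))) :
    ENNReal.ofReal (∫ t in Ioo (0 : ℝ) 1, ‖f t‖ ^ 2) = ∫⁻ t in Ioo (0 : ℝ) 1, ‖f t‖ₑ ^ 2 := by
  rw [ofReal_integral_eq_lintegral_ofReal (hf.integrable_norm_pow (by norm_num))
    (Eventually.of_forall fun _ => sq_nonneg _)]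
  refine lintegral_congr fun t => ?_
  rw [ENNReal.ofReal_pow (norm_nonneg _), ofReal_norm]

theorem lintegral_scale_comp {f : ℝ → E d} (hf : Measurable f) :
    ∫⁻ p, ‖scale (f p.1) p.2‖ₑ ^ 2 ∂(lagrange d) = ∫⁻ t in Ioo (0 : ℝ) 1, ‖f t‖ₑ ^ 2 := by
  rw [lintegral_prod _ ((measurable_scale_comp hf).enorm.pow_const 2).aemeasurable]
  refine lintegral_congr fun t => ?_
  dsimp only
  rw [lintegral_scale_sq, ENNReal.ofReal_pow (norm_nonneg _), ofReal_norm]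

theorem memLp_scale_comp {f : ℝ → E d} (hfm : Measurable f)
    (hf : MemLp f 2 (volume.restrict (Ioo (0 : ℝ) 1))) :
    MemLp (fun p => scale (f p.1) p.2) 2 (lagrange d) := by
  refine memLp_two_of_lintegral (measurable_scale_comp hfm).aestronglyMeasurable ?_
  rw [lintegral_scale_comp hfm]
  exact lintegral_lt_top_of_memLp_two hf

theorem memLp_vel (u : H2 d) : MemLp (H2.vel u) 2 (volume.restrict (Ioo (0 : ℝ) 1)) :=
  (memLp_congr_ae (H2.vel_ae u)).1 (Lp.memLp _)

/-- The Lagrangian velocity. -/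
noncomputable def lagVel (u : H2 d) (p : ℝ × E d) : E d := scale (H2.vel u p.1) p.2

/-- The Lagrangian acceleration. -/
noncomputable def lagAcc (u : H2 d) (p : ℝ × E d) : E d := scale (H2.acc u p.1) p.2

theorem memLp_lagVel (u : H2 d) : MemLp (lagVel u) 2 (lagrange d) :=
  memLp_scale_comp (H2.continuous_vel u).measurable (memLp_vel u)

theorem memLp_lagAcc (u : H2 d) : MemLp (lagAcc u) 2 (lagrange d) :=
  memLp_scale_comp (H2.stronglyMeasurable_acc u).measurable (H2.memLp_acc u)

theorem lintegral_lagVel (u : H2 d) :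
    ∫⁻ p, ‖lagVel u p‖ₑ ^ 2 ∂(lagrange d) = ENNReal.ofReal (‖u.1 1‖ ^ 2) := by
  rw [H2.norm_sq_one, ofReal_integral_norm_sq (memLp_vel u)]
  exact lintegral_scale_comp (H2.continuous_vel u).measurable

theorem lintegral_lagAcc (u : H2 d) :
    ∫⁻ p, ‖lagAcc u p‖ₑ ^ 2 ∂(lagrange d) = ENNReal.ofReal (‖u.1 2‖ ^ 2) := by
  rw [H2.norm_sq_two, ofReal_integral_norm_sq (H2.memLp_acc u)]
  exact lintegral_scale_comp (H2.stronglyMeasurable_acc u).measurable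

end Lagrange

/-! ### Continuity and momentum equations along the Lagrangian flow -/

section TestEquations

variable {d : ℕ} {u : H2 d}

theorem IsSpaceTimeTest.exists_bounds {F : Type*} [NormedAddCommGroup F] [NormedSpace ℝ F]
    {φ : ℝ × E d → F} (h : IsSpaceTimeTest φ) :
    ∃ C, 0 ≤ C ∧ ∀ q, ‖φ q‖ ≤ C ∧ ‖fderiv ℝ φ q‖ ≤ C := by
  obtain ⟨C1, h1⟩ := h.2.1.exists_bound_of_continuous h.1.continuous
  obtain ⟨C2, h2⟩ := (h.2.1.fderiv ℝ).exists_bound_of_continuous (h.1.continuous_fderiv (by simp))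
  exact ⟨max C1 C2, ((norm_nonneg _).trans (h1 0)).trans (le_max_left _ _),
    fun q => ⟨(h1 q).trans (le_max_left _ _), (h2 q).trans (le_max_right _ _)⟩⟩

theorem IsSpaceTimeTest.eq_zero {F : Type*} [NormedAddCommGroup F] [NormedSpace ℝ F]
    {φ : ℝ × E d → F} (h : IsSpaceTimeTest φ) {q : ℝ × E d} (hq : q.1 ∉ Ioo (0 : ℝ) 1) :
    φ q = 0 :=
  image_eq_zero_of_notMem_tsupport fun hmem => hq (h.2.2 hmem).1

theorem memLp_fderiv_test {F : Type*} [NormedAddCommGroup F] [NormedSpace ℝ F]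
    {φ : ℝ × E d → F} (h : IsSpaceTimeTest φ) {w : ℝ × E d → E d} (hw : MemLp w 2 (lagrange d)) :
    MemLp (fun p => fderiv ℝ φ (flow u p) ((1 : ℝ), w p)) 2 (lagrange d) := by
  obtain ⟨C, hC, hb⟩ := h.exists_bounds
  refine MemLp.mono' (g := fun p => C * (1 + ‖w p‖))
    (((memLp_const (1 : ℝ)).add hw.norm).const_mul C) ?_ (Eventually.of_forall fun p => ?_)
  · refine (ContinuousLinearMap.id ℝ (ℝ × E d →L[ℝ] F)).aestronglyMeasurable_comp₂ ?_ ?_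
    · exact ((h.1.continuous_fderiv (by simp)).comp (continuous_flow u)).aestronglyMeasurable
    · exact aestronglyMeasurable_const.prodMk hw.1
  · refine ((fderiv ℝ φ (flow u p)).le_opNorm _).trans ?_
    refine mul_le_mul (hb _).2 ?_ (norm_nonneg _) hC
    rw [Prod.norm_def]
    refine max_le ?_ ?_
    · simp
    · linarith

theorem memLp_test {F : Type*} [NormedAddCommGroup F] [NormedSpace ℝ F]
    {φ : ℝ × E d → F} (h : IsSpaceTimeTest φ) :
    MemLp (fun p => φ (flow u p)) 2 (lagrange d) := by
  obtain ⟨C, hC, hb⟩ := h.exists_bounds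
  exact MemLp.of_bound (h.1.continuous.comp (continuous_flow u)).aestronglyMeasurable C
    (Eventually.of_forall fun p => (hb _).1)

theorem hasDerivAt_test_flow {F : Type*} [NormedAddCommGroup F] [NormedSpace ℝ F]
    {φ : ℝ × E d → F} (h : IsSpaceTimeTest φ) (u : H2 d) (z : E d) (t : ℝ) :
    HasDerivAt (fun t => φ (flow u (t, z)))
      (fderiv ℝ φ (flow u (t, z)) ((1 : ℝ), lagVel u (t, z))) t :=
  ((h.1.differentiable (by simp)) _).hasFDerivAt.comp_hasDerivAt t
    ((hasDerivAt_id t).prodMk (hasDerivAt_scale_rep u z t))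

theorem continuous_fderiv_test_flow {F : Type*} [NormedAddCommGroup F] [NormedSpace ℝ F]
    {φ : ℝ × E d → F} (h : IsSpaceTimeTest φ) (u : H2 d) (z : E d) :
    Continuous fun t => fderiv ℝ φ (flow u (t, z)) ((1 : ℝ), lagVel u (t, z)) := by
  have h1 : Continuous fun t : ℝ => flow u (t, z) :=
    (continuous_flow u).comp (Continuous.prodMk_left z)
  have h2 : Continuous fun t : ℝ => lagVel u (t, z) :=
    continuous_scale.comp ((H2.continuous_vel u).prodMk continuous_const)
  exact ((h.1.continuous_fderiv (by simp)).comp h1).clm_apply (continuous_const.prodMk h2)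

/-- The continuity equation in Lagrangian coordinates. -/
theorem integral_fderiv_test_lagVel {φ : ℝ × E d → ℝ} (h : IsSpaceTimeTest φ) (u : H2 d) :
    ∫ p, fderiv ℝ φ (flow u p) ((1 : ℝ), lagVel u p) ∂(lagrange d) = 0 := by
  have hi := (memLp_fderiv_test (u := u) h (memLp_lagVel u)).integrable (by norm_num)
  rw [integral_prod_symm _ hi]
  refine integral_eq_zero_of_ae (Eventually.of_forall fun z => ?_)
  dsimp only
  -- Along the trajectory of a fixed `z` the integrand is a total derivative, and the test function
  -- vanishes at both end times.
  rw [integral_Ioo_eq_intervalIntegral,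
    intervalIntegral.integral_eq_sub_of_hasDerivAt (fun t _ => hasDerivAt_test_flow h u z t)
      ((continuous_fderiv_test_flow h u z).intervalIntegrable _ _),
    h.eq_zero (by simp [flow]), h.eq_zero (by simp [flow])]
  simp

theorem integrable_acceleration_test {ψ : ℝ × E d → E d} (h : IsSpaceTimeTest ψ)
    {v a : ℝ × E d → E d} (hv : MemLp v 2 (lagrange d)) (ha : MemLp a 2 (lagrange d)) :
    Integrable (fun p => inner ℝ (fderiv ℝ ψ (flow u p) ((1 : ℝ), v p)) (v p) +
      inner ℝ (ψ (flow u p)) (a p)) (lagrange d) :=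
  (integrable_inner_of_memLp (memLp_fderiv_test h hv) hv).add
    (integrable_inner_of_memLp (memLp_test h) ha)

/-- The momentum equation in Lagrangian coordinates. -/
theorem integral_acceleration_test_lag {ψ : ℝ × E d → E d} (h : IsSpaceTimeTest ψ) (u : H2 d) :
    ∫ p, (inner ℝ (fderiv ℝ ψ (flow u p) ((1 : ℝ), lagVel u p)) (lagVel u p) +
      inner ℝ (ψ (flow u p)) (lagAcc u p)) ∂(lagrange d) = 0 := by
  have hi := integrable_acceleration_test (u := u) h (memLp_lagVel u) (memLp_lagAcc u)
  rw [integral_prod_symm _ hi]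
  refine integral_eq_zero_of_ae (Eventually.of_forall fun z => ?_)
  dsimp only
  have hacc : Integrable (H2.acc u) (volume.restrict (Ioo (0 : ℝ) 1)) :=
    (H2.integrable_acc u).integrableOn
  set f' : ℝ → E d := fun t => fderiv ℝ ψ (flow u (t, z)) ((1 : ℝ), lagVel u (t, z)) with hf'
  have hcf' : Continuous f' := continuous_fderiv_test_flow h u z
  -- For fixed `z`, velocity and acceleration have the common factor `z j`; without it this is
  -- integration by parts against the primitive of `H2.acc u`.
  have hcoord : ∀ j, ∫ t in Ioo (0 : ℝ) 1,
      (f' t j * H2.vel u t j + ψ (flow u (t, z)) j * H2.acc u t j) = 0 := by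
    intro j
    have hd : ∀ t, HasDerivAt (fun t => ψ (flow u (t, z)) j) (f' t j) t := fun t =>
      (EuclideanSpace.proj (𝕜 := ℝ) j).hasFDerivAt.comp_hasDerivAt t (hasDerivAt_test_flow h u z t)
    have hc : Continuous fun t => f' t j := (EuclideanSpace.proj (𝕜 := ℝ) j).continuous.comp hcf'
    have key := integral_deriv_mul_primitive hd hc
      (by rw [h.eq_zero (by simp [flow])]; rfl) (by rw [h.eq_zero (by simp [flow])]; rfl)
      (integrable_coord hacc j) (H2.vel u 0 j)
    refine Eq.trans (integral_congr_ae (Eventually.of_forall fun t => ?_)) key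
    dsimp only
    rw [H2.vel_eq u t, PiLp.add_apply,
      intervalIntegral_coord (H2.integrable_acc u).intervalIntegrable]
  have hint : ∀ j, Integrable (fun t => z j *
      (f' t j * H2.vel u t j + ψ (flow u (t, z)) j * H2.acc u t j))
      (volume.restrict (Ioo (0 : ℝ) 1)) := by
    intro j
    have hc1 : Continuous fun t => f' t j * H2.vel u t j :=
      ((EuclideanSpace.proj (𝕜 := ℝ) j).continuous.comp hcf').mul
        ((EuclideanSpace.proj (𝕜 := ℝ) j).continuous.comp (H2.continuous_vel u))
    have hc2 : Continuous fun t => ψ (flow u (t, z)) j :=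
      (EuclideanSpace.proj (𝕜 := ℝ) j).continuous.comp
        (h.1.continuous.comp ((continuous_flow u).comp (Continuous.prodMk_left z)))
    obtain ⟨C, hC, hb⟩ := h.exists_bounds
    refine ((integrable_Ioo_of_continuous hc1).add ?_).const_mul _
    refine (integrable_coord hacc j).bdd_mul (c := C) hc2.aestronglyMeasurable
      (Eventually.of_forall fun t => ?_)
    exact (PiLp.norm_apply_le _ j).trans (hb _).1
  have hsum : ∀ t, inner ℝ (f' t) (lagVel u (t, z)) +
      inner ℝ (ψ (flow u (t, z))) (lagAcc u (t, z)) =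
      ∑ j, z j * (f' t j * H2.vel u t j + ψ (flow u (t, z)) j * H2.acc u t j) := by
    intro t
    rw [PiLp.inner_apply, PiLp.inner_apply, ← Finset.sum_add_distrib]
    refine Finset.sum_congr rfl fun j _ => ?_
    simp only [lagVel, lagAcc, scale_apply, RCLike.inner_apply, conj_trivial]
    ring
  refine (integral_congr_ae (Eventually.of_forall hsum)).trans ?_
  rw [integral_finsetSum _ fun j _ => hint j]
  refine Finset.sum_eq_zero fun j _ => ?_
  rw [integral_const_mul, hcoord, mul_zero]

/-- The Eulerian linear field `(t, x) ↦ diag(f_t / σ_t) x`. -/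
noncomputable def eulerField (u : H2 d) (f : ℝ → E d) (t : ℝ) (x : E d) : E d :=
  scale (WithLp.toLp 2 fun j => f t j / H2.rep u t j) x

theorem measurable_eulerField (u : H2 d) {f : ℝ → E d} (hf : Measurable f) :
    Measurable (Function.uncurry (eulerField u f)) := by
  have hr := (H2.continuous_rep u).measurable
  refine measurable_scale_comp (f := fun t => WithLp.toLp 2 fun j => f t j / H2.rep u t j) ?_
  refine (WithLp.measurable_toLp 2 _).comp (measurable_pi_lambda _ fun j => ?_)
  exact ((EuclideanSpace.proj (𝕜 := ℝ) j).continuous.measurable.comp hf).div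
    ((EuclideanSpace.proj (𝕜 := ℝ) j).continuous.measurable.comp hr)

/-- Where an entry of `σ_t` is nonzero the quotient cancels. Where it is zero, the flow vanishes in
that coordinate, and the hypothesis makes the right-hand side vanish too. -/
theorem eulerField_flow {f : ℝ → E d} {t : ℝ} (h : ∀ j, H2.rep u t j = 0 → f t j = 0) (z : E d) :
    Function.uncurry (eulerField u f) (flow u (t, z)) = scale (f t) z := by
  ext j
  simp only [Function.uncurry, eulerField, flow, scale_apply]
  by_cases h0 : H2.rep u t j = 0
  · rw [h j h0, h0]; simp
  · field_simp

theorem ae_eulerField_vel (hu : u ∈ H2Curves (nonnegDiag d)) :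
    ∀ᵐ p ∂(lagrange d), Function.uncurry (eulerField u (H2.vel u)) (flow u p) = lagVel u p := by
  have h : ∀ᵐ p ∂(lagrange d), p.1 ∈ Ioo (0 : ℝ) 1 :=
    Measure.quasiMeasurePreserving_fst.ae (ae_restrict_mem measurableSet_Ioo)
  filter_upwards [h] with p hp
  exact eulerField_flow (fun j hj => vel_eq_zero_of_rep_eq_zero hu hp hj) p.2

theorem ae_eulerField_acc (hu : u ∈ H2Curves (nonnegDiag d)) :
    ∀ᵐ p ∂(lagrange d), Function.uncurry (eulerField u (H2.acc u)) (flow u p) = lagAcc u p := by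
  have h := (Measure.quasiMeasurePreserving_fst (μ := volume.restrict (Ioo (0 : ℝ) 1))
    (ν := stdGaussian (E d))).ae (ae_acc_eq_zero_of_rep_eq_zero hu)
  filter_upwards [h] with p hp
  exact eulerField_flow hp p.2

theorem spaceTimeSq_eulerField_vel (hu : u ∈ H2Curves (nonnegDiag d)) :
    spaceTimeSq (fun t => diagGaussian (H2.fn u t)) (eulerField u (H2.vel u)) =
      ENNReal.ofReal (‖u.1 1‖ ^ 2) := by
  rw [spaceTimeSq_curve hu (measurable_eulerField u (H2.continuous_vel u).measurable),
    ← lintegral_lagVel]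
  exact lintegral_congr_ae ((ae_eulerField_vel hu).mono fun p hp => by simp only [hp])

theorem spaceTimeSq_eulerField_acc (hu : u ∈ H2Curves (nonnegDiag d)) :
    spaceTimeSq (fun t => diagGaussian (H2.fn u t)) (eulerField u (H2.acc u)) =
      ENNReal.ofReal (‖u.1 2‖ ^ 2) := by
  rw [spaceTimeSq_curve hu (measurable_eulerField u (H2.stronglyMeasurable_acc u).measurable),
    ← lintegral_lagAcc]
  exact lintegral_congr_ae ((ae_eulerField_acc hu).mono fun p hp => by simp only [hp])

theorem measurable_fderiv_test {F : Type*} [NormedAddCommGroup F] [NormedSpace ℝ F]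
    [MeasurableSpace F] [BorelSpace F] [SecondCountableTopology F]
    {φ : ℝ × E d → F} (h : IsSpaceTimeTest φ) {w : ℝ × E d → E d} (hw : Measurable w) :
    StronglyMeasurable fun q => fderiv ℝ φ q ((1 : ℝ), w q) := by
  have h1 : Continuous fun r : (ℝ × E d) × E d => fderiv ℝ φ r.1 ((1 : ℝ), r.2) :=
    ((h.1.continuous_fderiv (by simp)).comp continuous_fst).clm_apply
      (continuous_const.prodMk continuous_snd)
  exact (h1.measurable.comp (measurable_id.prodMk hw)).stronglyMeasurable

/-- The velocity test integral in Lagrangian coordinates. -/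
theorem velocity_test_eq (hu : u ∈ H2Curves (nonnegDiag d)) {v : ℝ → E d → E d}
    (hv : Measurable (Function.uncurry v))
    (hfin : spaceTimeSq (fun t => diagGaussian (H2.fn u t)) v < ⊤)
    {φ : ℝ × E d → ℝ} (h : IsSpaceTimeTest φ) :
    ∫ t in Ioo (0 : ℝ) 1, ∫ x, fderiv ℝ φ (t, x) ((1 : ℝ), v t x) ∂(diagGaussian (H2.fn u t)) =
      ∫ p, fderiv ℝ φ (flow u p) ((1 : ℝ), Function.uncurry v (flow u p)) ∂(lagrange d) :=
  integral_curve hu (F := fun q => fderiv ℝ φ q ((1 : ℝ), Function.uncurry v q))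
    (measurable_fderiv_test h hv).measurable
    ((memLp_fderiv_test h (memLp_curve hu hv hfin)).integrable (by norm_num))

/-- The acceleration test integral in Lagrangian coordinates. -/
theorem acceleration_test_eq (hu : u ∈ H2Curves (nonnegDiag d)) {v a : ℝ → E d → E d}
    (hv : Measurable (Function.uncurry v))
    (hfin : spaceTimeSq (fun t => diagGaussian (H2.fn u t)) v < ⊤)
    (ha : Measurable (Function.uncurry a))
    (hafin : spaceTimeSq (fun t => diagGaussian (H2.fn u t)) a < ⊤)
    {ψ : ℝ × E d → E d} (h : IsSpaceTimeTest ψ) :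
    ∫ t in Ioo (0 : ℝ) 1, ∫ x, (inner ℝ (fderiv ℝ ψ (t, x) ((1 : ℝ), v t x)) (v t x) +
        inner ℝ (ψ (t, x)) (a t x)) ∂(diagGaussian (H2.fn u t)) =
      ∫ p, (inner ℝ (fderiv ℝ ψ (flow u p) ((1 : ℝ), Function.uncurry v (flow u p)))
          (Function.uncurry v (flow u p)) +
        inner ℝ (ψ (flow u p)) (Function.uncurry a (flow u p))) ∂(lagrange d) :=
  integral_curve hu (F := fun q => inner ℝ (fderiv ℝ ψ q ((1 : ℝ), Function.uncurry v q))
      (Function.uncurry v q) + inner ℝ (ψ q) (Function.uncurry a q))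
    (((measurable_fderiv_test h hv).measurable.inner hv).add
      (h.1.continuous.measurable.inner ha))
    (integrable_acceleration_test h (memLp_curve hu hv hfin) (memLp_curve hu ha hafin))

theorem isVelocity_eulerField (hu : u ∈ H2Curves (nonnegDiag d)) :
    IsVelocity (fun t => diagGaussian (H2.fn u t)) (eulerField u (H2.vel u)) := by
  have hm := measurable_eulerField u (H2.continuous_vel u).measurable
  have hfin : spaceTimeSq (fun t => diagGaussian (H2.fn u t)) (eulerField u (H2.vel u)) < ⊤ := by
    rw [spaceTimeSq_eulerField_vel hu]; exact ENNReal.ofReal_lt_top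
  refine ⟨hm, hfin, fun φ h => ?_⟩
  rw [velocity_test_eq hu hm hfin h, ← integral_fderiv_test_lagVel h u]
  exact integral_congr_ae ((ae_eulerField_vel hu).mono fun p hp => by simp only [hp])

theorem isAcceleration_eulerField (hu : u ∈ H2Curves (nonnegDiag d)) :
    IsAcceleration (fun t => diagGaussian (H2.fn u t)) (eulerField u (H2.vel u))
      (eulerField u (H2.acc u)) := by
  have hm := measurable_eulerField u (H2.continuous_vel u).measurable
  have hfin : spaceTimeSq (fun t => diagGaussian (H2.fn u t)) (eulerField u (H2.vel u)) < ⊤ := by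
    rw [spaceTimeSq_eulerField_vel hu]; exact ENNReal.ofReal_lt_top
  have hma := measurable_eulerField u (H2.stronglyMeasurable_acc u).measurable
  have hafin : spaceTimeSq (fun t => diagGaussian (H2.fn u t)) (eulerField u (H2.acc u)) < ⊤ := by
    rw [spaceTimeSq_eulerField_acc hu]; exact ENNReal.ofReal_lt_top
  refine ⟨hma, hafin, fun ψ h => ?_⟩
  rw [acceleration_test_eq hu hm hfin hma hafin h, ← integral_acceleration_test_lag h u]
  refine integral_congr_ae ?_
  filter_upwards [ae_eulerField_vel hu, ae_eulerField_acc hu] with p h1 h2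
  simp only [h1, h2]

end TestEquations

/-! ### Tangent fields -/

section Tangent

variable {d : ℕ}

theorem eLpNorm_two_sq {α F : Type*} [MeasurableSpace α] [NormedAddCommGroup F]
    {μ : Measure α} (f : α → F) : eLpNorm f 2 μ ^ 2 = ∫⁻ x, ‖f x‖ₑ ^ 2 ∂μ := by
  rw [eLpNorm_eq_lintegral_rpow_enorm_toReal (by norm_num) (by norm_num)]
  simp only [ENNReal.toReal_ofNat, ENNReal.rpow_ofNat]
  rw [← ENNReal.rpow_natCast, ← ENNReal.rpow_mul]
  norm_num

theorem eLpNorm_two_le_of_lintegral_lt {α F : Type*} [MeasurableSpace α] [NormedAddCommGroup F]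
    {μ : Measure α} {f : α → F} {ε : ℝ≥0∞} (h : ∫⁻ x, ‖f x‖ₑ ^ 2 ∂μ < ε ^ 2) :
    eLpNorm f 2 μ ≤ ε := by
  rw [← eLpNorm_two_sq] at h
  exact (lt_of_pow_lt_pow_left' 2 h).le

theorem scale_comm (s z : E d) : scale s z = scale z s := by
  ext j; simp [mul_comm]

theorem hasFDerivAt_half_inner_scale (r x : E d) :
    HasFDerivAt (fun x => (1 / 2 : ℝ) * inner ℝ (scale r x) x)
      (InnerProductSpace.toDual ℝ (E d) (scale r x)) x := by
  have h1 : HasFDerivAt (fun x => scale r x) (scaleL r) x := by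
    have := (scaleL r).hasFDerivAt (x := x)
    refine this.congr_of_eventuallyEq (Eventually.of_forall fun y => ?_)
    rw [scaleL_apply, scale_comm]
  have h2 := (h1.inner ℝ (hasFDerivAt_id x)).const_mul (1 / 2 : ℝ)
  refine h2.congr_fderiv ?_
  ext h
  have e : inner ℝ (scaleL r h) x = inner ℝ (scale r x) h := by
    rw [PiLp.inner_apply, PiLp.inner_apply]
    refine Finset.sum_congr rfl fun j _ => ?_
    simp only [scaleL_apply, scale_apply, RCLike.inner_apply, conj_trivial]
    ring
  simp [fderivInnerCLM_apply, e]
  ring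

theorem continuous_gradient {φ : E d → ℝ} (h : ContDiff ℝ ∞ φ) : Continuous (gradient φ) :=
  (InnerProductSpace.toDual ℝ (E d)).symm.continuous.comp (h.continuous_fderiv (by simp))

theorem gradient_eq_zero_of_notMem_tsupport {φ : E d → ℝ} {x : E d} (hx : x ∉ tsupport φ) :
    gradient φ x = 0 := by
  have : fderiv ℝ φ x = 0 :=
    image_eq_zero_of_notMem_tsupport fun h => hx (tsupport_fderiv_subset ℝ h)
  rw [gradient, this, map_zero]

theorem exists_gradient_bound {φ : E d → ℝ} (h : ContDiff ℝ ∞ φ) (hc : HasCompactSupport φ) :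
    ∃ C, ∀ x, ‖gradient φ x‖ ≤ C := by
  obtain ⟨C, hC⟩ := (hc.fderiv ℝ).exists_bound_of_continuous (h.continuous_fderiv (by simp))
  exact ⟨C, fun x => by rw [gradient, LinearIsometryEquiv.norm_map]; exact hC x⟩

theorem memLp_gradient {φ : E d → ℝ} (h : ContDiff ℝ ∞ φ) (hc : HasCompactSupport φ)
    (μ : Measure (E d)) [IsFiniteMeasure μ] : MemLp (gradient φ) 2 μ := by
  obtain ⟨C, hC⟩ := exists_gradient_bound h hc
  exact MemLp.of_bound (continuous_gradient h).aestronglyMeasurable C (Eventually.of_forall hC)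

/-- A fixed smooth cut-off function. -/
noncomputable def cutoff (d : ℕ) : ContDiffBump (0 : E d) := ⟨1, 2, one_pos, one_lt_two⟩

/-- The rescaled cut-off functions. -/
noncomputable def cutoffSeq (d n : ℕ) (x : E d) : ℝ := cutoff d (((n : ℝ) + 1)⁻¹ • x)

theorem contDiff_cutoffSeq (n : ℕ) : ContDiff ℝ ∞ (cutoffSeq d n) :=
  (cutoff d).contDiff.comp (contDiff_const_smul _)

theorem hasCompactSupport_cutoffSeq (n : ℕ) : HasCompactSupport (cutoffSeq d n) :=
  (cutoff d).hasCompactSupport.comp_smul (by positivity)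

theorem cutoffSeq_mem (n : ℕ) (x : E d) : cutoffSeq d n x ∈ Icc (0 : ℝ) 1 :=
  ⟨(cutoff d).nonneg, (cutoff d).le_one⟩

theorem eventually_smul_mem_ball (x : E d) :
    ∀ᶠ n : ℕ in atTop, ((n : ℝ) + 1)⁻¹ • x ∈ Metric.ball (0 : E d) 1 := by
  have h1 : Tendsto (fun n : ℕ => ((n : ℝ) + 1)⁻¹ • x) atTop (𝓝 ((0 : ℝ) • x)) := by
    refine Tendsto.smul_const ?_ x
    simpa using tendsto_one_div_add_atTop_nhds_zero_nat (𝕜 := ℝ)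
  rw [zero_smul] at h1
  exact h1.eventually (Metric.ball_mem_nhds _ one_pos)

theorem eventually_cutoffSeq_eq_one (x : E d) : ∀ᶠ n in atTop, cutoffSeq d n x = 1 := by
  filter_upwards [eventually_smul_mem_ball x] with n hn
  exact (cutoff d).one_of_mem_closedBall (Metric.ball_subset_closedBall hn)

/-- In scaled form, the gradient of the `n`-th cut-off is at most `M / ‖x‖` uniformly in `n`, which
offsets the quadratic growth of the potential. -/
theorem exists_cutoff_bound (d : ℕ) : ∃ M, ∀ y : E d, ‖y‖ * ‖fderiv ℝ (cutoff d) y‖ ≤ M := by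
  have hcont : Continuous fun y : E d => ‖y‖ * ‖fderiv ℝ (cutoff d) y‖ :=
    continuous_norm.mul ((cutoff d).contDiff (n := 1)|>.continuous_fderiv (by simp)).norm
  have hc : HasCompactSupport fun y : E d => ‖y‖ * ‖fderiv ℝ (cutoff d) y‖ :=
    HasCompactSupport.mul_left ((cutoff d).hasCompactSupport.fderiv ℝ).norm
  obtain ⟨M, hM⟩ := hc.exists_bound_of_continuous hcont
  exact ⟨M, fun y => (le_abs_self _).trans (hM y)⟩

/-- A compactly supported potential of the linear field `scale r` near the origin. -/
noncomputable def quadCutoff (r : E d) (n : ℕ) (x : E d) : ℝ :=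
  cutoffSeq d n x * ((1 / 2 : ℝ) * inner ℝ (scale r x) x)

theorem contDiff_quadCutoff (r : E d) (n : ℕ) : ContDiff ℝ ∞ (quadCutoff r n) := by
  have h : ContDiff ℝ ∞ (fun x => scale r x) := by
    have e : (fun x => scale r x) = scaleL r := funext fun y => by rw [scaleL_apply, scale_comm]
    rw [e]
    exact (scaleL r).contDiff
  exact (contDiff_cutoffSeq n).mul (contDiff_const.mul (h.inner ℝ contDiff_id))

theorem hasCompactSupport_quadCutoff (r : E d) (n : ℕ) : HasCompactSupport (quadCutoff r n) :=
  (hasCompactSupport_cutoffSeq n).mul_right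

theorem hasFDerivAt_cutoffSeq (n : ℕ) (x : E d) : HasFDerivAt (cutoffSeq d n)
    (((n : ℝ) + 1)⁻¹ • fderiv ℝ (cutoff d) (((n : ℝ) + 1)⁻¹ • x)) x := by
  have ha := (((cutoff d).contDiff (n := 1)).differentiable (by simp)
    (((n : ℝ) + 1)⁻¹ • x)).hasFDerivAt
  have hb := ha.comp x ((hasFDerivAt_id x).const_smul ((n : ℝ) + 1)⁻¹)
  refine hb.congr_fderiv ?_
  ext h
  simp

theorem gradient_quadCutoff (r : E d) (n : ℕ) (x : E d) :
    gradient (quadCutoff r n) x = cutoffSeq d n x • scale r x +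
      (((1 / 2 : ℝ) * inner ℝ (scale r x) x) * ((n : ℝ) + 1)⁻¹) •
        (InnerProductSpace.toDual ℝ (E d)).symm
          (fderiv ℝ (cutoff d) (((n : ℝ) + 1)⁻¹ • x)) := by
  have h3 : fderiv ℝ (quadCutoff r n) x = _ :=
    ((hasFDerivAt_cutoffSeq n x).mul (hasFDerivAt_half_inner_scale r x)).fderiv
  rw [gradient, h3, map_add, LinearIsometryEquiv.map_smul, LinearIsometryEquiv.map_smul,
    LinearIsometryEquiv.map_smul, LinearIsometryEquiv.symm_apply_apply, smul_smul]

/-- The bound is linear in `x` and independent of `n`, so it dominates the error in `L²` of any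
measure with finite second moment. -/
theorem norm_scale_sub_gradient_quadCutoff_le {M : ℝ}
    (hM : ∀ y : E d, ‖y‖ * ‖fderiv ℝ (cutoff d) y‖ ≤ M) (r : E d) (n : ℕ) (x : E d) :
    ‖scale r x - gradient (quadCutoff r n) x‖ ≤ (‖r‖ * (1 + M)) * ‖x‖ := by
  rw [gradient_quadCutoff]
  set y := ((n : ℝ) + 1)⁻¹ • x with hy
  set q := (1 / 2 : ℝ) * inner ℝ (scale r x) x with hq
  have hn : (0 : ℝ) ≤ ((n : ℝ) + 1)⁻¹ := by positivity
  have hyn : ‖y‖ = ((n : ℝ) + 1)⁻¹ * ‖x‖ := by rw [hy, norm_smul, Real.norm_of_nonneg hn]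
  have hc := cutoffSeq_mem n x
  have h1 : ‖1 - cutoffSeq d n x‖ ≤ 1 := by
    rw [Real.norm_eq_abs, abs_le]; constructor <;> linarith [hc.1, hc.2]
  have hqb : ‖q‖ ≤ 1 / 2 * (‖r‖ * ‖x‖ * ‖x‖) := by
    have := (norm_inner_le_norm (𝕜 := ℝ) (scale r x) x).trans
      (mul_le_mul_of_nonneg_right (norm_scale_le r x) (norm_nonneg x))
    rw [hq, norm_mul, Real.norm_of_nonneg (by norm_num : (0 : ℝ) ≤ 1 / 2)]
    linarith
  have h2 : ‖1 - cutoffSeq d n x‖ * ‖scale r x‖ ≤ ‖r‖ * ‖x‖ :=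
    (mul_le_of_le_one_left (norm_nonneg _) h1).trans (norm_scale_le r x)
  have hMy := hM y
  have hM0 : 0 ≤ M := le_trans (by positivity) (hM 0)
  generalize hD : fderiv ℝ (cutoff d) y = D at hMy ⊢
  have h3 : ‖q‖ * ((n : ℝ) + 1)⁻¹ * ‖D‖ ≤ 1 / 2 * (‖r‖ * ‖x‖) * M := by
    calc ‖q‖ * ((n : ℝ) + 1)⁻¹ * ‖D‖
        ≤ 1 / 2 * (‖r‖ * ‖x‖ * ‖x‖) * ((n : ℝ) + 1)⁻¹ * ‖D‖ := by gcongr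
      _ = 1 / 2 * (‖r‖ * ‖x‖) * (‖y‖ * ‖D‖) := by rw [hyn]; ring
      _ ≤ 1 / 2 * (‖r‖ * ‖x‖) * M := by gcongr
  have e : scale r x - (cutoffSeq d n x • scale r x +
      (q * ((n : ℝ) + 1)⁻¹) • (InnerProductSpace.toDual ℝ (E d)).symm D) =
      (1 - cutoffSeq d n x) • scale r x -
        (q * ((n : ℝ) + 1)⁻¹) • (InnerProductSpace.toDual ℝ (E d)).symm D := by
    rw [sub_smul, one_smul, sub_sub]
  rw [e]
  refine (norm_sub_le _ _).trans ?_
  rw [norm_smul, norm_smul, LinearIsometryEquiv.norm_map, norm_mul, Real.norm_of_nonneg hn]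
  have h4 : 0 ≤ ‖r‖ * ‖x‖ * M := by positivity
  linarith

theorem eventually_gradient_quadCutoff (r x : E d) :
    ∀ᶠ n in atTop, gradient (quadCutoff r n) x = scale r x := by
  filter_upwards [eventually_cutoffSeq_eq_one x, eventually_smul_mem_ball x] with n h1 h2
  have h3 : fderiv ℝ (cutoff d) (((n : ℝ) + 1)⁻¹ • x) = 0 := by
    rw [((cutoff d).eventuallyEq_one_of_mem_ball h2).fderiv_eq]
    exact fderiv_const_apply (1 : ℝ)
  rw [gradient_quadCutoff, h1, h3, map_zero, smul_zero, one_smul, add_zero]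

/-- Linear fields with symmetric diagonal matrix are tangent at every measure of finite second
moment. -/
theorem isTangent_scale {μ : Measure (E d)} [IsFiniteMeasure μ] (hμ : ∫⁻ x, ‖x‖ₑ ^ 2 ∂μ < ⊤)
    (r : E d) : IsTangent μ (scale r) := by
  have hcr := continuous_scale_right r
  have hid : MemLp (fun x : E d => x) 2 μ :=
    memLp_two_of_lintegral continuous_id.aestronglyMeasurable hμ
  refine ⟨MemLp.mono' (hid.norm.const_mul ‖r‖) hcr.aestronglyMeasurable
    (Eventually.of_forall fun x => norm_scale_le r x), fun ε hε => ?_⟩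
  obtain ⟨M, hM⟩ := exists_cutoff_bound d
  have hlim : Tendsto (fun n => ∫⁻ x, ‖scale r x - gradient (quadCutoff r n) x‖ₑ ^ 2 ∂μ)
      atTop (𝓝 0) := by
    have hm : ∀ n, Measurable fun x => ‖scale r x - gradient (quadCutoff r n) x‖ₑ ^ 2 := fun n =>
      ((hcr.sub (continuous_gradient (contDiff_quadCutoff r n))).measurable.enorm).pow_const 2
    have hbd : ∫⁻ x, ‖(‖r‖ * (1 + M)) • x‖ₑ ^ 2 ∂μ ≠ ⊤ :=
      (lintegral_lt_top_of_memLp_two (f := fun x : E d => (‖r‖ * (1 + M)) • x)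
        (hid.const_smul (‖r‖ * (1 + M)))).ne
    have := tendsto_lintegral_of_dominated_convergence (μ := μ)
      (F := fun n x => ‖scale r x - gradient (quadCutoff r n) x‖ₑ ^ 2) (f := fun _ => 0)
      (fun x => ‖(‖r‖ * (1 + M)) • x‖ₑ ^ 2) hm (fun n => Eventually.of_forall fun x => ?_) hbd
      (Eventually.of_forall fun x => ?_)
    · simpa using this
    · dsimp only
      gcongr
      rw [enorm_le_iff_norm_le, norm_smul]
      exact (norm_scale_sub_gradient_quadCutoff_le hM r n x).trans
        (mul_le_mul_of_nonneg_right (le_abs_self _) (norm_nonneg _))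
    · refine tendsto_const_nhds.congr' ?_
      filter_upwards [eventually_gradient_quadCutoff r x] with n h1
      rw [h1, sub_self]
      simp
  have hε2 : (0 : ℝ≥0∞) < ε ^ 2 := ENNReal.pow_pos hε 2
  obtain ⟨n, hn⟩ := (hlim.eventually (gt_mem_nhds hε2)).exists
  exact ⟨quadCutoff r n, contDiff_quadCutoff r n, hasCompactSupport_quadCutoff r n,
    eLpNorm_two_le_of_lintegral_lt hn⟩

theorem IsTangent.sub {μ : Measure (E d)} [IsFiniteMeasure μ] {v w : E d → E d}
    (hv : IsTangent μ v) (hw : IsTangent μ w) : IsTangent μ (fun x => v x - w x) := by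
  refine ⟨hv.1.sub hw.1, fun ε hε => ?_⟩
  obtain ⟨φ, h1, h2, h3⟩ := hv.2 (ε / 2) (ENNReal.half_pos hε.ne')
  obtain ⟨χ, k1, k2, k3⟩ := hw.2 (ε / 2) (ENNReal.half_pos hε.ne')
  refine ⟨fun x => φ x - χ x, h1.sub k1, h2.sub k2, ?_⟩
  have e : (fun x => v x - w x - gradient (fun x => φ x - χ x) x) =
      (fun x => v x - gradient φ x) - fun x => w x - gradient χ x := by
    ext1 x
    have : gradient (fun x => φ x - χ x) x = gradient φ x - gradient χ x := by
      rw [gradient, gradient, gradient, ← map_sub]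
      congr 1
      exact fderiv_fun_sub (h1.differentiable (by simp) x) (k1.differentiable (by simp) x)
    rw [this, Pi.sub_apply]; abel
  rw [e]
  refine (eLpNorm_sub_le (hv.1.1.sub (memLp_gradient h1 h2 μ).1)
    (hw.1.1.sub (memLp_gradient k1 k2 μ).1) (by norm_num)).trans ?_
  exact (add_le_add h3 k3).trans (ENNReal.add_halves ε).le

/-- A tangent field that is orthogonal to all gradients vanishes. -/
theorem IsTangent.lintegral_eq_zero {μ : Measure (E d)} [IsFiniteMeasure μ] {X : E d → E d}
    (hX : IsTangent μ X) (h : ∀ φ : E d → ℝ, ContDiff ℝ ∞ φ → HasCompactSupport φ →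
      ∫ x, inner ℝ (gradient φ x) (X x) ∂μ = 0) : ∫⁻ x, ‖X x‖ₑ ^ 2 ∂μ = 0 := by
  set X' := hX.1.toLp X with hX'
  have hle : ∀ ε : ℝ, 0 < ε → ‖X'‖ ≤ ε := by
    intro ε hε
    obtain ⟨φ, h1, h2, h3⟩ := hX.2 (ENNReal.ofReal ε) (ENNReal.ofReal_pos.2 hε)
    have hG := memLp_gradient h1 h2 μ
    have horth : inner ℝ (hG.toLp _) X' = 0 := by
      rw [L2.inner_def, ← h φ h1 h2]
      refine integral_congr_ae ?_
      filter_upwards [hG.coeFn_toLp, hX.1.coeFn_toLp] with x e1 e2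
      rw [e1, e2]
    have hd : ‖X' - hG.toLp _‖ ≤ ε := by
      rw [hX', ← MemLp.toLp_sub, Lp.norm_toLp]
      exact ENNReal.toReal_le_of_le_ofReal hε.le h3
    -- Orthogonality lets an approximating gradient be subtracted for free, so `‖X'‖ ^ 2 ≤ ε *
    -- ‖X'‖`.
    have hsq : ‖X'‖ ^ 2 = inner ℝ (X' - hG.toLp _) X' := by
      rw [inner_sub_left, horth, sub_zero, real_inner_self_eq_norm_sq]
    have hcs := real_inner_le_norm (X' - hG.toLp _) X'
    rw [← hsq] at hcs
    by_contra hlt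
    push Not at hlt
    nlinarith [norm_nonneg X']
  have h0 : ‖X'‖ = 0 :=
    le_antisymm (le_of_forall_pos_le_add fun ε hε => by simpa using hle ε hε) (norm_nonneg _)
  rw [hX', Lp.norm_toLp, ENNReal.toReal_eq_zero_iff] at h0
  rw [← eLpNorm_two_sq, h0.resolve_right hX.1.2.ne]
  norm_num

/-- Gradients of test functions can be approximated uniformly by those of a countable family. -/
theorem exists_countable_test_family (d : ℕ) : ∃ D : Set (E d → ℝ), D.Countable ∧
    (∀ φ ∈ D, ContDiff ℝ ∞ φ ∧ HasCompactSupport φ) ∧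
    ∀ φ : E d → ℝ, ContDiff ℝ ∞ φ → HasCompactSupport φ → ∀ ε : ℝ, 0 < ε →
      ∃ χ ∈ D, ∀ x, ‖gradient φ x - gradient χ x‖ ≤ ε := by
  let S : ℕ → Set (E d → ℝ) := fun N =>
    {φ | ContDiff ℝ ∞ φ ∧ tsupport φ ⊆ Metric.closedBall 0 N}
  let G : ∀ N : ℕ, S N → C(Metric.closedBall (0 : E d) N, E d) := fun N φ =>
    ⟨fun x => gradient φ.1 x, (continuous_gradient φ.2.1).comp continuous_subtype_val⟩
  have hcount : ∀ N, ∃ D : Set (S N), D.Countable ∧ ∀ φ : S N, ∀ ε : ℝ, 0 < ε →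
      ∃ χ ∈ D, dist (G N φ) (G N χ) < ε := by
    intro N
    -- Density is taken inside the range of the gradient map, a subset of a separable space of
    -- continuous functions, so the approximants are themselves gradients of test functions.
    obtain ⟨s, hsc, hsd⟩ := TopologicalSpace.exists_countable_dense (range (G N))
    choose f hf using fun y : range (G N) => y.2
    refine ⟨f '' s, hsc.image f, fun φ ε hε => ?_⟩
    obtain ⟨y, hy, hdist⟩ := hsd.exists_dist_lt ⟨G N φ, φ, rfl⟩ hε
    refine ⟨f y, mem_image_of_mem f hy, ?_⟩
    rw [hf y]
    exact hdist
  choose D hDc hD using hcount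
  refine ⟨⋃ N, Subtype.val '' D N, countable_iUnion fun N => (hDc N).image _, ?_, ?_⟩
  · intro φ hφ
    obtain ⟨N, χ, -, rfl⟩ := mem_iUnion.1 hφ
    exact ⟨χ.2.1, (isCompact_closedBall (0 : E d) N).of_isClosed_subset (isClosed_tsupport _) χ.2.2⟩
  · intro φ h1 h2 ε hε
    obtain ⟨R, hR⟩ := (IsCompact.isBounded h2).subset_closedBall (0 : E d)
    obtain ⟨N, hN⟩ := exists_nat_ge R
    have hφ : φ ∈ S N := ⟨h1, hR.trans (Metric.closedBall_subset_closedBall hN)⟩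
    obtain ⟨χ, hχ, hdist⟩ := hD N ⟨φ, hφ⟩ ε hε
    refine ⟨χ, mem_iUnion.2 ⟨N, χ, hχ, rfl⟩, fun x => ?_⟩
    by_cases hx : x ∈ Metric.closedBall (0 : E d) N
    · rw [← dist_eq_norm]
      exact (ContinuousMap.dist_apply_le_dist (f := G N ⟨φ, hφ⟩) (g := G N χ)
        ⟨x, hx⟩).trans hdist.le
    · rw [gradient_eq_zero_of_notMem_tsupport fun h => hx (hφ.2 h),
        gradient_eq_zero_of_notMem_tsupport fun h => hx (χ.2.2 h)]
      simpa using hε.le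

end Tangent

/-! ### The energy of a Gaussian curve -/

section EnergyFormula

variable {d : ℕ} {u : H2 d}

theorem ae_eq_zero_of_integral_test_mul_eq_zero {h : ℝ → ℝ}
    (hh : Integrable h (volume.restrict (Ioo (0 : ℝ) 1)))
    (H : ∀ η : ℝ → ℝ, ContDiff ℝ ∞ η → HasCompactSupport η → tsupport η ⊆ Ioo (0 : ℝ) 1 →
      ∫ t in Ioo (0 : ℝ) 1, η t * h t = 0) :
    ∀ᵐ t ∂(volume.restrict (Ioo (0 : ℝ) 1)), h t = 0 := by
  have key := isOpen_Ioo.ae_eq_zero_of_integral_contDiff_smul_eq_zero (μ := (volume : Measure ℝ))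
    (U := Ioo (0 : ℝ) 1) (f := h) (IntegrableOn.locallyIntegrableOn hh) fun η h1 h2 h3 => by
      rw [← setIntegral_eq_integral_of_forall_compl_eq_zero (s := Ioo (0 : ℝ) 1)]
      · simpa using H η h1 h2 h3
      · intro t ht
        rw [eq_zero_of_tsupport_subset_Ioo h3 ht, zero_smul]
  rw [ae_restrict_iff' measurableSet_Ioo]
  exact key

theorem isSpaceTimeTest_smul {F : Type*} [NormedAddCommGroup F] [NormedSpace ℝ F] {η : ℝ → ℝ}
    (h1 : ContDiff ℝ ∞ η) (h2 : HasCompactSupport η) (h3 : tsupport η ⊆ Ioo (0 : ℝ) 1)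
    {Ψ : E d → F} (k1 : ContDiff ℝ ∞ Ψ) (k2 : HasCompactSupport Ψ) :
    IsSpaceTimeTest fun p : ℝ × E d => η p.1 • Ψ p.2 := by
  have hsub : tsupport (fun p : ℝ × E d => η p.1 • Ψ p.2) ⊆ tsupport η ×ˢ tsupport Ψ := by
    refine closure_minimal (fun p hp => ?_) ((isClosed_tsupport η).prod (isClosed_tsupport Ψ))
    rw [Function.mem_support] at hp
    exact ⟨subset_tsupport _ fun h => hp (by rw [h, zero_smul]),
      subset_tsupport _ fun h => hp (by rw [h, smul_zero])⟩
  exact ⟨(h1.comp contDiff_fst).smul (k1.comp contDiff_snd),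
    (h2.prod k2).of_isClosed_subset (isClosed_tsupport _) hsub,
    hsub.trans (prod_mono h3 (subset_univ _))⟩

/-- The time component is zero because this is applied to the difference of two directions `(1, v)`
and `(1, w)`. -/
theorem fderiv_mul_test {η : ℝ → ℝ} (h1 : ContDiff ℝ ∞ η) {φ : E d → ℝ} (k1 : ContDiff ℝ ∞ φ)
    (q : ℝ × E d) (w : E d) :
    fderiv ℝ (fun p : ℝ × E d => η p.1 • φ p.2) q ((0 : ℝ), w) =
      η q.1 * inner ℝ (gradient φ q.2) w := by
  have a1 := ((h1.differentiable (by simp)) q.1).hasFDerivAt.comp q hasFDerivAt_fst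
  have a2 := ((k1.differentiable (by simp)) q.2).hasFDerivAt.comp q hasFDerivAt_snd
  have a3 := (a1.smul a2).fderiv
  have e : inner ℝ (gradient φ q.2) w = fderiv ℝ φ q.2 w := by
    rw [gradient, InnerProductSpace.toDual_symm_apply]
  rw [e]
  refine (congrArg (fun L : ℝ × E d →L[ℝ] ℝ => L ((0 : ℝ), w)) a3).trans ?_
  simp

theorem lintegral_sq_diagGaussian_lt_top {s : E d} (hs : s ∈ nonnegDiag d) :
    ∫⁻ x, ‖x‖ₑ ^ 2 ∂(diagGaussian s) < ⊤ := by
  rw [diagGaussian_eq_map hs, lintegral_map (by fun_prop) (continuous_scale_right _).measurable,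
    lintegral_scale_sq]
  exact ENNReal.ofReal_lt_top

theorem ae_memLp_curve (hu : u ∈ H2Curves (nonnegDiag d)) {X : ℝ → E d → E d}
    (hX : Measurable (Function.uncurry X))
    (hfin : spaceTimeSq (fun t => diagGaussian (H2.fn u t)) X < ⊤) :
    ∀ᵐ t ∂(volume.restrict (Ioo (0 : ℝ) 1)), MemLp (X t) 2 (diagGaussian (H2.fn u t)) := by
  have hm : AEMeasurable (fun t => ∫⁻ x, ‖X t x‖ₑ ^ 2 ∂(diagGaussian (H2.fn u t)))
      (volume.restrict (Ioo (0 : ℝ) 1)) := by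
    have h1 : Measurable fun p : ℝ × E d => ‖Function.uncurry X (flow u p)‖ₑ ^ 2 :=
      (hX.comp (continuous_flow u).measurable).enorm.pow_const 2
    refine ⟨_, h1.lintegral_prod_right' (ν := stdGaussian (E d)), ?_⟩
    filter_upwards [ae_diagGaussian_eq hu] with t ht
    have hm' : Measurable fun x => ‖X t x‖ₑ ^ 2 :=
      (hX.comp measurable_prodMk_left).enorm.pow_const 2
    rw [ht, lintegral_map hm' (continuous_scale_right _).measurable]
    rfl
  filter_upwards [ae_lt_top' hm hfin.ne] with t ht
  exact memLp_two_of_lintegral (hX.comp measurable_prodMk_left).aestronglyMeasurable ht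

/-- Localization in time of a weak orthogonality relation. -/
theorem ae_integral_inner_eq_zero (hu : u ∈ H2Curves (nonnegDiag d)) {X : ℝ → E d → E d}
    (hX : Measurable (Function.uncurry X))
    (hfin : spaceTimeSq (fun t => diagGaussian (H2.fn u t)) X < ⊤)
    {Ψ : E d → E d} (hΨ : Continuous Ψ) {C : ℝ} (hC : ∀ x, ‖Ψ x‖ ≤ C)
    (H : ∀ η : ℝ → ℝ, ContDiff ℝ ∞ η → HasCompactSupport η → tsupport η ⊆ Ioo (0 : ℝ) 1 →
      ∫ p, η p.1 * inner ℝ (Ψ (flow u p).2) (Function.uncurry X (flow u p)) ∂(lagrange d) = 0) :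
    ∀ᵐ t ∂(volume.restrict (Ioo (0 : ℝ) 1)),
      ∫ x, inner ℝ (Ψ x) (X t x) ∂(diagGaussian (H2.fn u t)) = 0 := by
  have hX2 := memLp_curve hu hX hfin
  have hΨ2 : MemLp (fun p => Ψ (flow u p).2) 2 (lagrange d) :=
    MemLp.of_bound (hΨ.comp (continuous_snd.comp (continuous_flow u))).aestronglyMeasurable C
      (Eventually.of_forall fun p => hC _)
  have hi := integrable_inner_of_memLp hΨ2 hX2
  have h0 := ae_eq_zero_of_integral_test_mul_eq_zero hi.integral_prod_left fun η h1 h2 h3 => by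
    obtain ⟨M, hM⟩ := h2.exists_bound_of_continuous h1.continuous
    have hi' : Integrable (fun p : ℝ × E d =>
        η p.1 * inner ℝ (Ψ (flow u p).2) (Function.uncurry X (flow u p))) (lagrange d) :=
      hi.bdd_mul (c := M) (h1.continuous.comp continuous_fst).aestronglyMeasurable
        (Eventually.of_forall fun p => hM _)
    refine Eq.trans ?_ (H η h1 h2 h3)
    rw [integral_prod _ hi']
    simp only [integral_const_mul]
  filter_upwards [h0, ae_diagGaussian_eq hu] with t ht hd
  have hm : Measurable fun x => inner ℝ (Ψ x) (X t x) :=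
    hΨ.measurable.inner (hX.comp measurable_prodMk_left)
  rw [hd, integral_map (continuous_scale_right _).measurable.aemeasurable hm.aestronglyMeasurable]
  exact ht

theorem isTangent_eulerField {t : ℝ} (f : ℝ → E d) (h : H2.fn u t ∈ nonnegDiag d) :
    IsTangent (diagGaussian (H2.fn u t)) (eulerField u f t) :=
  isTangent_scale (lintegral_sq_diagGaussian_lt_top h) _

theorem ae_fn_mem (hu : u ∈ H2Curves (nonnegDiag d)) :
    ∀ᵐ t ∂(volume.restrict (Ioo (0 : ℝ) 1)), H2.fn u t ∈ nonnegDiag d := by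
  filter_upwards [H2.rep_ae u, ae_restrict_mem measurableSet_Ioo] with t h1 h2
  rw [show H2.fn u t = H2.rep u t from h1]
  exact mem_H2Curves_iff.1 hu t (Ioo_subset_Icc_self h2)

theorem isTangentVelocity_eulerField (hu : u ∈ H2Curves (nonnegDiag d)) :
    IsTangentVelocity (fun t => diagGaussian (H2.fn u t)) (eulerField u (H2.vel u)) :=
  ⟨isVelocity_eulerField hu, (ae_fn_mem hu).mono fun _ h => isTangent_eulerField _ h⟩

theorem spaceTimeSq_sub_lt_top (hu : u ∈ H2Curves (nonnegDiag d)) {v w : ℝ → E d → E d}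
    (hv : Measurable (Function.uncurry v)) (hw : Measurable (Function.uncurry w))
    (hvf : spaceTimeSq (fun t => diagGaussian (H2.fn u t)) v < ⊤)
    (hwf : spaceTimeSq (fun t => diagGaussian (H2.fn u t)) w < ⊤) :
    spaceTimeSq (fun t => diagGaussian (H2.fn u t)) (fun t x => v t x - w t x) < ⊤ := by
  have hm : Measurable (Function.uncurry fun t x => v t x - w t x) := hv.sub hw
  rw [spaceTimeSq_curve hu hm]
  exact lintegral_lt_top_of_memLp_two ((memLp_curve hu hv hvf).sub (memLp_curve hu hw hwf))

/-- Orthogonality to the gradients of a sufficiently rich family implies orthogonality to all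
gradients. -/
theorem integral_inner_gradient_eq_zero {μ : Measure (E d)} [IsFiniteMeasure μ] {X : E d → E d}
    (hX : MemLp X 2 μ) {D : Set (E d → ℝ)} (hD : ∀ φ ∈ D, ContDiff ℝ ∞ φ ∧ HasCompactSupport φ)
    (h : ∀ φ ∈ D, ∫ x, inner ℝ (gradient φ x) (X x) ∂μ = 0) {φ : E d → ℝ} (h1 : ContDiff ℝ ∞ φ)
    (h2 : HasCompactSupport φ)
    (happ : ∀ ε : ℝ, 0 < ε → ∃ χ ∈ D, ∀ x, ‖gradient φ x - gradient χ x‖ ≤ ε) :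
    ∫ x, inner ℝ (gradient φ x) (X x) ∂μ = 0 := by
  have hXi : Integrable (fun x => ‖X x‖) μ := (hX.integrable (by norm_num)).norm
  have hle : ∀ ε : ℝ, 0 < ε → ‖∫ x, inner ℝ (gradient φ x) (X x) ∂μ‖ ≤ ε * ∫ x, ‖X x‖ ∂μ := by
    intro ε hε
    obtain ⟨χ, hχ, hb⟩ := happ ε hε
    have e : ∫ x, inner ℝ (gradient φ x) (X x) ∂μ =
        ∫ x, inner ℝ (gradient φ x - gradient χ x) (X x) ∂μ := by
      simp only [inner_sub_left]
      rw [integral_sub (integrable_inner_of_memLp (memLp_gradient h1 h2 μ) hX)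
        (integrable_inner_of_memLp (memLp_gradient (hD χ hχ).1 (hD χ hχ).2 μ) hX), h χ hχ, sub_zero]
    rw [e, ← integral_const_mul]
    refine norm_integral_le_of_norm_le (hXi.const_mul ε) (Eventually.of_forall fun x => ?_)
    exact (norm_inner_le_norm _ _).trans (mul_le_mul_of_nonneg_right (hb x) (norm_nonneg _))
  set m := ∫ x, ‖X x‖ ∂μ
  have hm : 0 ≤ m := integral_nonneg fun x => norm_nonneg _
  have h0 : ‖∫ x, inner ℝ (gradient φ x) (X x) ∂μ‖ ≤ 0 := by
    refine le_of_forall_pos_le_add fun ε hε => ?_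
    have hp : 0 < m + 1 := by linarith
    refine (hle (ε / (m + 1)) (by positivity)).trans ?_
    rw [zero_add, div_mul_eq_mul_div, div_le_iff₀ hp]
    nlinarith
  exact norm_le_zero_iff.1 h0

/-- The tangent velocity field of a Gaussian curve is unique. -/
theorem IsTangentVelocity.ae_eq_lagVel (hu : u ∈ H2Curves (nonnegDiag d)) {v : ℝ → E d → E d}
    (hv : IsTangentVelocity (fun t => diagGaussian (H2.fn u t)) v) :
    ∀ᵐ p ∂(lagrange d), Function.uncurry v (flow u p) = lagVel u p := by
  have hw := isVelocity_eulerField hu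
  set w := eulerField u (H2.vel u) with hwdef
  set X : ℝ → E d → E d := fun t x => v t x - w t x with hXdef
  have hXm : Measurable (Function.uncurry X) := hv.1.1.sub hw.1
  have hXf := spaceTimeSq_sub_lt_top hu hv.1.1 hw.1 hv.1.2.1 hw.2.1
  -- Each test gradient has its own null set of exceptional times; a countable family leaves one
  -- common null set.
  obtain ⟨D, hDc, hD, happ⟩ := exists_countable_test_family d
  have hall : ∀ᵐ t ∂(volume.restrict (Ioo (0 : ℝ) 1)), ∀ φ ∈ D,
      ∫ x, inner ℝ (gradient φ x) (X t x) ∂(diagGaussian (H2.fn u t)) = 0 := by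
    rw [ae_ball_iff hDc]
    intro φ hφ
    obtain ⟨k1, k2⟩ := hD φ hφ
    obtain ⟨C, hC⟩ := exists_gradient_bound k1 k2
    refine ae_integral_inner_eq_zero hu hXm hXf (continuous_gradient k1) hC fun η h1 h2 h3 => ?_
    have htest := isSpaceTimeTest_smul h1 h2 h3 k1 k2
    have e1 := hv.1.2.2 _ htest
    have e2 := hw.2.2 _ htest
    rw [velocity_test_eq hu hv.1.1 hv.1.2.1 htest] at e1
    rw [velocity_test_eq hu hw.1 hw.2.1 htest] at e2
    have i1 := (memLp_fderiv_test (u := u) htest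
      (memLp_curve hu hv.1.1 hv.1.2.1)).integrable (by norm_num)
    have i2 := (memLp_fderiv_test (u := u) htest
      (memLp_curve hu hw.1 hw.2.1)).integrable (by norm_num)
    rw [← sub_self (0 : ℝ)]
    nth_rewrite 1 [← e1]
    rw [← e2, ← integral_sub i1 i2]
    refine integral_congr_ae (Eventually.of_forall fun p => ?_)
    dsimp only
    rw [← map_sub, Prod.mk_sub_mk, sub_self, fderiv_mul_test h1 k1]
    rfl
  have hzero : spaceTimeSq (fun t => diagGaussian (H2.fn u t)) X = 0 := by
    rw [spaceTimeSq, ← lintegral_zero (μ := volume.restrict (Ioo (0 : ℝ) 1))]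
    refine lintegral_congr_ae ?_
    filter_upwards [hall, hv.2, ae_fn_mem hu, ae_memLp_curve hu hXm hXf] with t g1 g2 g3 g4
    refine IsTangent.lintegral_eq_zero (g2.sub (isTangent_eulerField _ g3)) fun φ k1 k2 => ?_
    exact integral_inner_gradient_eq_zero g4 hD g1 k1 k2 (happ φ k1 k2)
  have hm : Measurable fun p => ‖Function.uncurry X (flow u p)‖ₑ ^ 2 :=
    (hXm.comp (continuous_flow u).measurable).enorm.pow_const 2
  rw [spaceTimeSq_curve hu hXm, lintegral_eq_zero_iff hm] at hzero
  filter_upwards [hzero, ae_eulerField_vel hu] with p h1 h2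
  rw [← h2, ← sub_eq_zero]
  have h3 : Function.uncurry X (flow u p) = 0 := by simpa using h1
  exact h3

theorem IsTangentVelocity.spaceTimeSq_eq (hu : u ∈ H2Curves (nonnegDiag d)) {v : ℝ → E d → E d}
    (hv : IsTangentVelocity (fun t => diagGaussian (H2.fn u t)) v) :
    spaceTimeSq (fun t => diagGaussian (H2.fn u t)) v = ENNReal.ofReal (‖u.1 1‖ ^ 2) := by
  rw [spaceTimeSq_curve hu hv.1.1, ← lintegral_lagVel]
  exact lintegral_congr_ae ((hv.ae_eq_lagVel hu).mono fun p hp => by simp only [hp])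

theorem pathEnergy_eq (hu : u ∈ H2Curves (nonnegDiag d)) :
    pathEnergy (fun t => diagGaussian (H2.fn u t)) = ENNReal.ofReal (‖u.1 1‖ ^ 2) := by
  refine le_antisymm ?_ (le_iInf₂ fun v hv => (hv.spaceTimeSq_eq hu).ge)
  exact (iInf₂_le _ (isTangentVelocity_eulerField hu)).trans (spaceTimeSq_eulerField_vel hu).le

/-- If the coordinate moments of `X` vanish, adding a linear field increases the energy. -/
theorem lintegral_scale_le_of_moments {μ : Measure (E d)} {X : E d → E d}
    (hX : MemLp X 2 μ) (hid : MemLp (fun x : E d => x) 2 μ) (r : E d)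
    (h : ∀ j, ∫ x, x j * X x j ∂μ = 0) :
    ∫⁻ x, ‖scale r x‖ₑ ^ 2 ∂μ ≤ ∫⁻ x, ‖X x + scale r x‖ₑ ^ 2 ∂μ := by
  have hr : MemLp (scale r) 2 μ :=
    MemLp.mono' (hid.norm.const_mul ‖r‖)
      ((continuous_scale_right r).comp_aestronglyMeasurable hid.1)
      (Eventually.of_forall fun x => norm_scale_le r x)
  have hco : ∀ {f : E d → E d}, MemLp f 2 μ → ∀ j, MemLp (fun x => f x j) 2 μ := fun hf j =>
    (EuclideanSpace.proj (𝕜 := ℝ) j).comp_memLp' hf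
  have horth : ∫ x, inner ℝ (scale r x) (X x) ∂μ = 0 := by
    have e : ∀ x, inner ℝ (scale r x) (X x) = ∑ j, r j * (x j * X x j) := fun x => by
      rw [PiLp.inner_apply]
      refine Finset.sum_congr rfl fun j _ => ?_
      simp only [scale_apply, RCLike.inner_apply, conj_trivial]; ring
    have hi : ∀ j, Integrable (fun x => r j * (x j * X x j)) μ := fun j =>
      ((hco hid j).integrable_mul (hco hX j)).const_mul (r j)
    simp only [e]
    rw [integral_finsetSum _ fun j _ => hi j]
    exact Finset.sum_eq_zero fun j _ => by rw [integral_const_mul, h j, mul_zero]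
  have hsq : ∀ {f : E d → E d}, MemLp f 2 μ →
      ∫⁻ x, ‖f x‖ₑ ^ 2 ∂μ = ENNReal.ofReal (∫ x, ‖f x‖ ^ 2 ∂μ) := fun {f} hf => by
    rw [ofReal_integral_eq_lintegral_ofReal (hf.integrable_norm_pow (by norm_num))
      (Eventually.of_forall fun _ => sq_nonneg _)]
    refine lintegral_congr fun t => ?_
    rw [ENNReal.ofReal_pow (norm_nonneg _), ofReal_norm]
  rw [hsq hr]
  refine le_of_le_of_eq ?_ (hsq (hX.add hr)).symm
  refine ENNReal.ofReal_le_ofReal ?_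
  have i1 : Integrable (fun x => ‖scale r x‖ ^ 2) μ := hr.integrable_norm_pow (by norm_num)
  have i2 := integrable_inner_of_memLp hr hX
  calc ∫ x, ‖scale r x‖ ^ 2 ∂μ
      = ∫ x, (‖scale r x‖ ^ 2 + 2 * inner ℝ (scale r x) (X x)) ∂μ := by
        rw [integral_add i1 (i2.const_mul 2), integral_const_mul, horth]; simp
    _ ≤ ∫ x, ‖(X + scale r) x‖ ^ 2 ∂μ := by
        refine integral_mono (i1.add (i2.const_mul 2))
          ((hX.add hr).integrable_norm_pow (by norm_num)) fun x => ?_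
        dsimp only
        rw [Pi.add_apply, add_comm (X x), norm_add_sq_real]
        linarith [sq_nonneg ‖X x‖]

/-- The truncated coordinate fields. -/
noncomputable def coordField (n : ℕ) (j : Fin d) (x : E d) : E d :=
  (cutoffSeq d n x * x j) • EuclideanSpace.single j (1 : ℝ)

theorem contDiff_coordField (n : ℕ) (j : Fin d) : ContDiff ℝ ∞ (coordField n j) :=
  ((contDiff_cutoffSeq n).mul (EuclideanSpace.proj (𝕜 := ℝ) j).contDiff).smul contDiff_const

theorem hasCompactSupport_coordField (n : ℕ) (j : Fin d) : HasCompactSupport (coordField n j) :=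
  ((hasCompactSupport_cutoffSeq n).mul_right (f' := fun x : E d => x j)).smul_right

theorem inner_coordField (n : ℕ) (j : Fin d) (x y : E d) :
    inner ℝ (coordField n j x) y = cutoffSeq d n x * (x j * y j) := by
  rw [coordField, real_inner_smul_left, EuclideanSpace.inner_single_left]
  simp; ring

/-- The coordinate field is not compactly supported. Dominated convergence removes the cut-off, with
dominating function `|x j * X x j|`. -/
theorem integral_coord_mul_eq_zero {μ : Measure (E d)} {X : E d → E d} (hX : MemLp X 2 μ)
    (hid : MemLp (fun x : E d => x) 2 μ) {j : Fin d}
    (h : ∀ n, ∫ x, inner ℝ (coordField n j x) (X x) ∂μ = 0) : ∫ x, x j * X x j ∂μ = 0 := by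
  have hco : ∀ {f : E d → E d}, MemLp f 2 μ → MemLp (fun x => f x j) 2 μ := fun hf =>
    (EuclideanSpace.proj (𝕜 := ℝ) j).comp_memLp' hf
  have hi := (hco hid).integrable_mul (hco hX)
  have hlim : Tendsto (fun n => ∫ x, inner ℝ (coordField n j x) (X x) ∂μ) atTop
      (𝓝 (∫ x, x j * X x j ∂μ)) := by
    refine tendsto_integral_of_dominated_convergence (fun x => ‖x j * X x j‖) (fun n => ?_) hi.norm
      (fun n => Eventually.of_forall fun x => ?_) (Eventually.of_forall fun x => ?_)
    · simp only [inner_coordField]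
      exact ((contDiff_cutoffSeq n).continuous.comp_aestronglyMeasurable hid.1).mul hi.1
    · rw [inner_coordField, norm_mul]
      refine mul_le_of_le_one_left (norm_nonneg _) ?_
      have := cutoffSeq_mem n x
      rw [Real.norm_of_nonneg this.1]
      exact this.2
    · refine tendsto_const_nhds.congr' ?_
      filter_upwards [eventually_cutoffSeq_eq_one x] with n hn
      rw [inner_coordField, hn, one_mul]
  simp only [h] at hlim
  exact tendsto_nhds_unique hlim tendsto_const_nhds |>.symm ▸ rfl

/-- The linear acceleration field has the least energy. -/
theorem IsAcceleration.le_spaceTimeSq (hu : u ∈ H2Curves (nonnegDiag d)) {v a : ℝ → E d → E d}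
    (hv : IsTangentVelocity (fun t => diagGaussian (H2.fn u t)) v)
    (ha : IsAcceleration (fun t => diagGaussian (H2.fn u t)) v a) :
    ENNReal.ofReal (‖u.1 2‖ ^ 2) ≤ spaceTimeSq (fun t => diagGaussian (H2.fn u t)) a := by
  have hw := isAcceleration_eulerField hu
  rw [← spaceTimeSq_eulerField_acc hu]
  set X : ℝ → E d → E d := fun t x => a t x - eulerField u (H2.acc u) t x with hXdef
  have hXm : Measurable (Function.uncurry X) := ha.1.sub hw.1
  have hXf := spaceTimeSq_sub_lt_top hu ha.1 hw.1 ha.2.1 hw.2.1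
  -- Accelerations are not required to be tangent. Testing with coordinate fields suffices, since
  -- only orthogonality to linear diagonal fields is needed.
  have hall : ∀ᵐ t ∂(volume.restrict (Ioo (0 : ℝ) 1)), ∀ (j : Fin d) (n : ℕ),
      ∫ x, inner ℝ (coordField n j x) (X t x) ∂(diagGaussian (H2.fn u t)) = 0 := by
    rw [ae_all_iff]
    intro j
    rw [ae_all_iff]
    intro n
    have k1 := contDiff_coordField n j
    have k2 := hasCompactSupport_coordField n j
    obtain ⟨C, hC⟩ := k2.exists_bound_of_continuous k1.continuous
    refine ae_integral_inner_eq_zero hu hXm hXf k1.continuous hC fun η h1 h2 h3 => ?_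
    have htest := isSpaceTimeTest_smul h1 h2 h3 k1 k2
    have e1 := ha.2.2 _ htest
    have e2 := hw.2.2 _ htest
    have hwv := isVelocity_eulerField hu
    rw [acceleration_test_eq hu hv.1.1 hv.1.2.1 ha.1 ha.2.1 htest] at e1
    rw [acceleration_test_eq hu hwv.1 hwv.2.1 hw.1 hw.2.1 htest] at e2
    have i1 := integrable_acceleration_test (u := u) htest (memLp_curve hu hv.1.1 hv.1.2.1)
      (memLp_curve hu ha.1 ha.2.1)
    have i2 := integrable_acceleration_test (u := u) htest (memLp_curve hu hwv.1 hwv.2.1)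
      (memLp_curve hu hw.1 hw.2.1)
    rw [← sub_self (0 : ℝ)]
    nth_rewrite 1 [← e1]
    rw [← e2, ← integral_sub i1 i2]
    refine integral_congr_ae ?_
    filter_upwards [hv.ae_eq_lagVel hu, ae_eulerField_vel hu] with p g1 g2
    -- Both velocities agree along the flow, so the terms quadratic in the velocity cancel.
    rw [g1, g2, add_sub_add_left_eq_sub, ← inner_sub_right, real_inner_smul_left]
    rfl
  rw [spaceTimeSq, spaceTimeSq]
  refine lintegral_mono_ae ?_
  filter_upwards [hall, ae_fn_mem hu, ae_memLp_curve hu hXm hXf] with t g1 g2 g3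
  have hid : MemLp (fun x : E d => x) 2 (diagGaussian (H2.fn u t)) :=
    memLp_two_of_lintegral continuous_id.aestronglyMeasurable (lintegral_sq_diagGaussian_lt_top g2)
  refine (lintegral_scale_le_of_moments g3 hid _
    fun j => integral_coord_mul_eq_zero g3 hid (g1 j)).trans (le_of_eq ?_)
  refine lintegral_congr fun x => ?_
  congr 2
  exact sub_add_cancel _ _

theorem splineEnergy_eq (hu : u ∈ H2Curves (nonnegDiag d)) :
    splineEnergy (fun t => diagGaussian (H2.fn u t)) = ENNReal.ofReal (‖u.1 2‖ ^ 2) := by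
  refine le_antisymm ?_ (le_iInf₂ fun v a => le_iInf₂ fun hv ha => ha.le_spaceTimeSq hu hv)
  exact (iInf₂_le _ _).trans ((iInf₂_le (isTangentVelocity_eulerField hu)
    (isAcceleration_eulerField hu)).trans (spaceTimeSq_eulerField_acc hu).le)

/-- The regularized spline energy of a Gaussian curve is the quadratic energy of its standard
deviation. -/
theorem energyHat_eq {δ : ℝ} (hδ : 0 ≤ δ) (hu : u ∈ H2Curves (nonnegDiag d)) :
    energyHat δ u = ENNReal.ofReal (energy δ u) := by
  rw [energyHat, regEnergy, splineEnergy_eq hu, pathEnergy_eq hu, ← ENNReal.ofReal_mul hδ,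
    ← ENNReal.ofReal_add (sq_nonneg _) (by positivity)]
  rfl

end EnergyFormula

/-! ### Sampling of `H²` curves -/

section Sampling

variable {d : ℕ}

theorem sq_norm_intervalIntegral_le {f : ℝ → E d} {a b : ℝ} (hab : a ≤ b)
    (hf : MemLp f 2 (volume.restrict (Ioc a b))) :
    ‖∫ s in a..b, f s‖ ^ 2 ≤ (b - a) * ∫ s in a..b, ‖f s‖ ^ 2 := by
  rw [intervalIntegral.integral_of_le hab, intervalIntegral.integral_of_le hab]
  have h := sq_norm_integral_le hf
  rwa [measureReal_restrict_apply_univ, Real.volume_real_Ioc_of_le hab] at h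

theorem sq_norm_intervalIntegral_le_of_continuous {f : ℝ → E d} {a b : ℝ} (hab : a ≤ b)
    (hf : Continuous f) : ‖∫ s in a..b, f s‖ ^ 2 ≤ (b - a) * ∫ s in a..b, ‖f s‖ ^ 2 := by
  refine sq_norm_intervalIntegral_le hab ?_
  obtain ⟨C, hC⟩ := isCompact_Icc.exists_bound_of_continuousOn (hf.continuousOn (s := Icc a b))
  refine MemLp.of_bound hf.aestronglyMeasurable C ?_
  filter_upwards [ae_restrict_mem measurableSet_Ioc] with t ht using hC t (Ioc_subset_Icc_self ht)

theorem H2.memLp_acc_volume (u : H2 d) : MemLp (H2.acc u) 2 volume :=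
  (memLp_indicator_iff_restrict measurableSet_Ioo).2 (Lp.memLp _)

theorem H2.integrable_norm_sq_acc (u : H2 d) : Integrable fun t => ‖H2.acc u t‖ ^ 2 :=
  (H2.memLp_acc_volume u).integrable_norm_pow (by norm_num)

/-- Cauchy–Schwarz on each interval of length `1 / K` produces the factor that cancels `K`. -/
theorem H2.sum_norm_sq_sub_le (u : H2 d) {K : ℕ} (hK : 0 < K) :
    (K : ℝ) * ∑ k ∈ Finset.range K,
      ‖H2.rep u (((k + 1 : ℕ) : ℝ) / K) - H2.rep u ((k : ℝ) / K)‖ ^ 2 ≤ ‖u.1 1‖ ^ 2 := by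
  have hK' : (0 : ℝ) < K := by exact_mod_cast hK
  have hc : Continuous fun t => ‖H2.vel u t‖ ^ 2 := (H2.continuous_vel u).norm.pow 2
  have hle : ∀ k : ℕ, (k : ℝ) / K ≤ ((k + 1 : ℕ) : ℝ) / K := fun k => by
    gcongr; exact k.le_succ
  have hstep : ∀ k ∈ Finset.range K,
      ‖H2.rep u (((k + 1 : ℕ) : ℝ) / K) - H2.rep u ((k : ℝ) / K)‖ ^ 2 ≤
        (1 / K : ℝ) * ∫ s in ((k : ℝ) / K)..(((k + 1 : ℕ) : ℝ) / K), ‖H2.vel u s‖ ^ 2 := by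
    intro k _
    rw [H2.rep_sub_eq]
    refine (sq_norm_intervalIntegral_le_of_continuous (hle k) (H2.continuous_vel u)).trans
      (le_of_eq ?_)
    congr 1
    push_cast; ring
  refine (mul_le_mul_of_nonneg_left (Finset.sum_le_sum hstep) hK'.le).trans (le_of_eq ?_)
  rw [← Finset.mul_sum, ← mul_assoc, mul_one_div_cancel hK'.ne', one_mul,
    intervalIntegral.sum_integral_adjacent_intervals (a := fun k : ℕ => (k : ℝ) / K)
      fun k _ => hc.intervalIntegrable _ _, H2.norm_sq_one, integral_Ioo_eq_intervalIntegral]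
  simp [hK'.ne']

theorem H2.second_difference_eq (u : H2 d) (a h : ℝ) :
    H2.rep u (a + h + h) - (2 : ℝ) • H2.rep u (a + h) + H2.rep u a =
      ∫ s in (0 : ℝ)..h, ∫ r in (a + s)..(a + s + h), H2.acc u r := by
  have hv := H2.continuous_vel u
  have e : ∀ s, ∫ r in (a + s)..(a + s + h), H2.acc u r =
      H2.vel u (a + h + s) - H2.vel u (a + s) := fun s => by
    rw [← H2.vel_sub_eq]; congr 2; ring
  have hi : ∀ c, IntervalIntegrable (fun s => H2.vel u (c + s)) volume 0 h := fun c =>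
    (hv.comp (by fun_prop : Continuous fun s : ℝ => c + s)).intervalIntegrable _ _
  simp only [e]
  rw [intervalIntegral.integral_sub (hi _) (hi _),
    intervalIntegral.integral_comp_add_left (fun s => H2.vel u s),
    intervalIntegral.integral_comp_add_left (fun s => H2.vel u s), ← H2.rep_sub_eq,
    ← H2.rep_sub_eq, add_zero, add_zero]
  module

/-- Cauchy–Schwarz is applied to both integrals of the second difference; each has length `h`. -/
theorem H2.norm_sq_second_difference_le (u : H2 d) (a : ℝ) {h : ℝ} (hh : 0 ≤ h) :
    ‖H2.rep u (a + h + h) - (2 : ℝ) • H2.rep u (a + h) + H2.rep u a‖ ^ 2 ≤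
      h ^ 2 * ∫ s in (0 : ℝ)..h, ∫ r in (a + s)..(a + s + h), ‖H2.acc u r‖ ^ 2 := by
  have hprim : ∀ {F : Type} [NormedAddCommGroup F] [NormedSpace ℝ F] {f : ℝ → F},
      Integrable f → Continuous fun s => ∫ r in (a + s)..(a + s + h), f r := by
    intro F _ _ f hf
    have hc := intervalIntegral.continuous_primitive (μ := volume) (f := f)
      (fun _ _ => hf.intervalIntegrable) 0
    have e : (fun s => ∫ r in (a + s)..(a + s + h), f r) =
        fun s => (∫ r in (0 : ℝ)..(a + s + h), f r) - ∫ r in (0 : ℝ)..(a + s), f r := by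
      ext1 s
      exact (intervalIntegral.integral_interval_sub_left hf.intervalIntegrable
        hf.intervalIntegrable).symm
    rw [e]
    exact (hc.comp (by fun_prop : Continuous fun s : ℝ => a + s + h)).sub
      (hc.comp (by fun_prop : Continuous fun s : ℝ => a + s))
  have hc1 := hprim (H2.integrable_acc u)
  have hc2 := hprim (H2.integrable_norm_sq_acc u)
  rw [H2.second_difference_eq]
  refine (sq_norm_intervalIntegral_le_of_continuous hh hc1).trans ?_
  rw [sub_zero, sq h, mul_assoc, ← intervalIntegral.integral_const_mul h (fun s => ∫ r in _.._, _)]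
  refine mul_le_mul_of_nonneg_left ?_ hh
  refine intervalIntegral.integral_mono_on hh ((hc1.norm.pow 2).intervalIntegrable _ _)
    ((hc2.const_mul h).intervalIntegrable _ _) fun s _ => ?_
  refine (sq_norm_intervalIntegral_le (by linarith)
    ((H2.memLp_acc_volume u).restrict _)).trans (le_of_eq ?_)
  ring

/-- For a fixed shift `s` in `[0, h]` the windows `[s + (k-1)h, s + kh]` are adjacent and stay
inside `[0, 1]`, so their integrals add up to at most the full one. Integrating over `s` gives the
last factor in `K³ h² h = 1`. -/
theorem H2.sum_norm_sq_secDiff_le (u : H2 d) {K : ℕ} (hK : 0 < K) :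
    (K : ℝ) ^ 3 * ∑ k ∈ Finset.Ico 1 K,
      ‖secDiff K (fun k => H2.rep u ((k : ℝ) / K)) k‖ ^ 2 ≤ ‖u.1 2‖ ^ 2 := by
  have hK' : (0 : ℝ) < K := by exact_mod_cast hK
  set h : ℝ := 1 / K with hh
  have hh0 : 0 < h := by positivity
  have hi := H2.integrable_norm_sq_acc u
  set f : ℝ → ℝ := fun r => ‖H2.acc u r‖ ^ 2 with hf
  have hstep : ∀ k ∈ Finset.Ico 1 K, ‖secDiff K (fun k => H2.rep u ((k : ℝ) / K)) k‖ ^ 2 ≤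
      h ^ 2 * ∫ s in (0 : ℝ)..h, ∫ r in (s + ((k : ℝ) - 1) * h)..(s + ((k + 1 : ℕ) - 1) * h),
        f r := by
    intro k hk
    rw [Finset.mem_Ico] at hk
    have hk1 : ((k - 1 : ℕ) : ℝ) = k - 1 := by rw [Nat.cast_sub hk.1, Nat.cast_one]
    have e := H2.norm_sq_second_difference_le u (((k : ℝ) - 1) * h) hh0.le
    rw [secDiff, if_pos hk, hk1]
    have e1 : ((k + 1 : ℕ) : ℝ) / K = ((k : ℝ) - 1) * h + h + h := by
      rw [hh]; push_cast; ring
    have e2 : (k : ℝ) / K = ((k : ℝ) - 1) * h + h := by rw [hh]; ring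
    have e3 : ((k : ℝ) - 1) / K = ((k : ℝ) - 1) * h := by rw [hh]; ring
    rw [e1, e2, e3]
    refine e.trans (le_of_eq ?_)
    congr 2
    ext1 s
    congr 1
    · ring
    · push_cast; ring
  have hsum : ∑ k ∈ Finset.Ico 1 K, ∫ s in (0 : ℝ)..h,
      ∫ r in (s + ((k : ℝ) - 1) * h)..(s + ((k + 1 : ℕ) - 1) * h), f r ≤
        h * ∫ r in (0 : ℝ)..1, f r := by
    have hc : ∀ c c' : ℝ, Continuous fun s => ∫ r in (s + c)..(s + c'), f r := by
      intro c c'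
      have hp := intervalIntegral.continuous_primitive (μ := volume) (f := f)
        (fun _ _ => hi.intervalIntegrable) 0
      have e : (fun s => ∫ r in (s + c)..(s + c'), f r) =
          fun s => (∫ r in (0 : ℝ)..(s + c'), f r) - ∫ r in (0 : ℝ)..(s + c), f r := by
        ext1 s
        exact (intervalIntegral.integral_interval_sub_left hi.intervalIntegrable
          hi.intervalIntegrable).symm
      rw [e]
      exact (hp.comp (by fun_prop : Continuous fun s : ℝ => s + c')).sub
        (hp.comp (by fun_prop : Continuous fun s : ℝ => s + c))
    rw [← intervalIntegral.integral_finsetSum fun k _ => (hc _ _).intervalIntegrable _ _]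
    have hbound : ∀ s ∈ Icc (0 : ℝ) h, ∑ k ∈ Finset.Ico 1 K,
        ∫ r in (s + ((k : ℝ) - 1) * h)..(s + ((k + 1 : ℕ) - 1) * h), f r ≤
          ∫ r in (0 : ℝ)..1, f r := by
      intro s hs
      rw [intervalIntegral.sum_integral_adjacent_intervals_Ico
        (a := fun k : ℕ => s + ((k : ℝ) - 1) * h) hK fun k _ => hi.intervalIntegrable]
      have hK1 : (1 : ℝ) ≤ K := by exact_mod_cast hK
      refine intervalIntegral.integral_mono_interval ?_ ?_ ?_
        (Eventually.of_forall fun _ => sq_nonneg _) hi.intervalIntegrable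
      · push_cast; linarith [hs.1]
      · push_cast
        have : 0 ≤ ((K : ℝ) - 1) * h := mul_nonneg (by linarith) hh0.le
        linarith
      · have : ((K : ℝ) - 1) * h = 1 - h := by rw [hh]; field_simp
        linarith [hs.2]
    have hcs : Continuous fun s => ∑ k ∈ Finset.Ico 1 K,
        ∫ r in (s + ((k : ℝ) - 1) * h)..(s + ((k + 1 : ℕ) - 1) * h), f r :=
      continuous_finsetSum _ fun k _ => hc _ _
    refine (intervalIntegral.integral_mono_on hh0.le (hcs.intervalIntegrable _ _)
      (intervalIntegrable_const (c := ∫ r in (0 : ℝ)..1, f r)) hbound).trans (le_of_eq ?_)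
    rw [intervalIntegral.integral_const, sub_zero, smul_eq_mul]
  refine (mul_le_mul_of_nonneg_left (Finset.sum_le_sum hstep) (by positivity)).trans ?_
  rw [← Finset.mul_sum, H2.norm_sq_two, integral_Ioo_eq_intervalIntegral]
  have := mul_le_mul_of_nonneg_left hsum (show 0 ≤ (K : ℝ) ^ 3 * h ^ 2 by positivity)
  rw [← mul_assoc]
  refine this.trans (le_of_eq ?_)
  rw [← mul_assoc, show (K : ℝ) ^ 3 * h ^ 2 * h = 1 by rw [hh]; field_simp, one_mul]

theorem H2.norm_rep_sub_le (u : H2 d) {a b : ℝ} (ha : a ∈ Icc (0 : ℝ) 1) (hb : b ∈ Icc (0 : ℝ) 1) :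
    ‖H2.rep u b - H2.rep u a‖ ≤ ‖u.1 1‖ := by
  have key : ∀ a ∈ Icc (0 : ℝ) 1, ∀ b ∈ Icc (0 : ℝ) 1, a ≤ b →
      ‖H2.rep u b - H2.rep u a‖ ≤ ‖u.1 1‖ := by
    intro a ha b hb hab
    have hc : Continuous fun t => ‖H2.vel u t‖ ^ 2 := (H2.continuous_vel u).norm.pow 2
    have h1 := sq_norm_intervalIntegral_le_of_continuous hab (H2.continuous_vel u)
    have h2 : ∫ s in a..b, ‖H2.vel u s‖ ^ 2 ≤ ∫ s in (0 : ℝ)..1, ‖H2.vel u s‖ ^ 2 :=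
      intervalIntegral.integral_mono_interval ha.1 hab hb.2
        (Eventually.of_forall fun _ => sq_nonneg _) (hc.intervalIntegrable _ _)
    have h3 : 0 ≤ ∫ s in a..b, ‖H2.vel u s‖ ^ 2 :=
      intervalIntegral.integral_nonneg hab fun _ _ => sq_nonneg _
    rw [← integral_Ioo_eq_intervalIntegral, ← H2.norm_sq_one] at h2
    rw [← H2.rep_sub_eq] at h1
    refine le_of_sq_le_sq (h1.trans ?_) (norm_nonneg _)
    nlinarith [ha.1, hb.2]
  rcases le_total a b with h | h
  · exact key a ha b hb h
  · rw [norm_sub_rev]; exact key b hb a ha h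

theorem H2.norm_zero_le (u : H2 d) {B : ℝ} (hB : 0 ≤ B)
    (h : ∀ t ∈ Icc (0 : ℝ) 1, ‖H2.rep u t‖ ≤ B) : ‖u.1 0‖ ≤ B := by
  refine le_of_sq_le_sq ?_ hB
  have hc : Continuous fun t => ‖H2.rep u t‖ ^ 2 := (H2.continuous_rep u).norm.pow 2
  rw [H2.norm_sq_zero, integral_Ioo_eq_intervalIntegral]
  refine (intervalIntegral.integral_mono_on zero_le_one (hc.intervalIntegrable _ _)
    (intervalIntegrable_const (c := B ^ 2)) fun t ht =>
      pow_le_pow_left₀ (norm_nonneg _) (h t ht) 2).trans (le_of_eq ?_)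
  simp

theorem H2.exists_lipschitz_rep (u : H2 d) : ∃ M, 0 ≤ M ∧ ∀ a ∈ Icc (0 : ℝ) 1,
    ∀ b ∈ Icc (0 : ℝ) 1, ‖H2.rep u b - H2.rep u a‖ ≤ M * |b - a| := by
  obtain ⟨M, hM⟩ := isCompact_Icc.exists_bound_of_continuousOn
    ((H2.continuous_vel u).continuousOn (s := Icc (0 : ℝ) 1))
  refine ⟨M, (norm_nonneg _).trans (hM 0 (by simp)), fun a ha b hb => ?_⟩
  exact (convex_Icc (0 : ℝ) 1).norm_image_sub_le_of_norm_hasDerivWithin_le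
    (fun t _ => (H2.hasDerivAt_rep u t).hasDerivWithinAt) hM ha hb

theorem div_mem_Icc {k K : ℕ} (h : k ≤ K) : (k : ℝ) / K ∈ Icc (0 : ℝ) 1 :=
  ⟨by positivity, div_le_one_of_le₀ (by exact_mod_cast h) (by positivity)⟩

/-- The extension of a sampled curve is uniformly close to the curve. -/
theorem norm_rep_sub_le_of_sampling {C : Set (E d)} {σ w : H2 d} {K : ℕ} (hK : 0 < K)
    (hw : IsExtension C K (fun k => H2.rep σ ((k : ℝ) / K)) w) {M : ℝ} (hM0 : 0 ≤ M)
    (hM : ∀ a ∈ Icc (0 : ℝ) 1, ∀ b ∈ Icc (0 : ℝ) 1, ‖H2.rep σ b - H2.rep σ a‖ ≤ M * |b - a|)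
    {t : ℝ} (ht : t ∈ Icc (0 : ℝ) 1) :
    ‖H2.rep w t - H2.rep σ t‖ ≤ M * (3 / 2) / K := by
  have hK' : (0 : ℝ) < K := by exact_mod_cast hK
  obtain ⟨i, a, hi, hdist, ha, ha1, he⟩ := splinePos_convex hK (fun k => H2.rep σ ((k : ℝ) / K))
    (mul_nonneg hK'.le ht.1) (by nlinarith [ht.2] : K * t ≤ K)
  rw [hw.rep_eqOn hK ht]
  dsimp only
  have e : H2.rep σ t = ∑ m, a m • H2.rep σ t := by rw [← Finset.sum_smul, ha1, one_smul]
  rw [he, e, ← Finset.sum_sub_distrib]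
  have hb : ∀ m, ‖a m • H2.rep σ ((i m : ℝ) / K) - a m • H2.rep σ t‖ ≤
      a m * (M * (3 / 2) / K) := by
    intro m
    rw [← smul_sub, norm_smul, Real.norm_of_nonneg (ha m)]
    refine mul_le_mul_of_nonneg_left ((hM t ht _ (div_mem_Icc (hi m))).trans ?_) (ha m)
    rw [mul_div_assoc]
    refine mul_le_mul_of_nonneg_left ?_ hM0
    have e2 : (i m : ℝ) / K - t = -((K * t - i m) / K) := by field_simp; ring
    rw [e2, abs_neg, abs_div, abs_of_pos hK']
    exact div_le_div_of_nonneg_right (hdist m) hK'.le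
  refine (norm_sum_le_of_le _ fun m _ => hb m).trans (le_of_eq ?_)
  rw [← Finset.sum_mul, ha1, one_mul]

/-- Extensions of samplings converge strongly in `H²`. -/
theorem tendsto_of_sampling {C : Set (E d)} {σ : H2 d} {K : ℕ → ℕ} (hK0 : ∀ n, 0 < K n)
    (hK : Tendsto K atTop atTop) {w : ℕ → H2 d}
    (hw : ∀ n, IsExtension C (K n) (fun k => H2.rep σ ((k : ℝ) / K n)) (w n)) :
    Tendsto w atTop (𝓝 σ) := by
  obtain ⟨M, hM0, hM⟩ := H2.exists_lipschitz_rep σ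
  set e : ℕ → ℝ := fun n => M * (3 / 2) / K n with he
  have he0 : ∀ n, 0 ≤ e n := fun n => by positivity
  have helim : Tendsto e atTop (𝓝 0) :=
    tendsto_const_nhds.div_atTop (tendsto_natCast_atTop_atTop.comp hK)
  have hclose : ∀ n, ∀ t ∈ Icc (0 : ℝ) 1, ‖H2.rep (w n) t - H2.rep σ t‖ ≤ e n :=
    fun n t ht => norm_rep_sub_le_of_sampling (hK0 n) (hw n) hM0 hM ht
  -- The derivative norms never exceed those of `σ`; only the zeroth-order term carries an error.
  set r : ℕ → ℝ := fun n => (‖σ.1 0‖ + e n) ^ 2 + ‖σ.1 1‖ ^ 2 + ‖σ.1 2‖ ^ 2 with hr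
  have hrlim : Tendsto r atTop (𝓝 (‖σ‖ ^ 2)) := by
    have := (((helim.const_add ‖σ.1 0‖).pow 2).add_const (‖σ.1 1‖ ^ 2)).add_const (‖σ.1 2‖ ^ 2)
    rwa [add_zero, ← H2.norm_sq] at this
  have hle : ∀ n, ‖w n‖ ^ 2 ≤ r n := by
    intro n
    rw [H2.norm_sq]
    have h1 : ‖(w n).1 0‖ ≤ ‖σ.1 0‖ + e n := by
      have h2 : ‖(w n - σ).1 0‖ ≤ e n := by
        refine H2.norm_zero_le _ (he0 n) fun t ht => ?_
        have := map_sub (H2.eval t ht) (w n) σ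
        rw [H2.eval_apply, H2.eval_apply, H2.eval_apply] at this
        rw [this]
        exact hclose n t ht
      have h3 : (w n).1 0 = σ.1 0 + (w n - σ).1 0 := (add_sub_cancel (σ.1 0) ((w n).1 0)).symm
      rw [h3]
      exact (norm_add_le _ _).trans (by linarith)
    refine add_le_add (add_le_add (pow_le_pow_left₀ (norm_nonneg _) h1 2) ?_) ?_
    · exact ((hw n).norm_sq_one_le (hK0 n)).trans (H2.sum_norm_sq_sub_le σ (hK0 n))
    · exact ((hw n).norm_sq_two (hK0 n)).le.trans (H2.sum_norm_sq_secDiff_le σ (hK0 n))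
  -- Every subsequence has a weakly convergent further subsequence. Uniform closeness identifies the
  -- limit as `σ`, and the norm bound makes the convergence strong.
  refine tendsto_of_subseq_tendsto fun ns hns => ?_
  obtain ⟨R, hR⟩ := hrlim.bddAbove_range
  have hbd : ∀ n, ‖w (ns n)‖ ≤ √R := fun n =>
    Real.le_sqrt_of_sq_le ((hle _).trans (hR (mem_range_self _)))
  obtain ⟨u, φ, hφ, hweak⟩ := exists_weakTendsto_subseq hbd
  have hsub : Tendsto (fun n => ns (φ n)) atTop atTop := hns.comp hφ.tendsto_atTop
  have hu : u = σ := by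
    refine H2.ext_rep fun t ht => tendsto_nhds_unique (hweak.rep ht) ?_
    rw [tendsto_iff_norm_sub_tendsto_zero]
    exact squeeze_zero (fun _ => norm_nonneg _) (fun n => hclose _ t ht) (helim.comp hsub)
  subst hu
  exact ⟨φ, hweak.tendsto_of_norm_sq_le (hrlim.comp hsub) fun n => hle _⟩

end Sampling

/-! ### The functionals on `H²((0,1); C)` -/

section Functionals

variable {d I : ℕ} {C : Set (E d)} {δ : ℝ} {t : Fin I → ℝ} {μ : Fin I → Measure (E d)} {K : ℕ}

theorem convex_nonnegDiag (d : ℕ) : Convex ℝ (nonnegDiag d) := by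
  intro x hx y hy a b ha hb _ j
  have := add_nonneg (mul_nonneg ha (hx j)) (mul_nonneg hb (hy j))
  simpa using this

theorem convex_posDiag (d : ℕ) : Convex ℝ (posDiag d) := by
  intro x hx y hy a b ha hb hab j
  have h : 0 < a * x j + b * y j := by
    rcases ha.eq_or_lt with rfl | ha'
    · have hb1 : b = 1 := by linarith
      simpa [hb1] using hy j
    · exact add_pos_of_pos_of_nonneg (mul_pos ha' (hx j)) (mul_nonneg hb (hy j).le)
  simpa using h

theorem posDiag_subset_nonnegDiag (d : ℕ) : posDiag d ⊆ nonnegDiag d := fun _ h j => (h j).le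

theorem H2Curves_mono {C' : Set (E d)} (h : C ⊆ C') {u : H2 d} (hu : u ∈ H2Curves C) :
    u ∈ H2Curves C' :=
  mem_H2Curves_iff.2 fun s hs => h (mem_H2Curves_iff.1 hu s hs)

theorem continuousFunctional_of_constraint (hδ : 0 < δ) (hC : C ⊆ nonnegDiag d)
    (ht : ∀ i, t i ∈ Icc (0 : ℝ) 1) {u : H2Curves C}
    (h : ∀ i, diagGaussian (H2.rep (u : H2 d) (t i)) = μ i) :
    continuousFunctional C δ t μ u = ENNReal.ofReal (energy δ (u : H2 d)) := by
  classical
  rw [continuousFunctional, constraintIndicator_eq ht, if_pos h, add_zero,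
    energyHat_eq hδ.le (H2Curves_mono hC u.2)]

theorem constraint_of_continuousFunctional_ne_top (ht : ∀ i, t i ∈ Icc (0 : ℝ) 1)
    {u : H2Curves C} (h : continuousFunctional C δ t μ u ≠ ⊤) (i : Fin I) :
    diagGaussian (H2.rep (u : H2 d) (t i)) = μ i := by
  classical
  revert i
  by_contra hn
  refine h ?_
  rw [continuousFunctional, constraintIndicator_eq ht, if_neg hn, add_top]

theorem exists_of_discreteFunctional_ne_top {w : H2Curves C}
    (h : discreteFunctional C δ t μ K w ≠ ⊤) : ∃ x : ℕ → E d, IsExtension C K x (w : H2 d) ∧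
      ∀ (i : Fin I) (k : ℕ), (k : ℝ) = K * t i → diagGaussian (x k) = μ i := by
  by_contra hn
  refine h ?_
  rw [discreteFunctional, discreteIndicator, if_neg hn, add_top]

/-- The comparison holds for every tuple whose extension is `w`, hence for the infimum. It reduces
the liminf inequality and compactness to the fixed quadratic energy. -/
theorem ofReal_energy_le_discreteFunctional (hδ : 0 < δ) (hC : C ⊆ nonnegDiag d) (hK : 0 < K)
    (w : H2Curves C) :
    ENNReal.ofReal (energy δ (w : H2 d)) ≤ discreteFunctional C δ t μ K w := by
  refine le_trans (le_iInf₂ fun x hx => ?_) le_self_add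
  rw [discreteRegEnergy_diagGaussian hδ fun k hk => hC (hx.1 k hk)]
  refine ENNReal.ofReal_le_ofReal (add_le_add (hx.norm_sq_two hK).le ?_)
  exact mul_le_mul_of_nonneg_left (hx.norm_sq_one_le hK) hδ.le

/-- Sampling a curve that satisfies the constraints does not increase the energy. -/
theorem exists_sampling (hδ : 0 < δ) (hC : C ⊆ nonnegDiag d) (hconv : Convex ℝ C) (hK : 0 < K)
    {u : H2Curves C} (h : ∀ i, diagGaussian (H2.rep (u : H2 d) (t i)) = μ i) :
    ∃ w : H2Curves C,
      IsExtension C K (fun k => H2.rep (u : H2 d) ((k : ℝ) / K)) (w : H2 d) ∧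
      discreteFunctional C δ t μ K w ≤ ENNReal.ofReal (energy δ (u : H2 d)) := by
  have hK' : (K : ℝ) ≠ 0 := by exact_mod_cast hK.ne'
  set x : ℕ → E d := fun k => H2.rep (u : H2 d) ((k : ℝ) / K) with hx
  have hxC : ∀ k ≤ K, x k ∈ C := fun k hk => mem_H2Curves_iff.1 u.2 _ (div_mem_Icc hk)
  obtain ⟨w, hw, -, -⟩ := exists_spline_H2 hK x
  have hext : IsExtension C K x w := isExtension_of_rep_eqOn hK hxC hw
  refine ⟨⟨w, rep_mem_of_isExtension hK hconv hext⟩, hext, ?_⟩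
  have hcon : ∃ x : ℕ → E d, IsExtension C K x w ∧
      ∀ (i : Fin I) (k : ℕ), (k : ℝ) = K * t i → diagGaussian (x k) = μ i := by
    refine ⟨x, hext, fun i k hk => ?_⟩
    rw [hx]
    dsimp only
    rw [hk, mul_div_cancel_left₀ _ hK', h i]
  rw [discreteFunctional, discreteIndicator, if_pos hcon, add_zero]
  refine (iInf₂_le x hext).trans ?_
  rw [discreteRegEnergy_diagGaussian hδ fun k hk => hC (hxC k hk)]
  refine ENNReal.ofReal_le_ofReal (add_le_add (H2.sum_norm_sq_secDiff_le _ hK) ?_)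
  exact mul_le_mul_of_nonneg_left (H2.sum_norm_sq_sub_le _ hK) hδ.le

theorem norm_sq_two_le_energy (hδ : 0 < δ) (u : H2 d) : ‖u.1 2‖ ^ 2 ≤ energy δ u :=
  le_add_of_nonneg_right (by positivity)

/-- Injectivity of `diagGaussian` on nonnegative vectors turns the constraint on measures into
equality of the node with `s`; near-interpolation does the rest. -/
theorem norm_rep_sub_le_of_constraint (hC : C ⊆ nonnegDiag d) (hK : 0 < K)
    (ht : ∀ i, t i ∈ Icc (0 : ℝ) 1) (hKt : ∀ i, ∃ k : ℕ, (k : ℝ) = K * t i) {x : ℕ → E d}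
    {w : H2 d} (hx : IsExtension C K x w)
    (hcon : ∀ (i : Fin I) (k : ℕ), (k : ℝ) = K * t i → diagGaussian (x k) = μ i) {i : Fin I}
    {s : E d} (hs : s ∈ nonnegDiag d) (hμ : μ i = diagGaussian s) :
    ‖H2.rep w (t i) - s‖ ^ 2 ≤ ‖w.1 2‖ ^ 2 / (K : ℝ) ^ 3 := by
  obtain ⟨k, hk⟩ := hKt i
  have hkK : k ≤ K := by
    have h1 : (k : ℝ) ≤ K := by
      rw [hk]; exact mul_le_of_le_one_right K.cast_nonneg (ht i).2
    exact_mod_cast h1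
  have hxs : x k = s :=
    diagGaussian_injOn (hC (hx.1 k hkK)) hs ((hcon i k hk).trans hμ)
  rw [← hxs]
  exact hx.norm_rep_sub_le hK hkK hk

/-- The interpolation constraints pass to weak limits. -/
theorem constraint_of_weakTendsto (hδ : 0 < δ) (hC : C ⊆ nonnegDiag d)
    (ht : ∀ i, t i ∈ Icc (0 : ℝ) 1) (hμ : ∀ i, ∃ s ∈ nonnegDiag d, μ i = diagGaussian s)
    {K : ℕ → ℕ} (hK0 : ∀ n, 0 < K n) (hK : Tendsto K atTop atTop)
    (hKt : ∀ n i, ∃ k : ℕ, (k : ℝ) = K n * t i) {w : ℕ → H2Curves C} {u : H2 d}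
    (hw : WeakTendsto (fun n => (w n : H2 d)) u) {q : ℝ≥0∞} (hq : q ≠ ⊤)
    (hle : ∀ n, discreteFunctional C δ t μ (K n) (w n) ≤ q) (i : Fin I) :
    diagGaussian (H2.rep u (t i)) = μ i := by
  obtain ⟨s, hs, hμs⟩ := hμ i
  have hE : ∀ n, energy δ (w n : H2 d) ≤ q.toReal := fun n =>
    (ENNReal.ofReal_le_iff_le_toReal hq).1
      ((ofReal_energy_le_discreteFunctional hδ hC (hK0 n) (w n)).trans (hle n))
  have hlim : Tendsto (fun n => H2.rep (w n : H2 d) (t i)) atTop (𝓝 s) := by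
    rw [tendsto_iff_norm_sub_tendsto_zero]
    have hsq : Tendsto (fun n => ‖H2.rep (w n : H2 d) (t i) - s‖ ^ 2) atTop (𝓝 0) := by
      have hb : Tendsto (fun n => q.toReal / (K n : ℝ) ^ 3) atTop (𝓝 0) :=
        tendsto_const_nhds.div_atTop
          ((tendsto_pow_atTop (by norm_num)).comp (tendsto_natCast_atTop_atTop.comp hK))
      refine squeeze_zero (fun n => sq_nonneg _) (fun n => ?_) hb
      obtain ⟨x, hx, hcon⟩ :=
        exists_of_discreteFunctional_ne_top (ne_top_of_le_ne_top hq (hle n))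
      refine (norm_rep_sub_le_of_constraint hC (hK0 n) ht (hKt n) hx hcon hs hμs).trans ?_
      gcongr
      exact (norm_sq_two_le_energy hδ _).trans (hE n)
    simpa using hsq.sqrt
  rw [tendsto_nhds_unique (hw.rep (ht i)) hlim, hμs]

/-- Mosco convergence for a convex set of diagonal matrices. -/
theorem moscoTendsto_discreteFunctional (hδ : 0 < δ) (hC : C ⊆ nonnegDiag d) (hconv : Convex ℝ C)
    (ht : ∀ i, t i ∈ Icc (0 : ℝ) 1) (hμ : ∀ i, ∃ s ∈ nonnegDiag d, μ i = diagGaussian s)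
    {K : ℕ → ℕ} (hK0 : ∀ n, 0 < K n) (hK : Tendsto K atTop atTop)
    (hKt : ∀ n i, ∃ k : ℕ, (k : ℝ) = K n * t i) :
    MoscoTendsto (fun n => discreteFunctional C δ t μ (K n)) (continuousFunctional C δ t μ) := by
  constructor
  · intro u w hw
    by_contra! hlt
    -- A subsequence stays below a finite `q`, so the constraints hold in the limit and weak lower
    -- semicontinuity bounds the limit energy by `q`.
    obtain ⟨q, hq1, hq2⟩ := exists_between hlt
    have hq : q ≠ ⊤ := ne_top_of_lt hq2
    obtain ⟨φ, hφ, hφq⟩ := extraction_of_frequently_atTop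
      (frequently_lt_of_liminf_lt (by isBoundedDefault) hq1)
    have hw' := hw.comp_tendsto hφ.tendsto_atTop
    have hcon := constraint_of_weakTendsto (K := fun n => K (φ n)) (w := fun n => w (φ n)) hδ hC ht
      hμ (fun n => hK0 _) (hK.comp hφ.tendsto_atTop) (fun n => hKt _) hw' hq fun n => (hφq n).le
    have hE := hw'.energy_le hδ (q := q.toReal) fun n =>
      (ENNReal.ofReal_le_iff_le_toReal hq).1
        ((ofReal_energy_le_discreteFunctional hδ hC (hK0 _) _).trans (hφq n).le)
    rw [continuousFunctional_of_constraint hδ hC ht hcon] at hq2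
    exact absurd hq2 (not_lt.2 ((ENNReal.ofReal_le_iff_le_toReal hq).2 hE))
  · intro u
    by_cases htop : continuousFunctional C δ t μ u = ⊤
    · exact ⟨fun _ => u, tendsto_const_nhds, htop ▸ le_top⟩
    have hcon := constraint_of_continuousFunctional_ne_top ht htop
    choose w hw1 hw2 using fun n => exists_sampling (K := K n) hδ hC hconv (hK0 n) hcon
    refine ⟨w, tendsto_of_sampling hK0 hK hw1, ?_⟩
    rw [continuousFunctional_of_constraint hδ hC ht hcon]
    exact (limsup_le_limsup (Eventually.of_forall hw2)).trans (limsup_const _).le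

/-- The energy controls only derivatives. One interpolation point anchors the curve near `s`, and
the first derivative bounds its distance from there. -/
theorem norm_le_of_discreteFunctional_le (hδ : 0 < δ) (hC : C ⊆ nonnegDiag d) (hK : 0 < K)
    (ht : ∀ i, t i ∈ Icc (0 : ℝ) 1) (hKt : ∀ i, ∃ k : ℕ, (k : ℝ) = K * t i) {i : Fin I} {s : E d}
    (hs : s ∈ nonnegDiag d) (hμ : μ i = diagGaussian s) {M : NNReal} {w : H2Curves C}
    (h : discreteFunctional C δ t μ K w ≤ M) :
    ‖(w : H2 d)‖ ≤ √((‖s‖ + √M + √(M / δ)) ^ 2 + M / δ + M) := by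
  obtain ⟨x, hx, hcon⟩ := exists_of_discreteFunctional_ne_top (ne_top_of_le_ne_top (by simp) h)
  have hE : energy δ (w : H2 d) ≤ M := by
    have := (ofReal_energy_le_discreteFunctional hδ hC hK w).trans h
    simpa using (ENNReal.ofReal_le_iff_le_toReal (by simp)).1 this
  have h2 : ‖(w : H2 d).1 2‖ ^ 2 ≤ M := (norm_sq_two_le_energy hδ _).trans hE
  have h1 : ‖(w : H2 d).1 1‖ ^ 2 ≤ M / δ := by
    rw [le_div_iff₀ hδ]
    unfold energy at hE
    nlinarith [sq_nonneg ‖(w : H2 d).1 2‖]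
  have h3 : ‖H2.rep (w : H2 d) (t i) - s‖ ≤ √M := by
    refine Real.le_sqrt_of_sq_le
      ((norm_rep_sub_le_of_constraint hC hK ht hKt hx hcon hs hμ).trans
        ((div_le_self (sq_nonneg _) ?_).trans h2))
    exact one_le_pow₀ (by exact_mod_cast hK)
  have h0 : ‖(w : H2 d).1 0‖ ≤ ‖s‖ + √M + √(M / δ) := by
    refine H2.norm_zero_le _ (by positivity) fun r hr => ?_
    have h4 := (H2.norm_rep_sub_le (w : H2 d) (ht i) hr).trans (Real.le_sqrt_of_sq_le h1)
    have e : H2.rep (w : H2 d) r = s + (H2.rep (w : H2 d) (t i) - s) +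
        (H2.rep (w : H2 d) r - H2.rep (w : H2 d) (t i)) := by abel
    rw [e]
    exact (norm_add₃_le).trans (add_le_add (add_le_add le_rfl h3) h4)
  refine Real.le_sqrt_of_sq_le ?_
  rw [H2.norm_sq]
  exact add_le_add (add_le_add (pow_le_pow_left₀ (norm_nonneg _) h0 2) h1) h2

theorem isClosed_nonnegDiag (d : ℕ) : IsClosed (nonnegDiag d) := by
  simp only [nonnegDiag, ofPred_forall]
  exact isClosed_iInter fun j =>
    isClosed_le continuous_const (EuclideanSpace.proj (𝕜 := ℝ) j).continuous

/-- Weak precompactness of sequences of bounded energy. -/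
theorem exists_weakTendsto_of_discreteFunctional_le (hI : 1 ≤ I) (hδ : 0 < δ)
    (ht : ∀ i, t i ∈ Icc (0 : ℝ) 1) (hμ : ∀ i, ∃ s ∈ nonnegDiag d, μ i = diagGaussian s)
    {K : ℕ → ℕ} (hK0 : ∀ n, 0 < K n) (hKt : ∀ n i, ∃ k : ℕ, (k : ℝ) = K n * t i)
    (w : ℕ → H2Curves (nonnegDiag d)) {M : NNReal}
    (hM : ∀ n, discreteFunctional (nonnegDiag d) δ t μ (K n) (w n) ≤ M) :
    ∃ (u : H2Curves (nonnegDiag d)) (φ : ℕ → ℕ), StrictMono φ ∧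
      WeakTendsto (fun n => (w (φ n) : H2 d)) u := by
  obtain ⟨s, hs, hμs⟩ := hμ ⟨0, hI⟩
  obtain ⟨u, φ, hφ, hu⟩ := exists_weakTendsto_subseq fun n =>
    norm_le_of_discreteFunctional_le hδ subset_rfl (hK0 n) ht (hKt n) hs hμs (hM n)
  refine ⟨⟨u, mem_H2Curves_iff.2 fun r hr => ?_⟩, φ, hφ, hu⟩
  exact (isClosed_nonnegDiag d).mem_of_tendsto (hu.rep hr)
    (Eventually.of_forall fun n => mem_H2Curves_iff.1 (w (φ n)).2 r hr)

/-- Polynomial curves of positive semidefinite matrices interpolate arbitrary data. -/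
theorem exists_interpolation (ht : StrictMono t)
    (hμ : ∀ i, ∃ s ∈ nonnegDiag d, μ i = diagGaussian s) (ht01 : ∀ i, t i ∈ Icc (0 : ℝ) 1) :
    ∃ u : H2Curves (nonnegDiag d), ∀ i, diagGaussian (H2.rep (u : H2 d) (t i)) = μ i := by
  choose s hs hμs using hμ
  -- Squaring the Lagrange basis keeps the values 0 and 1 at the nodes and makes all coefficients
  -- nonnegative.
  let p : Fin I → Polynomial ℝ := fun i => Lagrange.basis Finset.univ t i ^ 2
  have hder : ∀ (q : Fin I → Polynomial ℝ) (r : ℝ), HasDerivAt (fun r => ∑ i, (q i).eval r • s i)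
      (∑ i, (q i).derivative.eval r • s i) r := fun q r =>
    HasDerivAt.fun_sum fun i _ => ((q i).hasDerivAt r).smul_const (s i)
  have hcont : ∀ q : Fin I → Polynomial ℝ, Continuous fun r => ∑ i, (q i).eval r • s i := fun q =>
    continuous_finsetSum _ fun i _ => (q i).continuous.smul continuous_const
  set c2 : ℝ → E d := fun r => ∑ i, (p i).derivative.derivative.eval r • s i with hc2
  have hc2c : Continuous c2 := hcont fun i => (p i).derivative.derivative
  obtain ⟨B, hB⟩ := isCompact_Icc.exists_bound_of_continuousOn
    (hc2c.continuousOn (s := Icc (0 : ℝ) 1))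
  have hmem : MemLp c2 2 (volume.restrict (Ioo (0 : ℝ) 1)) := by
    refine MemLp.of_bound hc2c.aestronglyMeasurable B ?_
    filter_upwards [ae_restrict_mem measurableSet_Ioo] with r hr
    exact hB r (Ioo_subset_Icc_self hr)
  obtain ⟨u, hu, -, -⟩ := H2.exists_of_rep hmem (fun r _ => by
    rw [hc2, intervalIntegral.integral_eq_sub_of_hasDerivAt
      (fun r _ => hder (fun i => (p i).derivative) r) (hc2c.intervalIntegrable _ _),
      add_sub_cancel]) (hder p) (hcont fun i => (p i).derivative)
  refine ⟨⟨u, mem_H2Curves_iff.2 fun r hr j => ?_⟩, fun i => ?_⟩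
  · rw [hu hr]
    simp only [p, Polynomial.eval_pow, WithLp.ofLp_sum, WithLp.ofLp_smul, Finset.sum_apply,
      Pi.smul_apply, smul_eq_mul]
    exact Finset.sum_nonneg fun i _ => mul_nonneg (sq_nonneg _) (hs i j)
  · dsimp only
    rw [hu (ht01 i), hμs i]
    congr 1
    dsimp only
    rw [Finset.sum_eq_single i]
    · rw [Polynomial.eval_pow, Lagrange.eval_basis_self ht.injective.injOn (Finset.mem_univ i)]
      simp
    · intro j _ hj
      rw [Polynomial.eval_pow, Lagrange.eval_basis_of_ne hj (Finset.mem_univ i)]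
      simp
    · simp

end Functionals

end WassersteinSpline

theorem mainTheorem4 (d I : ℕ) (hI : 1 ≤ I) (δ : ℝ) (hδ : 0 < δ)
    (t : Fin I → ℝ) (ht : StrictMono t) (ht01 : ∀ i, t i ∈ Set.Icc (0 : ℝ) 1)
    (μ : Fin I → MeasureTheory.Measure (E d))
    (hμ : ∀ i, ∃ s ∈ nonnegDiag d, μ i = diagGaussian s)
    (K : ℕ → ℕ) (hK0 : ∀ n, 0 < K n) (hK : Filter.Tendsto K Filter.atTop Filter.atTop)
    (hKt : ∀ n i, ∃ k : ℕ, (k : ℝ) = K n * t i) :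
    -- Mosco convergence, on curves of positive semidefinite and of positive definite matrices
    MoscoTendsto (fun n => discreteFunctional (nonnegDiag d) δ t μ (K n))
      (continuousFunctional (nonnegDiag d) δ t μ) ∧
    MoscoTendsto (fun n => discreteFunctional (posDiag d) δ t μ (K n))
      (continuousFunctional (posDiag d) δ t μ) ∧
    -- weak precompactness of sequences of bounded energy
    (∀ w : ℕ → H2Curves (nonnegDiag d),
      (∃ M : NNReal, ∀ n, discreteFunctional (nonnegDiag d) δ t μ (K n) (w n) ≤ M) →
      ∃ (u : H2Curves (nonnegDiag d)) (φ : ℕ → ℕ), StrictMono φ ∧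
        WeakTendsto (fun n => (w (φ n) : H2 d)) u) ∧
    -- subconvergence of discrete minimizers to a continuous minimizer
    (∀ w : ℕ → H2Curves (nonnegDiag d),
      (∀ n v, discreteFunctional (nonnegDiag d) δ t μ (K n) (w n) ≤
        discreteFunctional (nonnegDiag d) δ t μ (K n) v) →
      ∃ (u : H2Curves (nonnegDiag d)) (φ : ℕ → ℕ), StrictMono φ ∧
        WeakTendsto (fun n => (w (φ n) : H2 d)) u ∧
        ∀ v, continuousFunctional (nonnegDiag d) δ t μ u ≤
          continuousFunctional (nonnegDiag d) δ t μ v) := by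
  -- Stated for a general sequence because the liminf inequality is used again along a subsequence
  -- of `K`.
  have hmosco : ∀ K' : ℕ → ℕ, (∀ n, 0 < K' n) → Tendsto K' atTop atTop →
      (∀ n i, ∃ k : ℕ, (k : ℝ) = K' n * t i) →
      MoscoTendsto (fun n => discreteFunctional (nonnegDiag d) δ t μ (K' n))
        (continuousFunctional (nonnegDiag d) δ t μ) := fun K' h1 h2 h3 =>
    moscoTendsto_discreteFunctional hδ subset_rfl (convex_nonnegDiag d) ht01 hμ h1 h2 h3
  have hcompact := fun (w : ℕ → H2Curves (nonnegDiag d)) (M : NNReal) =>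
    exists_weakTendsto_of_discreteFunctional_le (M := M) hI hδ ht01 hμ hK0 hKt w
  refine ⟨hmosco K hK0 hK hKt, moscoTendsto_discreteFunctional hδ (posDiag_subset_nonnegDiag d)
    (convex_posDiag d) ht01 hμ hK0 hK hKt, fun w ⟨M, hM⟩ => hcompact w M hM, fun w hw => ?_⟩
  -- Minimality against the sampled competitor gives a bound independent of `n`. It serves twice:
  -- with the polynomial interpolant for compactness, with arbitrary `v` for minimality of the
  -- limit.
  have hle : ∀ v : H2Curves (nonnegDiag d),
      (∀ i, diagGaussian (H2.rep (v : H2 d) (t i)) = μ i) → ∀ n,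
      discreteFunctional (nonnegDiag d) δ t μ (K n) (w n) ≤
        ENNReal.ofReal (energy δ (v : H2 d)) := fun v hv n => by
    obtain ⟨v', -, hv'⟩ := exists_sampling (δ := δ) hδ subset_rfl (convex_nonnegDiag d) (hK0 n) hv
    exact (hw n v').trans hv'
  obtain ⟨v₀, hv₀⟩ := exists_interpolation ht hμ ht01
  obtain ⟨u, φ, hφ, hu⟩ := hcompact w _ (hle v₀ hv₀)
  refine ⟨u, φ, hφ, hu, fun v => ?_⟩
  by_cases htop : continuousFunctional (nonnegDiag d) δ t μ v = ⊤
  · rw [htop]; exact le_top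
  have hv := constraint_of_continuousFunctional_ne_top ht01 htop
  rw [continuousFunctional_of_constraint hδ subset_rfl ht01 hv]
  have hliminf := (hmosco (fun n => K (φ n)) (fun n => hK0 _) (hK.comp hφ.tendsto_atTop)
    fun n => hKt _).1 u (fun n => w (φ n)) hu
  exact hliminf.trans ((liminf_le_liminf (Eventually.of_forall fun n => hle v hv (φ n))).trans
    (liminf_const _).le)
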